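/- Let $G$ be a $3$-dimensional real Lie group with Lie algebra $\mathfrak g$, and let $H$, $F$ be a left-invariant $3$-form and a left-invariant $2$-form on $G$. If $dF=0$ and $dH=-F\wedge F$, let $E_{H,F}=TG\oplus T^*G\oplus\mathbb R$ be the Courant algebroid of type $B_3$ with scalar product $\langle X+\xi+\lambda,Y+\eta+\mu\rangle=\frac12(\eta(X)+\xi(Y))+\lambda\mu$, anchor the projection to $TG$, and Dorfman bracket $$[X+\xi+\lambda,Y+\eta+\mu]=\mathcal L_XY+\mathcal L_X\eta-i_Yd\xi+2\mu\,d\lambda+i_Xi_YH-2(\mu\, i_XF-\lambda\, i_YF)+X(\mu)-Y(\lambda)+F(X,Y).$$ A $B_3$-generalized Kähler structure $(\mathcal G,\mathcal F)$ on $E=E_{H,F}$ consists of a generalized Riemannian metric $\mathcal G$, i.e. a rank $3$ subbundle $E_-\subset E$ on which $\langle\cdot,\cdot\rangle$ is negative definite (with $\mathcal G^{\mathrm{end}}=\pm\mathrm{Id}$ on $E_\pm$, $E_+=E_-^\perp$), and of an $\mathcal F\in\Gamma(\mathrm{End}\,E)$ commuting with $\mathcal G^{\mathrm{end}}$, such that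 $\mathcal F$ and $\mathcal G^{\mathrm{end}}\mathcal F$ are both $B_3$-generalized complex structures: the $i$-eigenbundle $L\subset E_{\mathbb C}$ is isotropic of rank $3$, the endomorphism vanishes on $(L\oplus\bar L)^\perp$, and the sections of $L$ are closed under the Dorfman bracket. For $\mathcal G$ in the standard form $E_-=\{X-i_Xg\mid X\in TG\}$, with $g$ a Riemannian metric, the components of $(\mathcal G,\mathcal F)$ are $(g,J_+,J_-,X_+,X_-)$, where $J_-$ corresponds to $\mathcal F|_{E_-}$ under $E_-\cong TG$, $X-i_Xg\mapsto X$; $J_+$ and $X_+$ are determined by the property that, under $E_+\cong TG\oplus\mathbb R$, $X+i_Xg+a\mapsto X+a$, the $TG$-parts of the images under $\mathcal F$ of $X\in TG$ and of $1\in\mathbb R$ are $J_+X$ and $X_+$; and $X_-$ is the $TG$-part of a section $u_0$ of $\mathrm{Ker}\,\mathcal F$ with $\langle u_0,u_0\rangle=-1$ (so $X_-$ is determined up to sign). The structure is left-invariant if all components are left-invariant; these, and $H$, $F$, are then regarded as tensors on $\mathfrak g$. Rescaling by $r\in\mathbb R\setminus\{0\}$ replaces $(g,J_\pm,X_\pm,H,F)$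 by $(r^2g,J_\pm,r^{-1}X_\pm,r^2H,rF)$. Let $g$ be a left-invariant Riemannian metric, $J_\pm$ left-invariant fields of endomorphisms of $TG$ and $X_\pm$ left-invariant vector fields on $G$. Then $dF=0$, $dH=-F\wedge F$ and $(g,J_+,J_-,X_+,X_-)$ are the components of a $B_3$-generalized Kähler structure on $E_{H,F}$ if and only if, after rescaling by some $r\neq0$ (the rescaled data being denoted by the same symbols), one of the following holds: i) there is a $g$-orthonormal basis $\{w_1,w_2,w_3\}$ of $\mathfrak g$ with $[w_1,w_2]=w_3$, $[w_2,w_3]=w_1$, $[w_3,w_1]=0$, and $X_-=w_2$, $X_+=\pm X_-$; ii) there are a $g$-orthogonal basis $\{w_1,w_2,w_3\}$ of $\mathfrak g$ and $\delta\in\mathbb R\setminus\{0\}$ with $[w_1,w_2]=w_2$, $[w_1,w_3]=[w_2,w_3]=0$, $g(w_1,w_1)=\frac1{\delta^2}$, $g(w_2,w_2)=g(w_3,w_3)=1$, and $X_-=w_3$, $X_+=\pm X_-$; iii) $\mathfrak g$ is abelian and $g(X_+,X_+)=g(X_-,X_-)=1$ ($g$ and the unit vectors $X_\pm$ being otherwise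 arbitrary); and, in all cases, $H=0$, $F=0$, and $J_+$, $J_-$ are $g$-skew-symmetric endomorphisms of $\mathfrak g$ such that $J_\pm X_\pm=0$ and $J_\pm|_{X_\pm^\perp}$ are complex structures. -/

import Mathlib

open scoped Manifold ContDiff TensorProduct

noncomputable section

namespace BnGeometry

/-! ### Fields on an `n`-dimensional manifold -/

/-- The model vector space `ℝⁿ`. -/
abbrev Mod (n : ℕ) : Type := EuclideanSpace ℝ (Fin n)

section Fields

variable (n : ℕ) (M : Type*) [TopologicalSpace M] [ChartedSpace (Mod n) M]

/-- Vector fields (not necessarily smooth). -/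
abbrev VField : Type _ := ∀ x : M, TangentSpace (𝓡 n) x

/-- Fields of covectors (not necessarily smooth). -/
abbrev CovField : Type _ := ∀ x : M, TangentSpace (𝓡 n) x →L[ℝ] ℝ

/-- Fields of alternating `k`-forms (not necessarily smooth). -/
abbrev FormField (k : ℕ) : Type _ := ∀ x : M, TangentSpace (𝓡 n) x [⋀^Fin k]→ₗ[ℝ] ℝ

/-- Fields of endomorphisms of the tangent bundle (not necessarily smooth). -/
abbrev TEndField : Type _ := ∀ x : M, TangentSpace (𝓡 n) x →ₗ[ℝ] TangentSpace (𝓡 n) x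

variable {n M}

/-- The derivative `X(f)` of a function along a vector field. -/
def dirDeriv (X : VField n M) (f : M → ℝ) : M → ℝ := fun x => mvfderiv (𝓡 n) f x (X x)

/-- The Lie bracket of vector fields. -/
abbrev lieB (X Y : VField n M) : VField n M := VectorField.mlieBracket (𝓡 n) X Y

theorem form2_add (F : FormField n M 2) (x : M) (a z w : TangentSpace (𝓡 n) x) :
    F x ![a, z + w] = F x ![a, z] + F x ![a, w] := by
  have h : ∀ t, ![a, t] = Function.update ![a, 0] 1 t := by
    intro t; ext i; fin_cases i <;> rfl
  rw [h, h z, h w, (F x).map_update_add]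

theorem form2_smul (F : FormField n M 2) (x : M) (a z : TangentSpace (𝓡 n) x) (r : ℝ) :
    F x ![a, r • z] = r * F x ![a, z] := by
  have h : ∀ t, ![a, t] = Function.update ![a, 0] 1 t := by
    intro t; ext i; fin_cases i <;> rfl
  rw [h, h z, (F x).map_update_smul, smul_eq_mul]

theorem form3_add (H : FormField n M 3) (x : M) (a b z w : TangentSpace (𝓡 n) x) :
    H x ![a, b, z + w] = H x ![a, b, z] + H x ![a, b, w] := by
  have h : ∀ t, ![a, b, t] = Function.update ![a, b, 0] 2 t := by
    intro t; ext i; fin_cases i <;> rfl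
  rw [h, h z, h w, (H x).map_update_add]

theorem form3_smul (H : FormField n M 3) (x : M) (a b z : TangentSpace (𝓡 n) x) (r : ℝ) :
    H x ![a, b, r • z] = r * H x ![a, b, z] := by
  have h : ∀ t, ![a, b, t] = Function.update ![a, b, 0] 2 t := by
    intro t; ext i; fin_cases i <;> rfl
  rw [h, h z, (H x).map_update_smul, smul_eq_mul]

end Fields

section Smooth

variable {n : ℕ} {M : Type*} [TopologicalSpace M] [ChartedSpace (Mod n) M]
  [IsManifold (𝓡 n) ∞ M]

/-- Smoothness of a vector field. -/
def SmoothVec (X : VField n M) : Prop :=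
  ContMDiff (𝓡 n) (𝓡 n).tangent ∞ (fun x => (X x : TangentBundle (𝓡 n) M))

/-- Smoothness of a one-form, as a section of the bundle `Hom(TM, ℝ)`. -/
def SmoothCov (ξ : CovField n M) : Prop :=
  ContMDiff (𝓡 n) ((𝓡 n).prod 𝓘(ℝ, Mod n →L[ℝ] ℝ)) ∞
    (fun x => Bundle.TotalSpace.mk' (Mod n →L[ℝ] ℝ)
      (E := fun x : M => TangentSpace (𝓡 n) x →L[ℝ] Bundle.Trivial M ℝ x) x (ξ x))

/-- Smoothness of a `k`-form: its values on smooth vector fields are smooth functions. -/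
def SmoothForm {k : ℕ} (θ : FormField n M k) : Prop :=
  ∀ V : Fin k → VField n M, (∀ i, SmoothVec (V i)) →
    ContMDiff (𝓡 n) 𝓘(ℝ) ∞ (fun x => θ x (fun i => V i x))

/-- A two-form `F` is closed: `dF(X, Y, Z) = 0` for all smooth vector fields. -/
def ClosedTwoForm (F : FormField n M 2) : Prop :=
  ∀ X Y Z : VField n M, SmoothVec X → SmoothVec Y → SmoothVec Z → ∀ x : M,
    dirDeriv X (fun y => F y ![Y y, Z y]) x
      - dirDeriv Y (fun y => F y ![X y, Z y]) x
      + dirDeriv Z (fun y => F y ![X y, Y y]) x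
      - F x ![lieB X Y x, Z x] + F x ![lieB X Z x, Y x] - F x ![lieB Y Z x, X x] = 0

/-- The value `dH(X, Y, Z, W)` of the exterior derivative of a three-form. -/
def dThree (H : FormField n M 3) (X Y Z W : VField n M) (x : M) : ℝ :=
  dirDeriv X (fun y => H y ![Y y, Z y, W y]) x
    - dirDeriv Y (fun y => H y ![X y, Z y, W y]) x
    + dirDeriv Z (fun y => H y ![X y, Y y, W y]) x
    - dirDeriv W (fun y => H y ![X y, Y y, Z y]) x
    - H x ![lieB X Y x, Z x, W x] + H x ![lieB X Z x, Y x, W x] - H x ![lieB X W x, Y x, Z x]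
    - H x ![lieB Y Z x, X x, W x] + H x ![lieB Y W x, X x, Z x] - H x ![lieB Z W x, X x, Y x]

/-- The value `(F ∧ F)(X, Y, Z, W)`. -/
def wedgeSq (F : FormField n M 2) (X Y Z W : VField n M) (x : M) : ℝ :=
  2 * (F x ![X x, Y x] * F x ![Z x, W x] - F x ![X x, Z x] * F x ![Y x, W x]
    + F x ![X x, W x] * F x ![Y x, Z x])

/-- The data twisting the Dorfman bracket of a Courant algebroid `E_{H,F}` of type `B_n`:
a smooth closed two-form `F` and a smooth three-form `H` with `dH = -F ∧ F`. -/
structure IsTwist (H : FormField n M 3) (F : FormField n M 2) : Prop where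
  smooth_H : SmoothForm H
  smooth_F : SmoothForm F
  closed_F : ClosedTwoForm F
  dH_eq : ∀ X Y Z W : VField n M, SmoothVec X → SmoothVec Y → SmoothVec Z → SmoothVec W →
    ∀ x : M, dThree H X Y Z W x = - wedgeSq F X Y Z W x

/-! ### The bundle `E = TM ⊕ T*M ⊕ ℝ` and its Dorfman bracket -/

variable (n) in
/-- The fibre `T_xM ⊕ T_x^*M ⊕ ℝ`. -/
abbrev Fib (x : M) : Type :=
  TangentSpace (𝓡 n) x × (TangentSpace (𝓡 n) x →L[ℝ] ℝ) × ℝ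

variable (n) in
/-- The scalar product `⟨X + ξ + λ, Y + η + μ⟩ = ½(η(X) + ξ(Y)) + λμ`. -/
def pairing (x : M) : LinearMap.BilinForm ℝ (Fib n x) :=
  LinearMap.mk₂ ℝ (fun u v => (1 / 2 : ℝ) * (v.2.1 u.1 + u.2.1 v.1) + u.2.2 * v.2.2)
    (by intro a b c; simp; ring) (by intro r a b; simp; ring)
    (by intro a b c; simp; ring) (by intro r a b; simp; ring)

variable (n M) in
/-- Smooth sections `X + ξ + λ` of `TM ⊕ T*M ⊕ ℝ`. -/
structure Sec where
  vec : VField n M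
  cov : CovField n M
  fn : M → ℝ
  smooth_vec : SmoothVec vec
  smooth_cov : SmoothCov cov
  smooth_fn : ContMDiff (𝓡 n) 𝓘(ℝ) ∞ fn

/-- The value of a section at a point. -/
def Sec.val (u : Sec n M) (x : M) : Fib n x := (u.vec x, u.cov x, u.fn x)

/-- The covector part of the Dorfman bracket of `u = X + ξ + λ` and `v = Y + η + μ` evaluated on a
vector field `Z`: the value on `Z` of
`L_X η - i_Y dξ + 2 μ dλ + i_X i_Y H - 2 (μ i_X F - λ i_Y F)`. -/
def dorfmanCovOp (H : FormField n M 3) (F : FormField n M 2) (u v : Sec n M) (x : M)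
    (Z : VField n M) : ℝ :=
  (dirDeriv u.vec (fun y => v.cov y (Z y)) x - v.cov x (lieB u.vec Z x))
    - (dirDeriv v.vec (fun y => u.cov y (Z y)) x - dirDeriv Z (fun y => u.cov y (v.vec y)) x
        - u.cov x (lieB v.vec Z x))
    + 2 * v.fn x * dirDeriv Z u.fn x
    + H x ![v.vec x, u.vec x, Z x]
    - 2 * (v.fn x * F x ![u.vec x, Z x] - u.fn x * F x ![v.vec x, Z x])

theorem mdiffAt_cov_apply {ξ : CovField n M} (hξ : SmoothCov ξ) {Z : VField n M} {x : M}
    (hZ : MDifferentiableAt (𝓡 n) (𝓡 n).tangent (fun y => (Z y : TangentBundle (𝓡 n) M)) x) :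
    MDifferentiableAt (𝓡 n) 𝓘(ℝ) (fun y => ξ y (Z y)) x := by
  have h1 := (ContMDiff.contMDiffAt hξ (x := x)).mdifferentiableAt (by simp)
  have h2 := MDifferentiableAt.clm_bundle_apply (F₁ := Mod n) (F₂ := ℝ)
    (E₁ := fun x : M => TangentSpace (𝓡 n) x) (E₂ := Bundle.Trivial M ℝ) (b := fun y : M => y)
    (ϕ := ξ) (v := Z) h1 hZ
  simp only [mdifferentiableAt_totalSpace] at h2
  exact h2.2

/-- `Z ↦ (covector part of [u, v])(Z)` is linear over functions in `Z`, so it is a covector. -/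
theorem dorfmanCovOp_tensorial (H : FormField n M 3) (F : FormField n M 2) (u v : Sec n M)
    (x : M) : TensorialAt (𝓡 n) (Mod n) (dorfmanCovOp H F u v x) x where
  smul := by
    intro f Z hf hZ
    have d1 : mvfderiv (𝓡 n) (fun y => v.cov y ((f • Z) y)) x =
        f x • mvfderiv (𝓡 n) (fun y => v.cov y (Z y)) x
          + v.cov x (Z x) • mvfderiv (𝓡 n) f x := by
      have e : (fun y => v.cov y ((f • Z) y)) = f * fun y => v.cov y (Z y) := by
        ext y; simp
      rw [e]
      exact mvfderiv_mul hf (mdiffAt_cov_apply v.smooth_cov hZ)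
    have d2 : mvfderiv (𝓡 n) (fun y => u.cov y ((f • Z) y)) x =
        f x • mvfderiv (𝓡 n) (fun y => u.cov y (Z y)) x
          + u.cov x (Z x) • mvfderiv (𝓡 n) f x := by
      have e : (fun y => u.cov y ((f • Z) y)) = f * fun y => u.cov y (Z y) := by
        ext y; simp
      rw [e]
      exact mvfderiv_mul hf (mdiffAt_cov_apply u.smooth_cov hZ)
    unfold dorfmanCovOp dirDeriv lieB
    rw [d1, d2, VectorField.mlieBracket_smul_right hf hZ,
      VectorField.mlieBracket_smul_right hf hZ]
    simp only [Pi.smul_apply', form2_smul, form3_smul]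
    simp
    ring
  add := by
    intro Z W hZ hW
    have d1 : mvfderiv (𝓡 n) (fun y => v.cov y ((Z + W) y)) x =
        mvfderiv (𝓡 n) (fun y => v.cov y (Z y)) x
          + mvfderiv (𝓡 n) (fun y => v.cov y (W y)) x := by
      have e : (fun y => v.cov y ((Z + W) y))
          = (fun y => v.cov y (Z y)) + fun y => v.cov y (W y) := by
        ext y; simp
      rw [e]
      exact mvfderiv_add (mdiffAt_cov_apply v.smooth_cov hZ) (mdiffAt_cov_apply v.smooth_cov hW)
    have d2 : mvfderiv (𝓡 n) (fun y => u.cov y ((Z + W) y)) x =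
        mvfderiv (𝓡 n) (fun y => u.cov y (Z y)) x
          + mvfderiv (𝓡 n) (fun y => u.cov y (W y)) x := by
      have e : (fun y => u.cov y ((Z + W) y))
          = (fun y => u.cov y (Z y)) + fun y => u.cov y (W y) := by
        ext y; simp
      rw [e]
      exact mvfderiv_add (mdiffAt_cov_apply u.smooth_cov hZ) (mdiffAt_cov_apply u.smooth_cov hW)
    unfold dorfmanCovOp dirDeriv lieB
    rw [d1, d2, VectorField.mlieBracket_add_right hZ hW,
      VectorField.mlieBracket_add_right hZ hW]
    simp only [Pi.add_apply, form2_add, form3_add]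
    simp
    ring

/-- The Dorfman bracket of two smooth sections, twisted by `(H, F)`. Its covector part is the
covector whose value on `Z x` is `dorfmanCovOp H F u v x Z`. -/
def dorfman (H : FormField n M 3) (F : FormField n M 2) (u v : Sec n M) (x : M) : Fib n x :=
  (lieB u.vec v.vec x,
   TensorialAt.mkHom (dorfmanCovOp H F u v x) x (dorfmanCovOp_tensorial H F u v x),
   dirDeriv u.vec v.fn x - dirDeriv v.vec u.fn x + F x ![u.vec x, v.vec x])

/-! ### Generalized metrics, generalized complex and generalized Kähler structures -/

variable (n M) in
/-- Fields of endomorphisms of `E` (not necessarily smooth). -/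
abbrev EEndField : Type _ := ∀ x : M, Fib n x →ₗ[ℝ] Fib n x

/-- A field of endomorphisms of `E` is smooth if it maps smooth sections to smooth sections. -/
def SmoothEnd (A : EEndField n M) : Prop :=
  ∀ u : Sec n M, ∃ w : Sec n M, ∀ x, w.val x = A x (u.val x)

variable (n M) in
/-- A generalized Riemannian metric: a smooth rank `n` subbundle `E₋ ⊆ E` on which the scalar
product is negative definite. The field `gend` is the endomorphism equal to `-1` on `E₋` and to
`1` on `E₊ = E₋^⊥`, which these two conditions determine; `E₋` is smooth if and only if `gend` is. -/
structure GenRiemannianMetric where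
  minus : ∀ x : M, Submodule ℝ (Fib n x)
  gend : EEndField n M
  finrank_minus : ∀ x, Module.finrank ℝ (minus x) = n
  neg_def : ∀ x, ∀ v ∈ minus x, v ≠ 0 → pairing n x v v < 0
  gend_minus : ∀ x, ∀ v ∈ minus x, gend x v = -v
  gend_plus : ∀ x v, (∀ w ∈ minus x, pairing n x v w = 0) → gend x v = v
  smooth_gend : SmoothEnd gend

variable (n) in
/-- The fibre of the complexified bundle `E_ℂ`. -/
abbrev FibC (x : M) : Type := ℂ ⊗[ℝ] Fib n x

variable (n) in
/-- The complex bilinear extension of the scalar product. -/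
def pairingC (x : M) : LinearMap.BilinForm ℂ (FibC n x) := (pairing n x).baseChange ℂ

/-- The element `a + i b` of `E_ℂ`. -/
def cx {x : M} (a b : Fib n x) : FibC n x := (1 : ℂ) ⊗ₜ[ℝ] a + Complex.I ⊗ₜ[ℝ] b

/-- The `i`-eigenbundle `L ⊆ E_ℂ` of a field of endomorphisms of `E`. -/
def iEigen (A : EEndField n M) (x : M) : Submodule ℂ (FibC n x) :=
  Module.End.eigenspace ((A x).baseChange ℂ) Complex.I

/-- `A` is a `B_n`-generalized almost complex structure: its `i`-eigenbundle `L` is an isotropic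
complex subbundle of rank `n`, and `A` vanishes on the orthogonal complement of `L ⊕ L̄` in `E`.
(As `A` is real, `L̄` is its `(-i)`-eigenbundle; so `L ∩ L̄ = 0`, and a real vector is orthogonal
to `L ⊕ L̄` if and only if it is orthogonal to `L`.) -/
structure IsBnAlmostComplex (A : EEndField n M) : Prop where
  smooth : SmoothEnd A
  rank : ∀ x, Module.finrank ℂ (iEigen A x) = n
  isotropic : ∀ x, ∀ l ∈ iEigen A x, ∀ l' ∈ iEigen A x, pairingC n x l l' = 0
  ker : ∀ (x : M) (v : Fib n x), (∀ l ∈ iEigen A x, pairingC n x ((1 : ℂ) ⊗ₜ[ℝ] v) l = 0) →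
    A x v = 0

/-- A complex subbundle of `E_ℂ` is integrable if its smooth sections `u₁ + i u₂` are closed under
the complex bilinear extension of the Dorfman bracket. -/
def DorfmanIntegrable (H : FormField n M 3) (F : FormField n M 2)
    (L : ∀ x : M, Submodule ℂ (FibC n x)) : Prop :=
  ∀ u₁ u₂ v₁ v₂ : Sec n M,
    (∀ x, cx (u₁.val x) (u₂.val x) ∈ L x) → (∀ x, cx (v₁.val x) (v₂.val x) ∈ L x) →
    ∀ x, cx (dorfman H F u₁ v₁ x - dorfman H F u₂ v₂ x)
      (dorfman H F u₁ v₂ x + dorfman H F u₂ v₁ x) ∈ L x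

/-- A `B_n`-generalized complex structure on `E_{H,F}`. -/
def IsBnComplex (H : FormField n M 3) (F : FormField n M 2) (A : EEndField n M) : Prop :=
  IsBnAlmostComplex A ∧ DorfmanIntegrable H F (iEigen A)

/-- `(𝒢, A)` is a `B_n`-generalized Kähler structure on `E_{H,F}`: `𝒢` is a generalized Riemannian
metric whose endomorphism commutes with `A`, and `A` and `𝒢^end A` are both `B_n`-generalized
complex structures. -/
structure IsBnKahler (H : FormField n M 3) (F : FormField n M 2)
    (𝒢 : GenRiemannianMetric n M) (A : EEndField n M) : Prop where
  commute : ∀ x, 𝒢.gend x ∘ₗ A x = A x ∘ₗ 𝒢.gend x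
  complex : IsBnComplex H F A
  complex₂ : IsBnComplex H F (fun x => 𝒢.gend x ∘ₗ A x)

/-! ### Components in odd dimensions -/

variable (n M) in
/-- The classical tensor fields `(g, J₊, J₋, X₊, X₋)`. -/
structure Components where
  g : Bundle.ContMDiffRiemannianMetric (𝓡 n) ∞ (Mod n) (fun x : M => TangentSpace (𝓡 n) x)
  Jp : TEndField n M
  Jm : TEndField n M
  Xp : VField n M
  Xm : VField n M

/-- `c` are the components (for odd `n`) of `(𝒢, A)`, where `𝒢` is in the standard form
`E₋ = {X - i_X g}`. Under `E₋ ≅ TM`, `X - i_X g ↦ X`, the endomorphism `A` becomes `J₋`; under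
`E₊ ≅ TM ⊕ ℝ`, `X + i_X g + a ↦ X + a`, it maps `X` to `J₊ X` and `1` to `X₊`, up to the part
in `ℝ`; and `X₋` is the vector part of a section `u₀` of `Ker A` with `⟨u₀, u₀⟩ = -1`. -/
structure Components.IsOf (c : Components n M) (𝒢 : GenRiemannianMetric n M)
    (A : EEndField n M) : Prop where
  minus_eq : ∀ (x : M) (v : Fib n x),
    v ∈ 𝒢.minus x ↔ ∃ X : TangentSpace (𝓡 n) x, v = (X, -(c.g.inner x X), 0)
  Jm_eq : ∀ (x : M) (X : TangentSpace (𝓡 n) x), c.Jm x X = (A x (X, -(c.g.inner x X), 0)).1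
  Jp_eq : ∀ (x : M) (X : TangentSpace (𝓡 n) x), c.Jp x X = (A x (X, c.g.inner x X, 0)).1
  Xp_eq : ∀ x : M, c.Xp x = (A x (0, 0, 1)).1
  Xm_eq : ∃ u₀ : Sec n M, (∀ x, A x (u₀.val x) = 0) ∧
    (∀ x, pairing n x (u₀.val x) (u₀.val x) = -1) ∧ ∀ x, c.Xm x = u₀.vec x

end Smooth

/-! ### Left-invariant fields on a Lie group, and data on its Lie algebra -/

section LieGroups

variable {n : ℕ} {G : Type*} [TopologicalSpace G] [ChartedSpace (Mod n) G] [Group G]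

/-- A form is left-invariant if its values on left-invariant vector fields are constant. -/
def LeftInvForm {k : ℕ} (θ : FormField n G k) : Prop :=
  ∀ (x : G) (v : Fin k → GroupLieAlgebra (𝓡 n) G),
    θ x (fun i => mulInvariantVectorField (v i) x) = θ 1 v

/-- A vector field is left-invariant if it is the one determined by its value at `1`. -/
def LeftInvVec (X : VField n G) : Prop :=
  ∀ x : G, X x = mulInvariantVectorField (I := 𝓡 n) (G := G) (X 1) x

/-- A field of endomorphisms `J` is left-invariant if it maps the left-invariant vector field of
each `v` in the Lie algebra to the left-invariant vector field of `J v`. -/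
def LeftInvTEnd (J : TEndField n G) : Prop :=
  ∀ (x : G) (v : GroupLieAlgebra (𝓡 n) G),
    J x (mulInvariantVectorField v x) = mulInvariantVectorField (J 1 v : GroupLieAlgebra (𝓡 n) G) x

/-- All components are left-invariant. -/
structure Components.LeftInv [IsManifold (𝓡 n) ∞ G] (c : Components n G) : Prop where
  g : ∀ (x : G) (v w : GroupLieAlgebra (𝓡 n) G),
    c.g.inner x (mulInvariantVectorField v x) (mulInvariantVectorField w x) = c.g.inner 1 v w
  Jp : LeftInvTEnd c.Jp
  Jm : LeftInvTEnd c.Jm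
  Xp : LeftInvVec c.Xp
  Xm : LeftInvVec c.Xm

end LieGroups

section Algebra

/-- Tensors `(g, J₊, J₋, X₊, X₋)` and `(H, F)` on a Lie algebra. -/
structure AlgData (𝔤 : Type*) [AddCommGroup 𝔤] [Module ℝ 𝔤] where
  g : LinearMap.BilinForm ℝ 𝔤
  Jp : 𝔤 →ₗ[ℝ] 𝔤
  Jm : 𝔤 →ₗ[ℝ] 𝔤
  Xp : 𝔤
  Xm : 𝔤
  H : 𝔤 [⋀^Fin 3]→ₗ[ℝ] ℝ
  F : 𝔤 [⋀^Fin 2]→ₗ[ℝ] ℝ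

variable {𝔤 : Type*} [AddCommGroup 𝔤] [Module ℝ 𝔤]

/-- Rescaling: `(r² g, J₊, J₋, r⁻¹ X₊, r⁻¹ X₋)` on the Courant algebroid twisted by `(r² H, r F)`. -/
def AlgData.rescale (d : AlgData 𝔤) (r : ℝ) : AlgData 𝔤 where
  g := r ^ 2 • d.g
  Jp := d.Jp
  Jm := d.Jm
  Xp := r⁻¹ • d.Xp
  Xm := r⁻¹ • d.Xm
  H := r ^ 2 • d.H
  F := r • d.F

/-- `J` is `g`-skew-symmetric, `J X = 0`, and `J` is a complex structure on `X^⊥`. -/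
structure IsAdmissibleJ (g : LinearMap.BilinForm ℝ 𝔤) (J : 𝔤 →ₗ[ℝ] 𝔤) (X : 𝔤) : Prop where
  skew : ∀ v w, g (J v) w = -g v (J w)
  apply_X : J X = 0
  perp : ∀ v, g v X = 0 → g (J v) X = 0
  sq : ∀ v, g v X = 0 → J (J v) = -v

variable [Bracket 𝔤 𝔤]

/-- A `g`-orthonormal basis with the standard bracket of `𝔦𝔰𝔬(2)`, and `X₋ = w₂`, `X₊ = ± X₋`. -/
def AlgData.IsEuclideanType (d : AlgData 𝔤) : Prop :=
  ∃ w : Module.Basis (Fin 3) ℝ 𝔤,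
    (∀ i j, d.g (w i) (w j) = if i = j then 1 else 0) ∧
    ⁅w 0, w 1⁆ = w 2 ∧ ⁅w 1, w 2⁆ = w 0 ∧ ⁅w 2, w 0⁆ = 0 ∧
    d.Xm = w 1 ∧ (d.Xp = d.Xm ∨ d.Xp = -d.Xm)

/-- A `g`-orthogonal basis with the standard bracket of `ℝ ⊕ 𝔰𝔬𝔩₂`, squared norms `1/δ², 1, 1`,
and `X₋ = w₃`, `X₊ = ± X₋`. -/
def AlgData.IsSolType (d : AlgData 𝔤) : Prop :=
  ∃ (w : Module.Basis (Fin 3) ℝ 𝔤) (δ : ℝ), δ ≠ 0 ∧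
    (∀ i j, i ≠ j → d.g (w i) (w j) = 0) ∧
    d.g (w 0) (w 0) = 1 / δ ^ 2 ∧ d.g (w 1) (w 1) = 1 ∧ d.g (w 2) (w 2) = 1 ∧
    ⁅w 0, w 1⁆ = w 1 ∧ ⁅w 0, w 2⁆ = 0 ∧ ⁅w 1, w 2⁆ = 0 ∧
    d.Xm = w 2 ∧ (d.Xp = d.Xm ∨ d.Xp = -d.Xm)

/-- The Lie algebra is abelian and `X₊`, `X₋` have norm one. -/
def AlgData.IsAbelianType (d : AlgData 𝔤) : Prop :=
  (∀ v w : 𝔤, ⁅v, w⁆ = 0) ∧ d.g d.Xp d.Xp = 1 ∧ d.g d.Xm d.Xm = 1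

/-- One of the three cases holds, `H = 0`, `F = 0`, and `J₊`, `J₋` are admissible. -/
structure AlgData.IsClassified (d : AlgData 𝔤) : Prop where
  cases : d.IsEuclideanType ∨ d.IsSolType ∨ d.IsAbelianType
  H_eq : d.H = 0
  F_eq : d.F = 0
  Jp : IsAdmissibleJ d.g d.Jp d.Xp
  Jm : IsAdmissibleJ d.g d.Jm d.Xm

end Algebra

section AtOne

variable {n : ℕ} {G : Type*} [TopologicalSpace G] [ChartedSpace (Mod n) G] [Group G]
  [IsManifold (𝓡 n) ∞ G]

/-- The tensors on the Lie algebra defined by fields on the group: their values at `1`. -/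
def Components.atOne (c : Components n G) (H : FormField n G 3) (F : FormField n G 2) :
    AlgData (GroupLieAlgebra (𝓡 n) G) where
  g := LinearMap.mk₂ ℝ (fun v w => c.g.inner 1 v w)
    (by simp) (by simp) (by simp) (by simp)
  Jp := c.Jp 1
  Jm := c.Jm 1
  Xp := c.Xp 1
  Xm := c.Xm 1
  H := H 1
  F := F 1

end AtOne

end BnGeometry

end

/-! Left-invariant sections trivialize `E`, so the problem becomes algebra on the Lie algebra `V`.
In the splitting `E₊ ⊕ E₋ = (V ⊕ ℝ) ⊕ V` the pairing is `g ⊕ 1 ⊕ (-g)`, the endomorphism is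
`AlgData.endo`, built from `J₊`, `X₊`, `J₋`, and the numbers `⟨[u, v], w⟩` for invariant sections
form the cyclic expression `AlgData.bracketForm`, which involves only the Lie bracket, `H` and `F`.

Necessity. The algebraic conditions on the `i`-eigenbundle say that `A` is skew, that `A³ = -A`, and
that `ker A` is a line (`skew_of_isotropic`). That line is spanned by a negative vector, hence lies
in `E₋`, and so `J₊`, `J₋` are admissible and `X₊`, `X₋` are unit vectors
(`AlgData.isAlmostKahler_of_endo`). The structures `A` and `𝒢^end A` differ only by the sign of
`J₋`; adding their integrability conditions isolates equations for the covariant derivatives of `X₋`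
and `X₊` (`AlgData.connection_of_isIntegrable`). The equation for `X₋` says that `X₋` is Killing and
that the differential of its dual form is given by `H`; this leaves four structure constants `p, q,
s, α` in an orthonormal basis ending in `X₋`. The equation for `X₊` then forces `H = 0` and `F = 0`,
and `X₊ = ± X₋` unless the bracket vanishes (`connection_scalars`). Finally the Jacobi identity
gives `αp = αq = 0`, which separates the Euclidean case (`α ≠ 0`), the solvable case (`α = 0`, `(p,
q) ≠ 0`) and the abelian one.

Sufficiency. With `H = F = 0`, the integrability condition on invariant sections is a polynomial
identity in coordinates (`nijenhuis_coordinates`). It extends to all sections of the eigenbundle by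
the Leibniz rules of the Dorfman bracket: the only non-tensorial term is `2⟨u, v⟩ df`, and it
vanishes because the eigenbundle is isotropic (`Components.LeftInv.dorfmanIntegrable`). -/

noncomputable section

namespace BnGeometry

/-! ### Complex structures with one-dimensional kernel -/

section Complexification

variable {E : Type*} [AddCommGroup E] [Module ℝ E]

/-- The element `a + i b` of `ℂ ⊗ E`. -/
def cplx (a b : E) : ℂ ⊗[ℝ] E := (1 : ℂ) ⊗ₜ[ℝ] a + Complex.I ⊗ₜ[ℝ] b

/-- The real part of an element of `ℂ ⊗ E`. -/
def cplxRe : ℂ ⊗[ℝ] E →ₗ[ℝ] E := (TensorProduct.lid ℝ E).toLinearMap ∘ₗ Complex.reLm.rTensor E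

/-- The imaginary part of an element of `ℂ ⊗ E`. -/
def cplxIm : ℂ ⊗[ℝ] E →ₗ[ℝ] E := (TensorProduct.lid ℝ E).toLinearMap ∘ₗ Complex.imLm.rTensor E

@[simp] theorem cplxRe_cplx (a b : E) : cplxRe (cplx a b) = a := by
  simp [cplxRe, cplx]

@[simp] theorem cplxIm_cplx (a b : E) : cplxIm (cplx a b) = b := by
  simp [cplxIm, cplx]

theorem cplx_inj {a b a' b' : E} : cplx a b = cplx a' b' ↔ a = a' ∧ b = b' := by
  constructor
  · intro h
    exact ⟨by simpa using congrArg cplxRe h, by simpa using congrArg cplxIm h⟩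
  · rintro ⟨rfl, rfl⟩; rfl

theorem cplx_add (a b a' b' : E) : cplx (a + a') (b + b') = cplx a b + cplx a' b' := by
  simp only [cplx, TensorProduct.tmul_add]; abel

theorem smul_cplx (z : ℂ) (a b : E) :
    z • cplx a b = cplx (z.re • a - z.im • b) (z.re • b + z.im • a) := by
  have h1 : (z • (1 : ℂ)) = z.re • (1 : ℂ) + z.im • Complex.I := by
    apply Complex.ext <;> simp
  have h2 : (z • Complex.I) = z.re • Complex.I - z.im • (1 : ℂ) := by
    apply Complex.ext <;> simp
  simp only [cplx, smul_add, TensorProduct.smul_tmul', h1, h2, TensorProduct.add_tmul,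
    TensorProduct.sub_tmul, TensorProduct.tmul_add, TensorProduct.tmul_sub,
    TensorProduct.tmul_smul]
  abel

theorem cplx_surj (l : ℂ ⊗[ℝ] E) : cplx (cplxRe l) (cplxIm l) = l := by
  induction l using TensorProduct.induction_on with
  | zero => simp [cplx]
  | tmul z a =>
    have : z = z.re • (1 : ℂ) + z.im • Complex.I := by apply Complex.ext <;> simp
    conv_rhs => rw [this]
    rw [TensorProduct.add_tmul, TensorProduct.smul_tmul, TensorProduct.smul_tmul]
    simp [cplx, cplxRe, cplxIm]
  | add x y hx hy => rw [map_add, map_add, cplx_add, hx, hy]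

theorem baseChange_cplx (A : E →ₗ[ℝ] E) (a b : E) :
    A.baseChange ℂ (cplx a b) = cplx (A a) (A b) := by
  simp [cplx]

theorem cplx_mem_eigenspace (A : E →ₗ[ℝ] E) (a b : E) :
    cplx a b ∈ Module.End.eigenspace (A.baseChange ℂ) Complex.I ↔ A a = -b ∧ A b = a := by
  rw [Module.End.mem_eigenspace_iff, baseChange_cplx, smul_cplx, cplx_inj]
  simp

theorem bilin_cplx (B : LinearMap.BilinForm ℝ E) (a b a' b' : E) :
    B.baseChange ℂ (cplx a b) (cplx a' b')
      = ((B a a' - B b b' : ℝ) : ℂ) + ((B a b' + B b a' : ℝ) : ℂ) * Complex.I := by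
  simp [cplx]
  ring

/-- The real subspace on which `A² = -1`. -/
def sqNegOne (A : E →ₗ[ℝ] E) : Submodule ℝ E := LinearMap.ker (A ∘ₗ A + LinearMap.id)

theorem mem_sqNegOne {A : E →ₗ[ℝ] E} {v : E} : v ∈ sqNegOne A ↔ A (A v) = -v := by
  simp [sqNegOne, add_eq_zero_iff_eq_neg]

/-- The real subspace on which `A² = -1` is isomorphic to the `i`-eigenspace. -/
def sqNegOneEquiv (A : E →ₗ[ℝ] E) :
    sqNegOne A ≃ₗ[ℝ] Module.End.eigenspace (A.baseChange ℂ) Complex.I where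
  toFun b := ⟨cplx (A b) b, (cplx_mem_eigenspace A _ _).2 ⟨mem_sqNegOne.1 b.2, rfl⟩⟩
  invFun l := ⟨cplxIm l, by
    obtain ⟨h1, h2⟩ := (cplx_mem_eigenspace A _ _).1 ((cplx_surj l.1).symm ▸ l.2)
    rw [mem_sqNegOne, h2, h1]⟩
  map_add' a b := by
    ext; simp [cplx_add]
  map_smul' r a := by
    ext; simp [cplx]
  left_inv b := by simp
  right_inv l := by
    obtain ⟨h1, h2⟩ := (cplx_mem_eigenspace A _ _).1 ((cplx_surj l.1).symm ▸ l.2)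
    ext
    simp only
    rw [h2, cplx_surj]

theorem finrank_sqNegOne (A : E →ₗ[ℝ] E) :
    Module.finrank ℝ (sqNegOne A)
      = 2 * Module.finrank ℂ (Module.End.eigenspace (A.baseChange ℂ) Complex.I) := by
  rw [(sqNegOneEquiv A).finrank_eq, ← Complex.finrank_real_complex,
    Module.finrank_mul_finrank]

theorem map_mem_sqNegOne {A : E →ₗ[ℝ] E} {v : E} (h : v ∈ sqNegOne A) : A v ∈ sqNegOne A := by
  rw [mem_sqNegOne] at h ⊢
  rw [h, map_neg]

variable [FiniteDimensional ℝ E]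

/-- The real consequences of the conditions on the `i`-eigenspace: `A` is skew-symmetric,
`A³ = -A` and the kernel of `A` is a line. -/
theorem skew_of_isotropic (B : LinearMap.BilinForm ℝ E) (hB : ∀ u v, B u v = B v u)
    (A : E →ₗ[ℝ] E) (n : ℕ) (hE : Module.finrank ℝ E = 2 * n + 1)
    (rank : Module.finrank ℂ (Module.End.eigenspace (A.baseChange ℂ) Complex.I) = n)
    (isotropic : ∀ l ∈ Module.End.eigenspace (A.baseChange ℂ) Complex.I,
      ∀ l' ∈ Module.End.eigenspace (A.baseChange ℂ) Complex.I, B.baseChange ℂ l l' = 0)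
    (ker : ∀ v : E, (∀ l ∈ Module.End.eigenspace (A.baseChange ℂ) Complex.I,
      B.baseChange ℂ ((1 : ℂ) ⊗ₜ[ℝ] v) l = 0) → A v = 0) :
    (∀ u v, B (A u) v = -B u (A v)) ∧ (∀ v, A (A (A v) + v) = 0) ∧
      (∀ u v, A u = 0 → A v = 0 → u ≠ 0 → ∃ k : ℝ, v = k • u) := by
  -- The elements of the eigenspace are `A b + i b` with `A² b = -b`; these two identities are the
  -- real and imaginary parts of isotropy.
  have iso : ∀ b ∈ sqNegOne A, ∀ b' ∈ sqNegOne A,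
      B (A b) (A b') = B b b' ∧ B (A b) b' = -B b (A b') := by
    intro b hb b' hb'
    have h := isotropic _ ((cplx_mem_eigenspace A _ _).2 ⟨mem_sqNegOne.1 hb, rfl⟩)
      _ ((cplx_mem_eigenspace A _ _).2 ⟨mem_sqNegOne.1 hb', rfl⟩)
    rw [bilin_cplx] at h
    have h1 := congrArg Complex.re h
    have h2 := congrArg Complex.im h
    simp at h1 h2
    exact ⟨by linarith, by linarith⟩
  have ker' : ∀ v, (∀ b ∈ sqNegOne A, B v b = 0) → A v = 0 := by
    intro v hv
    refine ker v fun l hl => ?_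
    have hl' := hl
    rw [← cplx_surj l, cplx_mem_eigenspace] at hl'
    have hb : cplxIm l ∈ sqNegOne A := by rw [mem_sqNegOne, hl'.2, hl'.1]
    have h1 := hv _ hb
    have h2 := hv _ (map_mem_sqNegOne hb)
    rw [hl'.2] at h2
    have e : (1 : ℂ) ⊗ₜ[ℝ] v = cplx v 0 := by simp [cplx]
    rw [← cplx_surj l, e, bilin_cplx, h1, h2]
    simp
  have dimW : Module.finrank ℝ (sqNegOne A) = 2 * n := by rw [finrank_sqNegOne, rank]
  -- The source has dimension `2n + 1` and the target `2n`, so some `k₀ ≠ 0` is orthogonal to the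
  -- subspace where `A² = -1`. The kernel condition gives `A k₀ = 0`, and `k₀` spans a complement of
  -- that subspace.
  let φ : E →ₗ[ℝ] Module.Dual ℝ (sqNegOne A) := (sqNegOne A).subtype.dualMap ∘ₗ B
  obtain ⟨k₀, hk₀, hk₀'⟩ : ∃ k ∈ LinearMap.ker φ, k ≠ 0 := by
    refine Submodule.exists_mem_ne_zero_of_ne_bot (LinearMap.ker_ne_bot_of_finrank_lt ?_)
    rw [Subspace.dual_finrank_eq]; omega
  have hφ : ∀ b ∈ sqNegOne A, B k₀ b = 0 := by
    intro b hb
    exact LinearMap.congr_fun (LinearMap.mem_ker.1 hk₀) (⟨b, hb⟩ : sqNegOne A)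
  have hAk₀ : A k₀ = 0 := ker' k₀ hφ
  have disj : ∀ v, A v = 0 → v ∈ sqNegOne A → v = 0 := by
    intro v h1 h2
    rw [mem_sqNegOne, h1, map_zero] at h2
    exact neg_eq_zero.1 h2.symm
  have decomp : ∀ v, ∃ w ∈ sqNegOne A, ∃ k : ℝ, v = w + k • k₀ := by
    have hd : Disjoint (sqNegOne A) (ℝ ∙ k₀) := by
      rw [Submodule.disjoint_def]
      intro v hv hv'
      obtain ⟨k, rfl⟩ := Submodule.mem_span_singleton.1 hv'
      exact disj _ (by rw [map_smul, hAk₀, smul_zero]) hv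
    have htop : sqNegOne A ⊔ (ℝ ∙ k₀) = ⊤ := by
      apply Submodule.eq_top_of_finrank_eq
      have h := Submodule.finrank_sup_add_finrank_inf_eq (sqNegOne A) (ℝ ∙ k₀)
      rw [hd.eq_bot, finrank_bot, finrank_span_singleton hk₀', dimW] at h
      omega
    intro v
    obtain ⟨w, hw, z, hz, h⟩ := Submodule.mem_sup.1 (htop ▸ Submodule.mem_top : v ∈ _)
    obtain ⟨k, rfl⟩ := Submodule.mem_span_singleton.1 hz
    exact ⟨w, hw, k, h.symm⟩
  refine ⟨fun u v => ?_, fun v => ?_, fun u v hu hv hu0 => ?_⟩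
  · obtain ⟨w, hw, k, rfl⟩ := decomp u
    obtain ⟨w', hw', k', rfl⟩ := decomp v
    have h1 := (iso w hw w' hw').2
    have h2 := hφ _ (map_mem_sqNegOne hw)
    have h3 := hφ _ (map_mem_sqNegOne hw')
    have h4 := hB (A w) k₀
    simp [hAk₀]
    rw [h1, h3, h4, h2]; simp
  · obtain ⟨w, hw, k, rfl⟩ := decomp v
    rw [mem_sqNegOne] at hw
    simp [hAk₀, hw]
  · have key : ∀ z, A z = 0 → ∃ k : ℝ, z = k • k₀ := by
      intro z hz
      obtain ⟨w, hw, k, rfl⟩ := decomp z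
      have : w = 0 := disj w (by simpa [hAk₀] using hz) hw
      exact ⟨k, by simp [this]⟩
    obtain ⟨a, rfl⟩ := key u hu
    obtain ⟨b, rfl⟩ := key v hv
    have ha : a ≠ 0 := by rintro rfl; simp at hu0
    exact ⟨b / a, by rw [smul_smul, div_mul_cancel₀ _ ha]⟩

/-- The conditions on the `i`-eigenspace hold for a skew-symmetric endomorphism with a negative
vector in its kernel and square `-1` on the orthogonal complement of that vector. -/
theorem isotropic_of_skew (B : LinearMap.BilinForm ℝ E)
    (nondeg : ∀ u, (∀ v, B u v = 0) → u = 0)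
    (A : E →ₗ[ℝ] E) (n : ℕ) (hE : Module.finrank ℝ E = 2 * n + 1)
    (skew : ∀ u v, B (A u) v = -B u (A v)) (u₀ : E) (hu₀ : B u₀ u₀ = -1) (hA : A u₀ = 0)
    (sq : ∀ v, B v u₀ = 0 → A (A v) = -v) :
    Module.finrank ℂ (Module.End.eigenspace (A.baseChange ℂ) Complex.I) = n ∧
    (∀ l ∈ Module.End.eigenspace (A.baseChange ℂ) Complex.I,
      ∀ l' ∈ Module.End.eigenspace (A.baseChange ℂ) Complex.I, B.baseChange ℂ l l' = 0) ∧
    (∀ v : E, (∀ l ∈ Module.End.eigenspace (A.baseChange ℂ) Complex.I,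
      B.baseChange ℂ ((1 : ℂ) ⊗ₜ[ℝ] v) l = 0) → A v = 0) := by
  -- If `A² v = -v`, then `-B(v, u₀) = B(A² v, u₀) = -B(A v, A u₀) = 0`; so the space where `A² =
  -- -1` is exactly the hyperplane orthogonal to `u₀`.
  have hW : sqNegOne A = LinearMap.ker (LinearMap.flip B u₀) := by
    ext v
    rw [mem_sqNegOne, LinearMap.mem_ker, LinearMap.flip_apply]
    refine ⟨fun h => ?_, sq v⟩
    have h1 : B (A (A v)) u₀ = 0 := by rw [skew, hA, map_zero, neg_zero]
    rw [h] at h1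
    simpa using h1
  refine ⟨?_, ?_, ?_⟩
  · have h1 := finrank_sqNegOne A
    have h2 := (LinearMap.flip B u₀).finrank_range_add_finrank_ker
    have h3 : LinearMap.range (LinearMap.flip B u₀) = ⊤ := by
      rw [LinearMap.range_eq_top]
      intro r
      exact ⟨(-r) • u₀, by simp [hu₀]⟩
    rw [h3, finrank_top, Module.finrank_self, hE, ← hW] at h2
    omega
  · intro l hl l' hl'
    rw [← cplx_surj l, cplx_mem_eigenspace] at hl
    rw [← cplx_surj l', cplx_mem_eigenspace] at hl'
    rw [← cplx_surj l, ← cplx_surj l', bilin_cplx, ← hl.2, ← hl'.2]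
    have h1 := skew (cplxIm l) (cplxIm l')
    have h2 := skew (cplxIm l) (cplxRe l')
    rw [hl.2, hl'.2] at h1
    rw [hl.2, hl'.1] at h2
    simp only [map_neg, neg_neg] at h2
    rw [hl.2, hl'.2, h1, h2]
    simp
  · intro v hv
    apply nondeg
    intro z
    rw [skew]
    have hz : A z ∈ sqNegOne A := by
      rw [hW, LinearMap.mem_ker, LinearMap.flip_apply, skew, hA, map_zero, neg_zero]
    have h := hv _ ((cplx_mem_eigenspace A _ _).2 ⟨mem_sqNegOne.1 hz, rfl⟩)
    have e : (1 : ℂ) ⊗ₜ[ℝ] v = cplx v 0 := by simp [cplx]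
    rw [e, bilin_cplx] at h
    simpa using congrArg Complex.im h

end Complexification

/-! ### Alternating forms as iterated linear maps -/

section Curry

variable {V : Type*} [AddCommGroup V] [Module ℝ V]

/-- An alternating form of degree one as a linear map. -/
def altLin₁ (f : V [⋀^Fin 1]→ₗ[ℝ] ℝ) : V →ₗ[ℝ] ℝ where
  toFun a := f.curryLeft a ![]
  map_add' a b := by rw [map_add]; rfl
  map_smul' r a := by rw [map_smul]; rfl

/-- An alternating form of degree two as a bilinear map. -/
def altLin₂ (f : V [⋀^Fin 2]→ₗ[ℝ] ℝ) : V →ₗ[ℝ] V →ₗ[ℝ] ℝ where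
  toFun a := altLin₁ (f.curryLeft a)
  map_add' a b := by rw [map_add]; rfl
  map_smul' r a := by rw [map_smul]; rfl

/-- An alternating form of degree three as a trilinear map. -/
def altLin₃ (f : V [⋀^Fin 3]→ₗ[ℝ] ℝ) : V →ₗ[ℝ] V →ₗ[ℝ] V →ₗ[ℝ] ℝ where
  toFun a := altLin₂ (f.curryLeft a)
  map_add' a b := by rw [map_add]; rfl
  map_smul' r a := by rw [map_smul]; rfl

theorem altLin₂_apply (f : V [⋀^Fin 2]→ₗ[ℝ] ℝ) (a b : V) : altLin₂ f a b = f ![a, b] := rfl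

theorem altLin₃_apply (f : V [⋀^Fin 3]→ₗ[ℝ] ℝ) (a b c : V) : altLin₃ f a b c = f ![a, b, c] := rfl

theorem altLin₂_self (f : V [⋀^Fin 2]→ₗ[ℝ] ℝ) (a : V) : altLin₂ f a a = 0 :=
  f.map_eq_zero_of_eq ![a, a] (i := 0) (j := 1) rfl (by decide)

theorem altLin₂_swap (f : V [⋀^Fin 2]→ₗ[ℝ] ℝ) (a b : V) : altLin₂ f a b = -altLin₂ f b a := by
  have h := altLin₂_self f (a + b)
  simp only [map_add, LinearMap.add_apply, altLin₂_self] at h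
  linarith

theorem altLin₃_self₁₂ (f : V [⋀^Fin 3]→ₗ[ℝ] ℝ) (a b : V) : altLin₃ f a a b = 0 :=
  f.map_eq_zero_of_eq ![a, a, b] (i := 0) (j := 1) rfl (by decide)

theorem altLin₃_self₂₃ (f : V [⋀^Fin 3]→ₗ[ℝ] ℝ) (a b : V) : altLin₃ f b a a = 0 :=
  altLin₂_self (f.curryLeft b) a

theorem altLin₃_self₁₃ (f : V [⋀^Fin 3]→ₗ[ℝ] ℝ) (a b : V) : altLin₃ f a b a = 0 :=
  f.map_eq_zero_of_eq ![a, b, a] (i := 0) (j := 2) rfl (by decide)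

theorem altLin₃_swap₁₂ (f : V [⋀^Fin 3]→ₗ[ℝ] ℝ) (a b c : V) :
    altLin₃ f a b c = -altLin₃ f b a c := by
  have h := altLin₃_self₁₂ f (a + b) c
  simp only [map_add, LinearMap.add_apply, altLin₃_self₁₂] at h
  linarith

theorem altLin₃_swap₂₃ (f : V [⋀^Fin 3]→ₗ[ℝ] ℝ) (a b c : V) :
    altLin₃ f a b c = -altLin₃ f a c b :=
  altLin₂_swap (f.curryLeft a) b c

end Curry

/-! ### Invariant sections and their brackets -/

section Invariant

variable {V : Type*} [AddCommGroup V] [Module ℝ V]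

/-- The value `⟨[u, v], w⟩` for invariant sections `u`, `v`, `w`, in the splitting
`E₊ ⊕ E₋ = (V ⊕ ℝ) ⊕ V`, where `(X, Y, t)` stands for `(X + gX + t) + (Y - gY)`. -/
def AlgData.bracketForm (d : AlgData V) (br : V →ₗ[ℝ] V →ₗ[ℝ] V) (u v w : V × V × ℝ) : ℝ :=
  (1 / 2) * (d.g (br (u.1 + u.2.1) (v.1 + v.2.1)) (w.1 - w.2.1)
      + d.g (br (v.1 + v.2.1) (w.1 + w.2.1)) (u.1 - u.2.1)
      + d.g (br (w.1 + w.2.1) (u.1 + u.2.1)) (v.1 - v.2.1))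
    - (1 / 2) * altLin₃ d.H (u.1 + u.2.1) (v.1 + v.2.1) (w.1 + w.2.1)
    + u.2.2 * altLin₂ d.F (v.1 + v.2.1) (w.1 + w.2.1)
    + v.2.2 * altLin₂ d.F (w.1 + w.2.1) (u.1 + u.2.1)
    + w.2.2 * altLin₂ d.F (u.1 + u.2.1) (v.1 + v.2.1)

/-- The endomorphism of `E₊ ⊕ E₋` with components `J₊`, `X₊`, `J₋`. -/
def AlgData.endo (d : AlgData V) : V × V × ℝ →ₗ[ℝ] V × V × ℝ where
  toFun u := (d.Jp u.1 + u.2.2 • d.Xp, d.Jm u.2.1, -d.g u.1 d.Xp)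
  map_add' u v := by
    simp only [Prod.fst_add, Prod.snd_add, map_add, LinearMap.add_apply, add_smul, Prod.mk_add_mk]
    congr 1
    · abel
    · congr 1; ring
  map_smul' r u := by
    simp [smul_smul]

theorem AlgData.endo_apply (d : AlgData V) (u : V × V × ℝ) :
    d.endo u = (d.Jp u.1 + u.2.2 • d.Xp, d.Jm u.2.1, -d.g u.1 d.Xp) := rfl

/-- The scalar product on `E₊ ⊕ E₋`. -/
def splitPairing (g : LinearMap.BilinForm ℝ V) : LinearMap.BilinForm ℝ (V × V × ℝ) :=
  LinearMap.mk₂ ℝ (fun u v => g u.1 v.1 - g u.2.1 v.2.1 + u.2.2 * v.2.2)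
    (by intro a b c; simp; ring) (by intro r a b; simp; ring)
    (by intro a b c; simp; ring) (by intro r a b; simp; ring)

theorem splitPairing_apply (g : LinearMap.BilinForm ℝ V) (u v : V × V × ℝ) :
    splitPairing g u v = g u.1 v.1 - g u.2.1 v.2.1 + u.2.2 * v.2.2 := rfl

/-- The metric is symmetric and positive definite, `J₊` and `J₋` are admissible, and `X₊` and
`X₋` are unit vectors. -/
structure AlgData.IsAlmostKahler (d : AlgData V) : Prop where
  symm : ∀ v w, d.g v w = d.g w v
  pos : ∀ v, v ≠ 0 → 0 < d.g v v
  Jp : IsAdmissibleJ d.g d.Jp d.Xp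
  Jm : IsAdmissibleJ d.g d.Jm d.Xm
  Xp : d.g d.Xp d.Xp = 1
  Xm : d.g d.Xm d.Xm = 1

/-- A vector is determined by its products with the elements of an orthonormal triple. -/
theorem basis_of_orthogonal (g : LinearMap.BilinForm ℝ V) (dim : Module.finrank ℝ V = 3)
    (v : Fin 3 → V) (h : ∀ i j, i ≠ j → g (v i) (v j) = 0) (h' : ∀ i, g (v i) (v i) ≠ 0) :
    ∃ w : Module.Basis (Fin 3) ℝ V, ∀ i, w i = v i := by
  have hl : LinearIndependent ℝ v :=
    LinearMap.linearIndependent_of_isOrthoᵢ (B := g) (fun i j hij => h i j hij) h'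
  exact ⟨basisOfLinearIndependentOfCardEqFinrank hl (by simp [dim]), by simp⟩

theorem expand_orthonormal (g : LinearMap.BilinForm ℝ V) (w : Module.Basis (Fin 3) ℝ V)
    (h : ∀ i j, g (w i) (w j) = if i = j then 1 else 0) (v : V) :
    v = g v (w 0) • w 0 + g v (w 1) • w 1 + g v (w 2) • w 2 := by
  have hv := w.sum_repr v
  rw [Fin.sum_univ_three] at hv
  have e : ∀ i, g v (w i) = w.repr v i := by
    intro i
    conv_lhs => rw [← hv]
    fin_cases i <;> simp [h]
  rw [e, e, e, hv]

end Invariant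

/-! ### Structure constants forced by the equations for `X₋` and `X₊`. -/

section Classification

variable {V : Type*} [AddCommGroup V] [Module ℝ V]

theorem basis_of_orthonormal (g : LinearMap.BilinForm ℝ V) (symm : ∀ v w, g v w = g w v)
    (dim : Module.finrank ℝ V = 3) {a b c : V}
    (haa : g a a = 1) (hbb : g b b = 1) (hcc : g c c = 1)
    (hab : g a b = 0) (hbc : g b c = 0) (hca : g c a = 0) :
    ∃ w : Module.Basis (Fin 3) ℝ V, (∀ i j, g (w i) (w j) = if i = j then 1 else 0) ∧
      w 0 = a ∧ w 1 = b ∧ w 2 = c := by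
  have hba : g b a = 0 := by rw [symm, hab]
  have hcb : g c b = 0 := by rw [symm, hbc]
  have hac : g a c = 0 := by rw [symm, hca]
  obtain ⟨w, hw⟩ := basis_of_orthogonal g dim ![a, b, c]
    (by intro i j hij; fin_cases i <;> fin_cases j <;> simp_all)
    (by intro i; fin_cases i <;> simp_all)
  refine ⟨w, ?_, hw 0, hw 1, hw 2⟩
  intro i j
  rw [hw, hw]
  fin_cases i <;> fin_cases j <;> simp_all

/-- An orthonormal basis adapted to an admissible endomorphism. -/
theorem IsAdmissibleJ.exists_basis {g : LinearMap.BilinForm ℝ V} {J : V →ₗ[ℝ] V} {X : V}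
    (h : IsAdmissibleJ g J X) (symm : ∀ v w, g v w = g w v) (pos : ∀ v, v ≠ 0 → 0 < g v v)
    (hX : g X X = 1) (dim : Module.finrank ℝ V = 3) :
    ∃ w : Module.Basis (Fin 3) ℝ V, (∀ i j, g (w i) (w j) = if i = j then 1 else 0) ∧
      w 2 = X ∧ J (w 0) = w 1 := by
  have : FiniteDimensional ℝ V := Module.finite_of_finrank_pos (by omega)
  obtain ⟨v, hv, hv0⟩ : ∃ v ∈ LinearMap.ker (LinearMap.flip g X), v ≠ 0 := by
    refine Submodule.exists_mem_ne_zero_of_ne_bot (LinearMap.ker_ne_bot_of_finrank_lt ?_)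
    rw [dim, Module.finrank_self]; norm_num
  have hv : g v X = 0 := hv
  have hpos := pos v hv0
  set a : V := (Real.sqrt (g v v))⁻¹ • v with ha
  have haX : g a X = 0 := by simp [ha, hv]
  have haa : g a a = 1 := by
    simp only [ha, map_smul, LinearMap.smul_apply, smul_eq_mul]
    have h1 := Real.mul_self_sqrt hpos.le
    have h2 := (Real.sqrt_pos.2 hpos).ne'
    field_simp
    linarith
  have hab : g a (J a) = 0 := by
    have h1 := h.skew a a
    rw [symm (J a) a] at h1
    linarith
  have hbb : g (J a) (J a) = 1 := by
    rw [h.skew, h.sq a haX, map_neg, haa, neg_neg]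
  obtain ⟨w, hw, h0, h1, h2⟩ := basis_of_orthonormal g symm dim haa hbb hX hab (h.perp a haX)
    (by rw [symm, haX])
  exact ⟨w, hw, h2, by rw [h0, h1]⟩

theorem self_eq_zero_of_skew (br : V →ₗ[ℝ] V →ₗ[ℝ] V) (skew : ∀ v w, br v w = -br w v) (v : V) :
    br v v = 0 := by
  have h : (2 : ℝ) • br v v = 0 := by
    rw [two_smul]; nth_rewrite 1 [skew]; exact neg_add_cancel _
  simpa using h

/-- The consequences of integrability for the covariant derivatives of `X₊` and `X₋`. -/
theorem AlgData.derivative_eqs (d : AlgData V) (hd : d.IsAlmostKahler)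
    (br : V →ₗ[ℝ] V →ₗ[ℝ] V) (skew : ∀ v w, br v w = -br w v)
    (h₁ : ∀ X t Y, d.bracketForm br (X, 0, t) (0, Y, 0) (0, d.Xm, 0) = 0)
    (h₂ : ∀ X t X' t' Y, d.bracketForm br (X, 0, t) (X', 0, t') (0, Y, 0)
      = d.bracketForm br (d.endo (X, 0, t)) (d.endo (X', 0, t')) (0, Y, 0)) :
    (∀ Y, altLin₂ d.F Y d.Xm = 0) ∧
    (∀ X Y, -d.g (br X Y) d.Xm + d.g (br Y d.Xm) X - d.g (br d.Xm X) Y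
      = altLin₃ d.H X Y d.Xm) ∧
    (∀ U Y, -d.g (br U d.Xp) Y + d.g (br d.Xp Y) U + d.g (br Y U) d.Xp
      - altLin₃ d.H U d.Xp Y = -2 * altLin₂ d.F Y (d.Jp U)) := by
  have hF : ∀ Y, altLin₂ d.F Y d.Xm = 0 := by
    intro Y
    simpa [AlgData.bracketForm] using h₁ 0 1 Y
  refine ⟨hF, fun X Y => ?_, ?_⟩
  · have h := h₁ X 0 Y
    simp only [AlgData.bracketForm, add_zero, zero_add, sub_zero, zero_sub, map_neg, zero_mul]
      at h
    linarith
  have key : ∀ X Y, d.g X d.Xp = 0 → -d.g (br (d.Jp X) d.Xp) Y + d.g (br d.Xp Y) (d.Jp X)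
      + d.g (br Y (d.Jp X)) d.Xp - altLin₃ d.H (d.Jp X) d.Xp Y = 2 * altLin₂ d.F Y X := by
    intro X Y hX
    -- The second section is the constant `1`, which `A` maps to `X₊`. For `X ⟂ X₊` the image `A X =
    -- J₊ X` has no scalar part, so `F` occurs on one side only.
    have h := h₂ X 0 0 1 Y
    simp only [AlgData.endo_apply, AlgData.bracketForm, add_zero, zero_add, sub_zero, zero_sub,
      map_neg, zero_mul, map_zero, zero_smul, one_smul, hX, one_mul, LinearMap.zero_apply,
      neg_zero, mul_zero] at h
    linarith
  intro U Y
  have perp : d.g (d.Jp U) d.Xp = 0 := by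
    rw [hd.Jp.skew, hd.Jp.apply_X, map_zero, neg_zero]
  have hU : d.g (U - d.g U d.Xp • d.Xp) d.Xp = 0 := by
    simp [hd.Xp]
  have hJ : d.Jp (U - d.g U d.Xp • d.Xp) = d.Jp U := by simp [hd.Jp.apply_X]
  have hJJ : d.Jp (d.Jp U) = -(U - d.g U d.Xp • d.Xp) := by rw [← hJ, hd.Jp.sq _ hU]
  -- Replacing `X` by `J₊ U` recovers `U` up to its component along `X₊`, and that component
  -- contributes zero by antisymmetry.
  have h := key (d.Jp U) Y perp
  have hs := skew d.Xp Y
  have hself : br d.Xp d.Xp = 0 := self_eq_zero_of_skew br skew _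
  rw [hJJ] at h
  simp only [map_neg, map_sub, map_smul, LinearMap.neg_apply, LinearMap.sub_apply,
    LinearMap.smul_apply, smul_eq_mul, altLin₃_self₁₂, hself, hs, LinearMap.zero_apply,
    map_zero] at h ⊢
  linarith

/-- The structure constants in an orthonormal basis whose last vector is `X₋`. -/
theorem AlgData.structure_constants (d : AlgData V) (br : V →ₗ[ℝ] V →ₗ[ℝ] V)
    (skew : ∀ v w, br v w = -br w v) (w : Module.Basis (Fin 3) ℝ V)
    (hw : ∀ i j, d.g (w i) (w j) = if i = j then 1 else 0) (hm : d.Xm = w 2)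
    (hK : ∀ X Y, -d.g (br X Y) d.Xm + d.g (br Y d.Xm) X - d.g (br d.Xm X) Y
      = altLin₃ d.H X Y d.Xm) :
    ∃ p q s α : ℝ, br (w 0) (w 1) = p • w 0 + q • w 1 + s • w 2 ∧ br (w 2) (w 0) = α • w 1 ∧
      br (w 1) (w 2) = α • w 0 ∧ altLin₃ d.H (w 0) (w 1) (w 2) = -s := by
  have hself := self_eq_zero_of_skew br skew
  have s20 : br (w 0) (w 2) = -br (w 2) (w 0) := skew _ _
  have s21 : br (w 2) (w 1) = -br (w 1) (w 2) := skew _ _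
  have s10 : br (w 1) (w 0) = -br (w 0) (w 1) := skew _ _
  have a10 := altLin₃_swap₁₂ d.H (w 1) (w 0) (w 2)
  -- The symmetric part of `hK` says that `ad X₋` is `g`-skew, so it is a rotation `α` of the plane
  -- of `w 0`, `w 1`; the antisymmetric part reads `-g([X, Y], X₋) = H(X, Y, X₋)`.
  have e00 := hK (w 0) (w 0)
  have e01 := hK (w 0) (w 1)
  have e10 := hK (w 1) (w 0)
  have e11 := hK (w 1) (w 1)
  have e20 := hK (w 2) (w 0)
  have e21 := hK (w 2) (w 1)
  simp only [hm, hself, s20, s21, s10, a10, altLin₃_self₁₂, altLin₃_self₁₃, map_neg,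
    LinearMap.neg_apply, map_zero, LinearMap.zero_apply, neg_zero] at e00 e01 e10 e11 e20 e21
  refine ⟨d.g (br (w 0) (w 1)) (w 0), d.g (br (w 0) (w 1)) (w 1), d.g (br (w 0) (w 1)) (w 2),
    d.g (br (w 2) (w 0)) (w 1), expand_orthonormal d.g w hw _, ?_, ?_, by linarith⟩
  · rw [expand_orthonormal d.g w hw (br (w 2) (w 0))]
    have h0 : d.g (br (w 2) (w 0)) (w 0) = 0 := by linarith
    have h2 : d.g (br (w 2) (w 0)) (w 2) = 0 := by linarith
    simp [h0, h2, hw]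
  · rw [expand_orthonormal d.g w hw (br (w 1) (w 2))]
    have h0 : d.g (br (w 1) (w 2)) (w 0) = d.g (br (w 2) (w 0)) (w 1) := by linarith
    have h1 : d.g (br (w 1) (w 2)) (w 1) = 0 := by linarith
    have h2 : d.g (br (w 1) (w 2)) (w 2) = 0 := by linarith
    simp [h0, h1, h2]

/-- An admissible endomorphism is the vector product with a multiple `τ X` of `X`, `τ² = 1`. -/
theorem IsAdmissibleJ.exists_cross {g : LinearMap.BilinForm ℝ V} {J : V →ₗ[ℝ] V} {X : V}
    (h : IsAdmissibleJ g J X) (symm : ∀ v w, g v w = g w v) (w : Module.Basis (Fin 3) ℝ V)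
    (hw : ∀ i j, g (w i) (w j) = if i = j then 1 else 0) {x y z : ℝ}
    (hX : X = x • w 0 + y • w 1 + z • w 2) (unit : x ^ 2 + y ^ 2 + z ^ 2 = 1) :
    ∃ τ : ℝ, τ ^ 2 = 1 ∧ J (w 0) = (τ * z) • w 1 - (τ * y) • w 2 ∧
      J (w 1) = (τ * x) • w 2 - (τ * z) • w 0 ∧ J (w 2) = (τ * y) • w 0 - (τ * x) • w 1 := by
  have sk : ∀ i j, g (J (w i)) (w j) = -g (J (w j)) (w i) := by
    intro i j; rw [h.skew, symm]
  have sk0 : ∀ i, g (J (w i)) (w i) = 0 := by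
    intro i; have := sk i i; linarith
  -- In dimension three a skew endomorphism is the vector product with some `(a, b, c)`. Since `J X
  -- = 0`, this vector is parallel to the unit vector `X`, with factor `τ = ax + by + cz`.
  obtain ⟨a, ha⟩ : ∃ a, a = g (J (w 1)) (w 2) := ⟨_, rfl⟩
  obtain ⟨b, hb⟩ : ∃ b, b = g (J (w 2)) (w 0) := ⟨_, rfl⟩
  obtain ⟨c, hc⟩ : ∃ c, c = g (J (w 0)) (w 1) := ⟨_, rfl⟩
  have J0 : J (w 0) = c • w 1 - b • w 2 := by
    rw [expand_orthonormal g w hw (J (w 0)), sk0, sk 0 2, ← hc, ← hb]; module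
  have J1 : J (w 1) = a • w 2 - c • w 0 := by
    rw [expand_orthonormal g w hw (J (w 1)), sk0, sk 1 0, ← hc, ← ha]; module
  have J2 : J (w 2) = b • w 0 - a • w 1 := by
    rw [expand_orthonormal g w hw (J (w 2)), sk0, sk 2 1, ← hb, ← ha]; module
  have hJX : J X = 0 := h.apply_X
  have k0 := congrArg (fun v => g v (w 0)) hJX
  have k1 := congrArg (fun v => g v (w 1)) hJX
  have k2 := congrArg (fun v => g v (w 2)) hJX
  simp [hX, J0, J1, J2, hw] at k0 k1 k2
  have ea : a = (a * x + b * y + c * z) * x := by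
    linear_combination (-a) * unit + y * k2 - z * k1
  have eb : b = (a * x + b * y + c * z) * y := by
    linear_combination (-b) * unit - x * k2 + z * k0
  have ec : c = (a * x + b * y + c * z) * z := by
    linear_combination (-c) * unit + x * k1 - y * k0
  set τ := a * x + b * y + c * z with hτ
  refine ⟨τ, ?_, by rw [J0, ← eb, ← ec], by rw [J1, ← ea, ← ec], by rw [J2, ← ea, ← eb]⟩
  -- `J` is isometric on `X^⊥`. The three test vectors below span `X^⊥`, and the sum of the
  -- resulting equations gives `τ² = 1` without choosing a nonzero coordinate of `X`.
  have q : ∀ v, g v X = 0 → g (J v) (J v) = g v v := by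
    intro v hv
    rw [h.skew, h.sq v hv, map_neg, neg_neg]
  have q0 := q (y • w 0 - x • w 1) (by simp [hX, hw]; ring)
  have q1 := q (z • w 0 - x • w 2) (by simp [hX, hw]; ring)
  have q2 := q (z • w 1 - y • w 2) (by simp [hX, hw]; ring)
  simp [J0, J1, J2, hw] at q0 q1 q2
  rw [ea, eb, ec] at q0 q1 q2
  linear_combination (q0 + q1 + q2) / 2 + (1 - τ ^ 2 * (x ^ 2 + y ^ 2 + z ^ 2 + 1)) * unit

/-- Bilinear extension of the values of a bracket on a basis. -/
theorem bracket_eq_zero_of_basis (br : V →ₗ[ℝ] V →ₗ[ℝ] V) (skew : ∀ v w, br v w = -br w v)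
    (w : Module.Basis (Fin 3) ℝ V) (h01 : br (w 0) (w 1) = 0) (h20 : br (w 2) (w 0) = 0)
    (h12 : br (w 1) (w 2) = 0) : br = 0 := by
  have hself := self_eq_zero_of_skew br skew
  refine w.ext fun i => w.ext fun j => ?_
  fin_cases i <;> fin_cases j <;>
    simp [hself, h01, h20, h12, skew (w 1) (w 0), skew (w 0) (w 2), skew (w 2) (w 1)]

/-- The connection equation for `X₊` forces `F = 0`, `H = 0`, and `X₊ = ± X₋` unless the Lie
algebra is abelian. -/
theorem connection_scalars {p q s α f τ x y z : ℝ} (unit : x ^ 2 + y ^ 2 + z ^ 2 = 1)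
    (hτ : τ ^ 2 = 1) (h1 : p * y = -(τ * f * z)) (h2 : p * x + s * z = 0)
    (h3 : s * y = τ * f * x) (h4 : q * y + s * z = 0) (h5 : q * x = τ * f * z)
    (h6 : s * x = -(τ * f * y)) (h7 : α * x = 0) (h8 : α * y = 0) :
    s = 0 ∧ f = 0 ∧ ((p = 0 ∧ q = 0 ∧ α = 0) ∨ (x = 0 ∧ y = 0)) := by
  have hτ0 : τ ≠ 0 := by rintro rfl; norm_num at hτ
  -- The alternative is whether `X₊ = (x, y, z)` is parallel to `X₋ = w 2`. If it is not, each
  -- unknown times `x² + y²` is a combination of two of the equations; if it is, `z ≠ 0` eliminates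
  -- `s` and `f`.
  by_cases hxy : x ^ 2 + y ^ 2 = 0
  · have hx : x = 0 := by nlinarith [sq_nonneg x, sq_nonneg y]
    have hy : y = 0 := by nlinarith [sq_nonneg x, sq_nonneg y]
    subst hx hy
    have hz : z ≠ 0 := by rintro rfl; norm_num at unit
    have hs : s = 0 := by simpa [hz] using h2
    have hf : f = 0 := by simpa [hz, hτ0] using h5
    exact ⟨hs, hf, Or.inr ⟨rfl, rfl⟩⟩
  · have hs : s = 0 := by
      have : s * (x ^ 2 + y ^ 2) = 0 := by linear_combination x * h6 + y * h3
      simpa [hxy] using this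
    have hf : f = 0 := by
      have : τ * f * (x ^ 2 + y ^ 2) = 0 := by linear_combination (-x) * h3 + y * h6
      simpa [hxy, hτ0] using this
    subst hs hf
    refine ⟨rfl, rfl, Or.inl ⟨?_, ?_, ?_⟩⟩
    · have : p * (x ^ 2 + y ^ 2) = 0 := by linear_combination x * h2 + y * h1
      simpa [hxy] using this
    · have : q * (x ^ 2 + y ^ 2) = 0 := by linear_combination x * h5 + y * h4
      simpa [hxy] using this
    · have : α * (x ^ 2 + y ^ 2) = 0 := by linear_combination x * h7 + y * h8
      simpa [hxy] using this

/-- Vanishing of `H` and `F` and the bracket relations in an orthonormal basis. -/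
theorem AlgData.normal_form (d : AlgData V) (hd : d.IsAlmostKahler)
    (dim : Module.finrank ℝ V = 3)
    (br : V →ₗ[ℝ] V →ₗ[ℝ] V) (skew : ∀ v w, br v w = -br w v)
    (jacobi : ∀ u v w, br u (br v w) = br (br u v) w + br v (br u w))
    (h₁ : ∀ X t Y, d.bracketForm br (X, 0, t) (0, Y, 0) (0, d.Xm, 0) = 0)
    (h₂ : ∀ X t X' t' Y, d.bracketForm br (X, 0, t) (X', 0, t') (0, Y, 0)
      = d.bracketForm br (d.endo (X, 0, t)) (d.endo (X', 0, t')) (0, Y, 0)) :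
    d.H = 0 ∧ d.F = 0 ∧ (br = 0 ∨ ∃ (w : Module.Basis (Fin 3) ℝ V) (p q α : ℝ),
      (∀ i j, d.g (w i) (w j) = if i = j then 1 else 0) ∧ d.Xm = w 2 ∧
      (d.Xp = d.Xm ∨ d.Xp = -d.Xm) ∧ br (w 0) (w 1) = p • w 0 + q • w 1 ∧
      br (w 2) (w 0) = α • w 1 ∧ br (w 1) (w 2) = α • w 0 ∧ α * p = 0 ∧ α * q = 0) := by
  obtain ⟨hF, hK, hE⟩ := d.derivative_eqs hd br skew h₁ h₂
  -- Only the orthonormality and `w 2 = X₋` are needed here, so the position of `J₋` in the basis is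
  -- dropped.
  obtain ⟨w, hw, hw2, -⟩ := hd.Jm.exists_basis hd.symm hd.pos hd.Xm dim
  obtain ⟨p, q, s, α, b01, b20, b12, hH⟩ := d.structure_constants br skew w hw hw2.symm hK
  obtain ⟨x, y, z, hX⟩ : ∃ x y z : ℝ, d.Xp = x • w 0 + y • w 1 + z • w 2 :=
    ⟨_, _, _, expand_orthonormal d.g w hw _⟩
  have unit : x ^ 2 + y ^ 2 + z ^ 2 = 1 := by
    have := hd.Xp
    simp [hX, hw] at this
    linarith
  obtain ⟨τ, hτ, J0, J1, J2⟩ := hd.Jp.exists_cross hd.symm w hw hX unit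
  have hself := self_eq_zero_of_skew br skew
  have s02 : br (w 0) (w 2) = -(α • w 1) := by rw [skew, b20]
  have s21 : br (w 2) (w 1) = -(α • w 0) := by rw [skew, b12]
  have s10 : br (w 1) (w 0) = -(p • w 0 + q • w 1 + s • w 2) := by rw [skew, b01]
  rw [← hw2] at hF
  obtain ⟨f, hf⟩ : ∃ f, f = altLin₂ d.F (w 0) (w 1) := ⟨_, rfl⟩
  have F10 : altLin₂ d.F (w 1) (w 0) = -f := by rw [altLin₂_swap, hf]
  have F2 : ∀ Y, altLin₂ d.F (w 2) Y = 0 := by intro Y; rw [altLin₂_swap, hF, neg_zero]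
  have E : ∀ i j, _ := fun i j => hE (w i) (w j)
  have H102 : altLin₃ d.H (w 1) (w 0) (w 2) = s := by rw [altLin₃_swap₁₂, hH, neg_neg]
  have H021 : altLin₃ d.H (w 0) (w 2) (w 1) = s := by rw [altLin₃_swap₂₃, hH, neg_neg]
  have H120 : altLin₃ d.H (w 1) (w 2) (w 0) = -s := by rw [altLin₃_swap₂₃, H102]
  have H201 : altLin₃ d.H (w 2) (w 0) (w 1) = -s := by rw [altLin₃_swap₁₂, H021]
  have H210 : altLin₃ d.H (w 2) (w 1) (w 0) = s := by rw [altLin₃_swap₁₂, H120, neg_neg]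
  have E00 := E 0 0
  have E01 := E 0 1
  have E02 := E 0 2
  have E10 := E 1 0
  have E11 := E 1 1
  have E12 := E 1 2
  have E20 := E 2 0
  have E21 := E 2 1
  simp [hX, J0, J1, J2, hself, b01, b20, b12, s02, s21, s10, hF, F2, F10, ← hf, H102, H021, H120,
    H201, H210, hH, altLin₃_self₁₂, altLin₃_self₂₃, altLin₃_self₁₃, altLin₂_self, hw]
    at E00 E01 E02 E10 E11 E12 E20 E21
  -- The parameter `f` of the scalar system is `F(w 1, w 0)`, whence the sign.
  obtain ⟨hs, hf0, hcases⟩ := connection_scalars (p := p) (q := q) (s := s) (α := α) (f := -f)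
    unit hτ (by linarith) (by linarith) (by linarith) (by linarith) (by linarith) (by linarith)
    (by linarith) (by linarith)
  rw [neg_eq_zero] at hf0
  subst hs hf0
  -- The only independent value of `H` is `H(w 0, w 1, w 2) = -s`, and that of `F` is `F(w 0, w 1)`
  -- because `F(·, X₋) = 0`.
  have hH0 : altLin₃ d.H = 0 := by
    refine w.ext fun i => w.ext fun j => w.ext fun k => ?_
    fin_cases i <;> fin_cases j <;> fin_cases k <;>
      simp [hH, H102, H021, H120, H201, H210, altLin₃_self₁₂, altLin₃_self₂₃, altLin₃_self₁₃]
  have hF0 : altLin₂ d.F = 0 := by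
    refine w.ext fun i => w.ext fun j => ?_
    fin_cases i <;> fin_cases j <;> simp [← hf, F10, F2, hF, altLin₂_self]
  refine ⟨?_, ?_, ?_⟩
  · ext v
    have e : v = ![v 0, v 1, v 2] := by ext i; fin_cases i <;> rfl
    rw [e, ← altLin₃_apply, hH0]; rfl
  · ext v
    have e : v = ![v 0, v 1] := by ext i; fin_cases i <;> rfl
    rw [e, ← altLin₂_apply, hF0]; rfl
  rcases hcases with ⟨rfl, rfl, rfl⟩ | ⟨rfl, rfl⟩
  · exact Or.inl (bracket_eq_zero_of_basis br skew w (by simp [b01]) (by simp [b20])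
      (by simp [b12]))
  -- The right-hand side vanishes and the left-hand side is `αp w₁ - αq w₀`.
  · have hj := jacobi (w 2) (w 0) (w 1)
    simp only [b01, b20, s21, map_add, map_smul, map_neg, hself, zero_smul, add_zero,
      smul_zero, LinearMap.smul_apply, neg_zero] at hj
    have hj0 := congrArg (fun v => d.g v (w 0)) hj
    have hj1 := congrArg (fun v => d.g v (w 1)) hj
    simp [hw] at hj0 hj1
    have hz : z = 1 ∨ z = -1 := by
      exact mul_self_eq_one_iff.1 (by linarith)
    refine Or.inr ⟨w, p, q, α, hw, hw2.symm, ?_, by simpa using b01, b20, b12, ?_, ?_⟩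
    · rw [hX, ← hw2]
      rcases hz with rfl | rfl
      · left; simp
      · right; simp
    · rcases hj1 with h | h <;> simp [h]
    · rcases hj0 with h | h <;> simp [h]

end Classification

/-! ### Passage between structure constants and the three normal forms. -/

section Classification

variable {V : Type*} [AddCommGroup V] [Module ℝ V]

theorem IsAdmissibleJ.rescale {g : LinearMap.BilinForm ℝ V} {J : V →ₗ[ℝ] V} {X : V}
    (h : IsAdmissibleJ g J X) {r : ℝ} (hr : r ≠ 0) : IsAdmissibleJ (r ^ 2 • g) J (r⁻¹ • X) where
  skew v w := by simp [h.skew v w]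
  apply_X := by simp [h.apply_X]
  perp v hv := by
    have : g v X = 0 := by simpa [hr] using hv
    simp [h.perp v this]
  sq v hv := h.sq v (by simpa [hr] using hv)

variable [Bracket V V]

theorem AlgData.exists_classified (d : AlgData V) (hd : d.IsAlmostKahler)
    (dim : Module.finrank ℝ V = 3)
    (br : V →ₗ[ℝ] V →ₗ[ℝ] V) (hbr : ∀ v w : V, ⁅v, w⁆ = br v w) (skew : ∀ v w, br v w = -br w v)
    (jacobi : ∀ u v w, br u (br v w) = br (br u v) w + br v (br u w))
    (h₁ : ∀ X t Y, d.bracketForm br (X, 0, t) (0, Y, 0) (0, d.Xm, 0) = 0)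
    (h₂ : ∀ X t X' t' Y, d.bracketForm br (X, 0, t) (X', 0, t') (0, Y, 0)
      = d.bracketForm br (d.endo (X, 0, t)) (d.endo (X', 0, t')) (0, Y, 0)) :
    ∃ r : ℝ, r ≠ 0 ∧ (d.rescale r).IsClassified := by
  obtain ⟨hH, hF, h⟩ := d.normal_form hd dim br skew jacobi h₁ h₂
  suffices h : ∃ r : ℝ, r ≠ 0 ∧ ((d.rescale r).IsEuclideanType ∨ (d.rescale r).IsSolType ∨
      (d.rescale r).IsAbelianType) by
    obtain ⟨r, hr, h⟩ := h
    exact ⟨r, hr, h, by simp [AlgData.rescale, hH], by simp [AlgData.rescale, hF],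
      hd.Jp.rescale hr, hd.Jm.rescale hr⟩
  have abelian : br = 0 → (d.rescale 1).IsAbelianType := fun h =>
    ⟨fun v w => by rw [hbr, h]; rfl, by simp [AlgData.rescale, hd.Xp],
      by simp [AlgData.rescale, hd.Xm]⟩
  rcases h with h | ⟨w, p, q, α, hw, hm, hpm, b01, b20, b12, hp, hq⟩
  · exact ⟨1, one_ne_zero, Or.inr (Or.inr (abelian h))⟩
  have hself := self_eq_zero_of_skew br skew
  have s02 : br (w 0) (w 2) = -(α • w 1) := by rw [skew, b20]
  have s21 : br (w 2) (w 1) = -(α • w 0) := by rw [skew, b12]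
  have s10 : br (w 1) (w 0) = -(p • w 0 + q • w 1) := by rw [skew, b01]
  by_cases hα : α = 0
  · subst hα
    by_cases hpq : p ^ 2 + q ^ 2 = 0
    · have hp0 : p = 0 := by nlinarith [sq_nonneg p, sq_nonneg q]
      have hq0 : q = 0 := by nlinarith [sq_nonneg p, sq_nonneg q]
      exact ⟨1, one_ne_zero, Or.inr (Or.inr (abelian
        (bracket_eq_zero_of_basis br skew w (by simp [b01, hp0, hq0]) (by simp [b20])
          (by simp [b12]))))⟩
    -- `N` is the length of `[w 0, w 1]` and serves as `δ`. The second new basis vector is the unit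
    -- vector along `[w 0, w 1]`; the first is orthogonal to it in the same plane, with the length
    -- `1/N` that makes its bracket with the second equal to the second. No rescaling is needed.
    · obtain ⟨N, hN, hN0⟩ : ∃ N : ℝ, N ^ 2 = p ^ 2 + q ^ 2 ∧ N ≠ 0 := by
        refine ⟨Real.sqrt (p ^ 2 + q ^ 2), Real.sq_sqrt (by positivity), ?_⟩
        rw [Real.sqrt_ne_zero (by positivity)]
        exact hpq
      refine ⟨1, one_ne_zero, Or.inr (Or.inl ?_)⟩
      have g00 : d.g ((N ^ 2)⁻¹ • (q • w 0 - p • w 1)) ((N ^ 2)⁻¹ • (q • w 0 - p • w 1))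
          = 1 / N ^ 2 := by
        simp [hw]
        field_simp
        linarith
      have g11 : d.g (N⁻¹ • (p • w 0 + q • w 1)) (N⁻¹ • (p • w 0 + q • w 1)) = 1 := by
        simp [hw]
        field_simp
        linarith
      have g01 : d.g ((N ^ 2)⁻¹ • (q • w 0 - p • w 1)) (N⁻¹ • (p • w 0 + q • w 1)) = 0 := by
        simp [hw]
        field_simp
        simp
      have g02 : d.g ((N ^ 2)⁻¹ • (q • w 0 - p • w 1)) (w 2) = 0 := by simp [hw]
      have g12 : d.g (N⁻¹ • (p • w 0 + q • w 1)) (w 2) = 0 := by simp [hw]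
      have g10 := g01
      have g20 := g02
      have g21 := g12
      rw [hd.symm] at g10 g20 g21
      obtain ⟨b, hb⟩ := basis_of_orthogonal d.g dim
        ![(N ^ 2)⁻¹ • (q • w 0 - p • w 1), N⁻¹ • (p • w 0 + q • w 1), w 2]
        (by
          intro i j hij
          fin_cases i <;> fin_cases j <;> first | exact absurd rfl hij | assumption)
        (by
          intro i
          fin_cases i
          · exact g00.trans_ne (by positivity)
          · exact g11.trans_ne one_ne_zero
          · exact (by simp [hw] : d.g (w 2) (w 2) = 1).trans_ne one_ne_zero)
      have hb0 : b 0 = (N ^ 2)⁻¹ • (q • w 0 - p • w 1) := hb 0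
      have hb1 : b 1 = N⁻¹ • (p • w 0 + q • w 1) := hb 1
      have hb2 : b 2 = w 2 := hb 2
      refine ⟨b, N, hN0, ?_, ?_, ?_, ?_, ?_, ?_, ?_, ?_, ?_⟩
      · intro i j hij
        simp only [AlgData.rescale, one_pow, one_smul, hb]
        fin_cases i <;> fin_cases j <;> first | exact absurd rfl hij | assumption
      · simpa only [AlgData.rescale, one_pow, one_smul, hb0] using g00
      · simpa only [AlgData.rescale, one_pow, one_smul, hb1] using g11
      · simp [AlgData.rescale, hb2, hw]
      · rw [hbr, hb0, hb1]
        simp only [map_smul, map_add, map_sub, LinearMap.smul_apply, LinearMap.sub_apply, hself,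
          b01, s10, smul_zero, sub_zero, zero_sub]
        have : N⁻¹ • (p • w 0 + q • w 1)
            = ((N ^ 2)⁻¹ * N ^ 2) • N⁻¹ • (p • w 0 + q • w 1) := by
          rw [inv_mul_cancel₀ (pow_ne_zero 2 hN0), one_smul]
        rw [this, hN]
        module
      · rw [hbr, hb0, hb2]
        simp [s02, b12]
      · rw [hbr, hb1, hb2]
        simp [s02, b12]
      · simp [AlgData.rescale, hb2, hm]
      · simpa [AlgData.rescale] using hpm
  · obtain rfl : p = 0 := by simpa [hα] using hp
    obtain rfl : q = 0 := by simpa [hα] using hq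
    -- The factor `-α` normalizes the rotation speed of `ad X₋`. Dividing the basis by `-α` keeps it
    -- orthonormal for the rescaled metric, and exchanging `w 1` and `w 2` puts `X₋` in the second
    -- place; the sign of the factor compensates the change of orientation.
    refine ⟨-α, neg_ne_zero.2 hα, Or.inl ?_⟩
    have hG : ∀ u v : V, ((-α) ^ 2 • d.g) ((-α)⁻¹ • u) ((-α)⁻¹ • v) = d.g u v := by
      intro u v
      simp
      field_simp
    obtain ⟨b, hb, hb0, hb1, hb2⟩ := basis_of_orthonormal ((-α) ^ 2 • d.g)
      (by intro u v; simp [hd.symm u v]) dim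
      (a := (-α)⁻¹ • w 0) (b := (-α)⁻¹ • w 2) (c := (-α)⁻¹ • w 1)
      (by simp only [hG]; simp [hw]) (by simp only [hG]; simp [hw]) (by simp only [hG]; simp [hw])
      (by simp only [hG]; simp [hw]) (by simp only [hG]; simp [hw]) (by simp only [hG]; simp [hw])
    refine ⟨b, hb, ?_, ?_, ?_, ?_, ?_⟩
    · rw [hbr, hb0, hb1, hb2]
      simp [s02, smul_smul, hα]
    · rw [hbr, hb0, hb1, hb2]
      simp [s21, smul_smul, hα]
    · rw [hbr, hb0, hb2]
      simp [s10]
    · simp [AlgData.rescale, hb1, hm]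
    · rcases hpm with h | h
      · left; simp [AlgData.rescale, h]
      · right; simp [AlgData.rescale, h]

/-- The consequences of the classification that are used to show integrability. -/
theorem AlgData.IsClassified.normal_form (d : AlgData V) {r : ℝ} (hr : r ≠ 0)
    (h : (d.rescale r).IsClassified) (symm : ∀ v w, d.g v w = d.g w v)
    (pos : ∀ v, v ≠ 0 → 0 < d.g v v) (dim : Module.finrank ℝ V = 3)
    (br : V →ₗ[ℝ] V →ₗ[ℝ] V) (hbr : ∀ v w : V, ⁅v, w⁆ = br v w)
    (skew : ∀ v w, br v w = -br w v) :
    d.H = 0 ∧ d.F = 0 ∧ d.IsAlmostKahler ∧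
    (br = 0 ∨ ∃ (w : Module.Basis (Fin 3) ℝ V) (p q α : ℝ),
      (∀ i j, d.g (w i) (w j) = if i = j then 1 else 0) ∧ d.Xm = w 2 ∧
      (d.Xp = d.Xm ∨ d.Xp = -d.Xm) ∧ br (w 0) (w 1) = p • w 0 + q • w 1 ∧
      br (w 2) (w 0) = α • w 1 ∧ br (w 1) (w 2) = α • w 0) := by
  have hJp : IsAdmissibleJ d.g d.Jp d.Xp := by
    have := h.Jp.rescale (inv_ne_zero hr)
    simpa [AlgData.rescale, smul_smul, hr] using this
  have hJm : IsAdmissibleJ d.g d.Jm d.Xm := by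
    have := h.Jm.rescale (inv_ne_zero hr)
    simpa [AlgData.rescale, smul_smul, hr] using this
  refine ⟨by simpa [AlgData.rescale, hr] using h.H_eq, by simpa [AlgData.rescale, hr] using h.F_eq,
    ?_⟩
  have hG : ∀ u v : V, d.g (r • u) (r • v) = (r ^ 2 • d.g) u v := by
    intro u v
    simp; ring
  have pm : ∀ {X Y : V}, (r⁻¹ • X = r⁻¹ • Y ∨ r⁻¹ • X = -(r⁻¹ • Y)) → (X = Y ∨ X = -Y) := by
    intro X Y h
    rw [← smul_neg] at h
    exact h.imp (fun h => smul_right_injective V (inv_ne_zero hr) h)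
      (fun h => smul_right_injective V (inv_ne_zero hr) h)
  have kahler : d.g d.Xm d.Xm = 1 → (d.Xp = d.Xm ∨ d.Xp = -d.Xm) → d.IsAlmostKahler := by
    intro h1 h2
    refine ⟨symm, pos, hJp, hJm, ?_, h1⟩
    rcases h2 with h2 | h2 <;> simp [h2, h1]
  rcases h.cases with ⟨w, hw, b01, b12, b20, hm, hpm⟩ |
    ⟨w, δ, hδ, hw, g0, g1, g2, b01, b02, b12, hm, hpm⟩ |
    ⟨h0, hp, hm⟩
  · have hpm := pm hpm
    have hm : d.Xm = r • w 1 := by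
      rw [← hm]; simp [AlgData.rescale, smul_smul, hr]
    have hw : ∀ i j, (r ^ 2 • d.g) (w i) (w j) = if i = j then 1 else 0 := hw
    -- Inverse of the normalization: multiply by `r` and move `X₋` to the last place, which gives `p
    -- = q = 0` and `α = -r`.
    obtain ⟨e, he, he0, he1, he2⟩ := basis_of_orthonormal d.g symm dim
      (a := r • w 0) (b := r • w 2) (c := r • w 1)
      (by rw [hG, hw]; simp) (by rw [hG, hw]; simp) (by rw [hG, hw]; simp)
      (by rw [hG, hw]; simp) (by rw [hG, hw]; simp) (by rw [hG, hw]; simp)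
    rw [hbr] at b01 b12 b20
    refine ⟨kahler (by rw [hm, hG, hw]; simp) hpm,
      Or.inr ⟨e, 0, 0, -r, he, by rw [hm, he2], hpm, ?_, ?_, ?_⟩⟩
    · rw [he0, he1, skew]; simp [b20]
    · rw [he0, he1, he2, skew]; simp [b01]
    · rw [he0, he1, he2, skew]; simp [b12]
  · have hpm := pm hpm
    have hm : d.Xm = r • w 2 := by
      rw [← hm]; simp [AlgData.rescale, smul_smul, hr]
    have hw : ∀ i j, i ≠ j → (r ^ 2 • d.g) (w i) (w j) = 0 := hw
    have g0 : (r ^ 2 • d.g) (w 0) (w 0) = 1 / δ ^ 2 := g0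
    have g1 : (r ^ 2 • d.g) (w 1) (w 1) = 1 := g1
    have g2 : (r ^ 2 • d.g) (w 2) (w 2) = 1 := g2
    -- The factor `δ` makes the first vector a unit vector; the structure constants become `p = α =
    -- 0` and `q = rδ`.
    obtain ⟨e, he, he0, he1, he2⟩ := basis_of_orthonormal d.g symm dim
      (a := r • δ • w 0) (b := r • w 1) (c := r • w 2)
      (by
        rw [hG, map_smul, map_smul, LinearMap.smul_apply, g0]
        simp; field_simp)
      (by rw [hG, g1]) (by rw [hG, g2])
      (by rw [hG, map_smul, LinearMap.smul_apply, hw 0 1 (by decide), smul_zero])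
      (by rw [hG, hw 1 2 (by decide)])
      (by rw [hG, map_smul, hw 2 0 (by decide), smul_zero])
    rw [hbr] at b01 b12 b02
    refine ⟨kahler (by rw [hm, hG, g2]) hpm,
      Or.inr ⟨e, 0, r * δ, 0, he, by rw [hm, he2], hpm, ?_, ?_, ?_⟩⟩
    · rw [he0, he1]; simp [b01, smul_smul]; ring_nf
    · rw [he0, he2, skew]; simp [b02]
    · rw [he1, he2]; simp [b12]
  · refine ⟨⟨symm, pos, hJp, hJm, ?_, ?_⟩, Or.inl ?_⟩
    · have hp : (r ^ 2 • d.g) (r⁻¹ • d.Xp) (r⁻¹ • d.Xp) = 1 := hp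
      rwa [← hG, smul_inv_smul₀ hr] at hp
    · have hm : (r ^ 2 • d.g) (r⁻¹ • d.Xm) (r⁻¹ • d.Xm) = 1 := hm
      rwa [← hG, smul_inv_smul₀ hr] at hm
    · ext v w
      rw [← hbr, h0]; rfl

end Classification

/-! ### Integrability on invariant sections. -/

section Integrability

variable {V : Type*} [AddCommGroup V] [Module ℝ V]

/-- The value `g([a, b], c)` in coordinates. -/
def structureForm (p q α a0 a1 a2 b0 b1 b2 c0 c1 : ℝ) : ℝ :=
  (a0 * b1 - a1 * b0) * (p * c0 + q * c1)
    + α * ((a2 * b0 - a0 * b2) * c1 + (a1 * b2 - a2 * b1) * c0)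

theorem bracket_coordinates (g : LinearMap.BilinForm ℝ V) (br : V →ₗ[ℝ] V →ₗ[ℝ] V)
    (skew : ∀ v w, br v w = -br w v) (w : Module.Basis (Fin 3) ℝ V)
    (hw : ∀ i j, g (w i) (w j) = if i = j then 1 else 0) {p q α : ℝ}
    (b01 : br (w 0) (w 1) = p • w 0 + q • w 1) (b20 : br (w 2) (w 0) = α • w 1)
    (b12 : br (w 1) (w 2) = α • w 0) (a0 a1 a2 b0 b1 b2 c0 c1 c2 : ℝ) :
    g (br (a0 • w 0 + a1 • w 1 + a2 • w 2) (b0 • w 0 + b1 • w 1 + b2 • w 2))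
      (c0 • w 0 + c1 • w 1 + c2 • w 2) = structureForm p q α a0 a1 a2 b0 b1 b2 c0 c1 := by
  have hself := self_eq_zero_of_skew br skew
  have s02 : br (w 0) (w 2) = -(α • w 1) := by rw [skew, b20]
  have s21 : br (w 2) (w 1) = -(α • w 0) := by rw [skew, b12]
  have s10 : br (w 1) (w 0) = -(p • w 0 + q • w 1) := by rw [skew, b01]
  simp [hself, b01, b20, b12, s02, s21, s10, hw, structureForm]
  ring

/-- The value `⟨[u, v], w⟩` for invariant sections in coordinates; the first three arguments are
the coordinates in `E₊`, the other ones those in `E₋`. -/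
def bracketCoord (p q α x0 x1 x2 y0 y1 y2 x0' x1' x2' y0' y1' y2' x0'' x1'' x2'' y0'' y1'' y2'' : ℝ) :
    ℝ :=
  (1 / 2) * (structureForm p q α (x0 + y0) (x1 + y1) (x2 + y2) (x0' + y0') (x1' + y1') (x2' + y2')
      (x0'' - y0'') (x1'' - y1'')
    + structureForm p q α (x0' + y0') (x1' + y1') (x2' + y2') (x0'' + y0'') (x1'' + y1'')
      (x2'' + y2'') (x0 - y0) (x1 - y1)
    + structureForm p q α (x0'' + y0'') (x1'' + y1'') (x2'' + y2'') (x0 + y0) (x1 + y1) (x2 + y2)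
      (x0' - y0') (x1' - y1'))

/-- This is the whole computation behind sufficiency. `σ` and `ρ` are the senses of rotation of `J₊`
and `J₋` in the plane orthogonal to `X₋`, and `ε` is the sign in `X₊ = ε X₋`. For each of the eight
choices of signs it is a polynomial identity, valid for arbitrary `p`, `q`, `α`. The last coordinate
in `E₋` of the first two sections is zero, as they are orthogonal to `ker A`. -/
theorem nijenhuis_coordinates (p q α : ℝ) {σ ε ρ : ℝ} (hσ : σ = 1 ∨ σ = -1) (hε : ε = 1 ∨ ε = -1)
    (hρ : ρ = 1 ∨ ρ = -1)
    (x0 x1 x2 y0 y1 t x0' x1' x2' y0' y1' t' x0'' x1'' x2'' y0'' y1'' y2'' t'' : ℝ) :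
    bracketCoord p q α x0 x1 x2 y0 y1 0 x0' x1' x2' y0' y1' 0 x0'' x1'' x2'' y0'' y1'' y2''
    - bracketCoord p q α (-σ * x1) (σ * x0) (t * ε) (-ρ * y1) (ρ * y0) 0
      (-σ * x1') (σ * x0') (t' * ε) (-ρ * y1') (ρ * y0') 0 x0'' x1'' x2'' y0'' y1'' y2''
    - bracketCoord p q α x0 x1 x2 y0 y1 0 (-σ * x1') (σ * x0') (t' * ε) (-ρ * y1') (ρ * y0') 0
      (-σ * x1'') (σ * x0'') (t'' * ε) (-ρ * y1'') (ρ * y0'') 0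
    - bracketCoord p q α (-σ * x1) (σ * x0) (t * ε) (-ρ * y1) (ρ * y0) 0 x0' x1' x2' y0' y1' 0
      (-σ * x1'') (σ * x0'') (t'' * ε) (-ρ * y1'') (ρ * y0'') 0 = 0 := by
  rcases hσ with rfl | rfl <;> rcases hε with rfl | rfl <;> rcases hρ with rfl | rfl <;>
  · simp only [bracketCoord, structureForm]
    ring

/-- The data with `J₋` replaced by `-J₋`; they describe `𝒢^end A` instead of `A`. -/
def AlgData.conj (d : AlgData V) : AlgData V := { d with Jm := -d.Jm }

theorem IsAdmissibleJ.neg {g : LinearMap.BilinForm ℝ V} {J : V →ₗ[ℝ] V} {X : V}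
    (h : IsAdmissibleJ g J X) : IsAdmissibleJ g (-J) X where
  skew v w := by simp [h.skew v w]
  apply_X := by simp [h.apply_X]
  perp v hv := by simp [h.perp v hv]
  sq v hv := by simp [h.sq v hv]

theorem AlgData.IsAlmostKahler.conj {d : AlgData V} (hd : d.IsAlmostKahler) :
    d.conj.IsAlmostKahler :=
  { hd with Jm := hd.Jm.neg }

/-- Integrability of the `i`-eigenbundle on invariant sections. -/
def AlgData.IsIntegrable (d : AlgData V) (br : V →ₗ[ℝ] V →ₗ[ℝ] V) : Prop :=
  ∀ u v w : V × V × ℝ, d.g u.2.1 d.Xm = 0 → d.g v.2.1 d.Xm = 0 →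
    d.bracketForm br u v w - d.bracketForm br (d.endo u) (d.endo v) w
      - d.bracketForm br u (d.endo v) (d.endo w) - d.bracketForm br (d.endo u) v (d.endo w) = 0

theorem AlgData.bracketForm_coordinates (d : AlgData V) (hH : d.H = 0) (hF : d.F = 0)
    (br : V →ₗ[ℝ] V →ₗ[ℝ] V) (skew : ∀ v w, br v w = -br w v) (w : Module.Basis (Fin 3) ℝ V)
    (hw : ∀ i j, d.g (w i) (w j) = if i = j then 1 else 0) {p q α : ℝ}
    (b01 : br (w 0) (w 1) = p • w 0 + q • w 1) (b20 : br (w 2) (w 0) = α • w 1)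
    (b12 : br (w 1) (w 2) = α • w 0)
    (x0 x1 x2 y0 y1 y2 t x0' x1' x2' y0' y1' y2' t' x0'' x1'' x2'' y0'' y1'' y2'' t'' : ℝ) :
    d.bracketForm br
      (x0 • w 0 + x1 • w 1 + x2 • w 2, y0 • w 0 + y1 • w 1 + y2 • w 2, t)
      (x0' • w 0 + x1' • w 1 + x2' • w 2, y0' • w 0 + y1' • w 1 + y2' • w 2, t')
      (x0'' • w 0 + x1'' • w 1 + x2'' • w 2, y0'' • w 0 + y1'' • w 1 + y2'' • w 2, t'')
    = bracketCoord p q α x0 x1 x2 y0 y1 y2 x0' x1' x2' y0' y1' y2' x0'' x1'' x2'' y0'' y1'' y2'' := by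
  have hadd : ∀ a0 a1 a2 b0 b1 b2 : ℝ, (a0 • w 0 + a1 • w 1 + a2 • w 2)
      + (b0 • w 0 + b1 • w 1 + b2 • w 2)
      = (a0 + b0) • w 0 + (a1 + b1) • w 1 + (a2 + b2) • w 2 := by intros; module
  have hsub : ∀ a0 a1 a2 b0 b1 b2 : ℝ, (a0 • w 0 + a1 • w 1 + a2 • w 2)
      - (b0 • w 0 + b1 • w 1 + b2 • w 2)
      = (a0 - b0) • w 0 + (a1 - b1) • w 1 + (a2 - b2) • w 2 := by intros; module
  have h3 : altLin₃ (0 : V [⋀^Fin 3]→ₗ[ℝ] ℝ) = 0 := rfl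
  have h2 : altLin₂ (0 : V [⋀^Fin 2]→ₗ[ℝ] ℝ) = 0 := rfl
  simp only [AlgData.bracketForm, hH, hF, h2, h3, LinearMap.zero_apply, mul_zero, sub_zero,
    add_zero, hadd, hsub, bracket_coordinates d.g br skew w hw b01 b20 b12, bracketCoord]

theorem AlgData.isIntegrable (d : AlgData V) (hd : d.IsAlmostKahler) (hH : d.H = 0) (hF : d.F = 0)
    (br : V →ₗ[ℝ] V →ₗ[ℝ] V) (skew : ∀ v w, br v w = -br w v)
    (h : br = 0 ∨ ∃ (w : Module.Basis (Fin 3) ℝ V) (p q α : ℝ),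
      (∀ i j, d.g (w i) (w j) = if i = j then 1 else 0) ∧ d.Xm = w 2 ∧
      (d.Xp = d.Xm ∨ d.Xp = -d.Xm) ∧ br (w 0) (w 1) = p • w 0 + q • w 1 ∧
      br (w 2) (w 0) = α • w 1 ∧ br (w 1) (w 2) = α • w 0) : d.IsIntegrable br := by
  rcases h with rfl | ⟨w, p, q, α, hw, hm, hpm, b01, b20, b12⟩
  · have h3 : altLin₃ (0 : V [⋀^Fin 3]→ₗ[ℝ] ℝ) = 0 := rfl
    have h2 : altLin₂ (0 : V [⋀^Fin 2]→ₗ[ℝ] ℝ) = 0 := rfl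
    intro u v w _ _
    simp [AlgData.bracketForm, hH, hF, h2, h3]
  have hXm : d.Xm = (0 : ℝ) • w 0 + (0 : ℝ) • w 1 + (1 : ℝ) • w 2 := by simp [hm]
  obtain ⟨ρ, hρ, m0, m1, m2⟩ := hd.Jm.exists_cross hd.symm w hw hXm (by norm_num)
  obtain ⟨ε, hε, hXp⟩ : ∃ ε : ℝ, (ε = 1 ∨ ε = -1) ∧
      d.Xp = (0 : ℝ) • w 0 + (0 : ℝ) • w 1 + ε • w 2 := by
    rcases hpm with h | h
    · exact ⟨1, Or.inl rfl, by simp [h, hm]⟩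
    · exact ⟨-1, Or.inr rfl, by simp [h, hm]⟩
  obtain ⟨τ, hτ, p0, p1, p2⟩ := hd.Jp.exists_cross hd.symm w hw hXp
    (by rcases hε with rfl | rfl <;> norm_num)
  have hρ : ρ = 1 ∨ ρ = -1 := mul_self_eq_one_iff.1 (by rw [← sq, hρ])
  -- `J₊` is the vector product with `τ X₊ = τε w₂`, so `τε` is its sense of rotation with respect
  -- to `w 0`, `w 1`.
  have hσ : τ * ε = 1 ∨ τ * ε = -1 := by
    rcases mul_self_eq_one_iff.1 ((sq τ).symm.trans hτ) with rfl | rfl <;> rcases hε with rfl | rfl <;> simp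
  have endo : ∀ x0 x1 x2 y0 y1 y2 t : ℝ,
      d.endo (x0 • w 0 + x1 • w 1 + x2 • w 2, y0 • w 0 + y1 • w 1 + y2 • w 2, t)
      = ((-(τ * ε) * x1) • w 0 + (τ * ε * x0) • w 1 + (t * ε) • w 2,
        (-ρ * y1) • w 0 + (ρ * y0) • w 1 + (0 : ℝ) • w 2, -(x2 * ε)) := by
    intros
    rw [AlgData.endo_apply]
    refine Prod.ext ?_ (Prod.ext ?_ ?_)
    · simp only [map_add, map_smul, p0, p1, p2, hXp]; module
    · simp only [map_add, map_smul, m0, m1, m2]; module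
    · simp [hXp, hw, mul_comm]
  have coord : ∀ u : V × V × ℝ, ∃ x0 x1 x2 y0 y1 y2 t : ℝ,
      u = (x0 • w 0 + x1 • w 1 + x2 • w 2, y0 • w 0 + y1 • w 1 + y2 • w 2, t) := fun u =>
    ⟨_, _, _, _, _, _, u.2.2, Prod.ext (expand_orthonormal d.g w hw _)
      (Prod.ext (expand_orthonormal d.g w hw _) rfl)⟩
  intro u v z hu hv
  obtain ⟨x0, x1, x2, y0, y1, y2, t, rfl⟩ := coord u
  obtain ⟨x0', x1', x2', y0', y1', y2', t', rfl⟩ := coord v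
  obtain ⟨x0'', x1'', x2'', y0'', y1'', y2'', t'', rfl⟩ := coord z
  obtain rfl : y2 = 0 := by simpa [hm, hw] using hu
  obtain rfl : y2' = 0 := by simpa [hm, hw] using hv
  simp only [endo, d.bracketForm_coordinates hH hF br skew w hw b01 b20 b12]
  exact nijenhuis_coordinates p q α hσ hε hρ _ _ _ _ _ _ _ _ _ _ _ _ _ _ _ _ _ _ _

theorem AlgData.bracketForm_neg₁ (d : AlgData V) (br : V →ₗ[ℝ] V →ₗ[ℝ] V) (u v w : V × V × ℝ) :
    d.bracketForm br (-u) v w = -d.bracketForm br u v w := by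
  simp only [AlgData.bracketForm, Prod.fst_neg, Prod.snd_neg, map_add, map_sub, map_neg,
    LinearMap.add_apply, LinearMap.neg_apply]
  ring

theorem AlgData.bracketForm_neg₂ (d : AlgData V) (br : V →ₗ[ℝ] V →ₗ[ℝ] V) (u v w : V × V × ℝ) :
    d.bracketForm br u (-v) w = -d.bracketForm br u v w := by
  simp only [AlgData.bracketForm, Prod.fst_neg, Prod.snd_neg, map_add, map_sub, map_neg,
    LinearMap.add_apply, LinearMap.neg_apply]
  ring

theorem AlgData.bracketForm_neg₃ (d : AlgData V) (br : V →ₗ[ℝ] V →ₗ[ℝ] V) (u v w : V × V × ℝ) :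
    d.bracketForm br u v (-w) = -d.bracketForm br u v w := by
  simp only [AlgData.bracketForm, Prod.fst_neg, Prod.snd_neg, map_add, map_sub, map_neg,
    LinearMap.add_apply, LinearMap.neg_apply]
  ring

/-- Integrability on invariant sections of the structures given by `J₋` and by `-J₋` yields the
equations satisfied by the covariant derivatives of `X₋` and `X₊`. -/
theorem AlgData.connection_of_isIntegrable (d : AlgData V) (hd : d.IsAlmostKahler)
    (br : V →ₗ[ℝ] V →ₗ[ℝ] V) (skew : ∀ v w, br v w = -br w v)
    (h : d.IsIntegrable br) (h' : d.conj.IsIntegrable br) :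
    (∀ X t Y, d.bracketForm br (X, 0, t) (0, Y, 0) (0, d.Xm, 0) = 0) ∧
    (∀ X t X' t' Y, d.bracketForm br (X, 0, t) (X', 0, t') (0, Y, 0)
      = d.bracketForm br (d.endo (X, 0, t)) (d.endo (X', 0, t')) (0, Y, 0)) := by
  have e : ∀ u v w, d.conj.bracketForm br u v w = d.bracketForm br u v w := fun u v w => rfl
  have n₂ := d.bracketForm_neg₂ br
  have n₃ := d.bracketForm_neg₃ br
  have z₃ : ∀ u v, d.bracketForm br u v 0 = 0 := by
    intro u v
    simp [AlgData.bracketForm]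
  have eminus : ∀ Y, d.conj.endo (0, Y, 0) = -d.endo (0, Y, 0) := by
    intro Y
    simp [AlgData.endo_apply, AlgData.conj]
  have eplus : ∀ X t, d.conj.endo (X, 0, t) = d.endo (X, 0, t) := by
    intro X t
    simp [AlgData.endo_apply, AlgData.conj]
  have ezero : d.endo (0, d.Xm, 0) = 0 := by
    simp [AlgData.endo_apply, hd.Jm.apply_X]
  constructor
  -- `A` kills the third argument `X₋`, so only `⟨[u, v], X₋⟩ - ⟨[A u, A v], X₋⟩` remains. Replacing
  -- `J₋` by `-J₋` changes the sign of the second term, hence both terms vanish.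
  · have key : ∀ X t Y, d.g Y d.Xm = 0 →
        d.bracketForm br (X, 0, t) (0, Y, 0) (0, d.Xm, 0) = 0 := by
      intro X t Y hY
      have h1 := h (X, 0, t) (0, Y, 0) (0, d.Xm, 0) (by simp) hY
      have h2 := h' (X, 0, t) (0, Y, 0) (0, d.Xm, 0) (by simp) hY
      simp only [e, eminus, eplus, ezero, n₂, z₃, neg_zero] at h1 h2
      linarith
    intro X t Y
    -- The component of `Y` along `X₋` contributes zero by antisymmetry of the expression in its
    -- last two arguments.
    have h1 := key X t (Y - d.g Y d.Xm • d.Xm) (by simp [hd.Xm])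
    have hself := self_eq_zero_of_skew br skew d.Xm
    have hs := skew d.Xm X
    simp only [AlgData.bracketForm, add_zero, zero_add, sub_zero, zero_sub, map_neg, zero_mul,
      map_sub, map_smul, LinearMap.sub_apply, LinearMap.smul_apply, smul_eq_mul,
      altLin₃_self₂₃, altLin₂_self, hself, hs, LinearMap.zero_apply, map_zero,
      LinearMap.neg_apply, mul_zero, neg_neg] at h1 ⊢
    linarith
  · intro X t X' t' Y
    -- For two sections of `E₊` tested on `E₋`, the terms containing `A Y` are odd in `J₋` and
    -- cancel in the sum of the two conditions.
    have h1 := h (X, 0, t) (X', 0, t') (0, Y, 0) (by simp) (by simp)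
    have h2 := h' (X, 0, t) (X', 0, t') (0, Y, 0) (by simp) (by simp)
    simp only [e, eminus, eplus, n₃] at h1 h2
    linarith

/-! ### Linear algebra of the split fibre -/

theorem AlgData.IsAlmostKahler.endo_skew {d : AlgData V} (hd : d.IsAlmostKahler)
    (u v : V × V × ℝ) :
    splitPairing d.g (d.endo u) v = -splitPairing d.g u (d.endo v) := by
  simp only [splitPairing_apply, AlgData.endo_apply, map_add, map_smul, LinearMap.add_apply,
    LinearMap.smul_apply, smul_eq_mul, hd.Jp.skew u.1, hd.Jm.skew u.2.1, hd.symm d.Xp v.1]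
  ring

/-- On `X₊^⊥` and on `X₋^⊥` this is the square of `J₊` and of `J₋`; in the remaining plane of `E₊`
the endomorphism maps `1` to `X₊` and `X₊` to `-1`. -/
theorem AlgData.IsAlmostKahler.endo_endo {d : AlgData V} (hd : d.IsAlmostKahler)
    (u : V × V × ℝ) (hu : d.g u.2.1 d.Xm = 0) : d.endo (d.endo u) = -u := by
  have h : ∀ X, d.Jp (d.Jp X) = -(X - d.g X d.Xp • d.Xp) := by
    intro X
    rw [← hd.Jp.sq _ (by simp [hd.Xp] : d.g (X - d.g X d.Xp • d.Xp) d.Xp = 0)]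
    simp [hd.Jp.apply_X]
  have h' : d.g (d.Jp u.1) d.Xp = 0 := by rw [hd.Jp.skew, hd.Jp.apply_X, map_zero, neg_zero]
  refine Prod.ext ?_ (Prod.ext ?_ ?_)
  · simp [AlgData.endo_apply, h, hd.Jp.apply_X]
    abel
  · simp [AlgData.endo_apply, hd.Jm.sq _ hu]
  · simp [AlgData.endo_apply, h', hd.Xp]

theorem splitPairing_nondegenerate {g : LinearMap.BilinForm ℝ V}
    (pos : ∀ v, v ≠ 0 → 0 < g v v) (u : V × V × ℝ) (hu : ∀ v, splitPairing g u v = 0) : u = 0 := by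
  -- Reversing the sign of the `E₋` part turns the indefinite pairing into a sum of three
  -- nonnegative terms.
  have h := hu (u.1, -u.2.1, u.2.2)
  simp only [splitPairing_apply, map_neg, sub_neg_eq_add] at h
  have nonneg : ∀ v, 0 ≤ g v v := fun v => by
    by_cases hv : v = 0
    · simp [hv]
    · exact (pos v hv).le
  have h1 := nonneg u.1
  have h2 := nonneg u.2.1
  have h3 := mul_self_nonneg u.2.2
  refine Prod.ext ?_ (Prod.ext ?_ ?_)
  · by_contra hne
    have := pos _ hne
    linarith
  · by_contra hne
    have := pos _ hne
    linarith
  · exact mul_self_eq_zero.1 (by linarith)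

end Integrability

/-! ### Left-invariant vector fields and their brackets. -/

section LeftTranslation

variable {n : ℕ} {G : Type*} [TopologicalSpace G] [ChartedSpace (Mod n) G] [Group G]

/-- The left translation of the Lie algebra to the tangent space at `x`. -/
def leftTrans (x : G) : GroupLieAlgebra (𝓡 n) G →ₗ[ℝ] TangentSpace (𝓡 n) x where
  toFun v := mulInvariantVectorField v x
  map_add' v w := by rw [mulInvariantVectorField_add]; rfl
  map_smul' r v := by rw [mulInvariantVectorField_smul]; rfl

end LeftTranslation

section LeftInvariant

open Bundle

variable {n : ℕ} {G : Type*} [TopologicalSpace G] [ChartedSpace (Mod n) G] [Group G]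
  [LieGroup (𝓡 n) ∞ G]

variable (n G) in
theorem lieGroup_minSmoothness : LieGroup (𝓡 n) (minSmoothness ℝ 3) G :=
  LieGroup.of_le (n := ∞) (by
    rw [minSmoothness_of_isRCLikeNormedField]
    exact ENat.LEInfty.out)

/-- Left-invariant vector fields are smooth. -/
theorem smoothVec_mulInvariant (v : GroupLieAlgebra (𝓡 n) G) :
    SmoothVec (mulInvariantVectorField v : VField n G) := by
  -- The invariant field at `g` is the differential of the multiplication applied to `(0_g, v)`, a
  -- composition of smooth maps.
  let fg : G → TangentBundle (𝓡 n) G := fun g ↦ TotalSpace.mk' (Mod n) g 0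
  have sfg : ContMDiff (𝓡 n) (𝓡 n).tangent ∞ fg := contMDiff_zeroSection _ _
  let fv : G → TangentBundle (𝓡 n) G := fun _ ↦ TotalSpace.mk' (Mod n) 1 v
  have sfv : ContMDiff (𝓡 n) (𝓡 n).tangent ∞ fv := contMDiff_const
  let F₁ : G → (TangentBundle (𝓡 n) G × TangentBundle (𝓡 n) G) := fun g ↦ (fg g, fv g)
  have S₁ : ContMDiff (𝓡 n) ((𝓡 n).tangent.prod (𝓡 n).tangent) ∞ F₁ := sfg.prodMk sfv
  let F₂ : (TangentBundle (𝓡 n) G × TangentBundle (𝓡 n) G) →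
      TangentBundle ((𝓡 n).prod (𝓡 n)) (G × G) :=
    (equivTangentBundleProd (𝓡 n) G (𝓡 n) G).symm
  have S₂ : ContMDiff ((𝓡 n).tangent.prod (𝓡 n).tangent) ((𝓡 n).prod (𝓡 n)).tangent ∞ F₂ :=
    contMDiff_equivTangentBundleProd_symm
  let F₃ : TangentBundle ((𝓡 n).prod (𝓡 n)) (G × G) → TangentBundle (𝓡 n) G :=
    tangentMap ((𝓡 n).prod (𝓡 n)) (𝓡 n) (fun (p : G × G) ↦ p.1 * p.2)
  have S₃ : ContMDiff ((𝓡 n).prod (𝓡 n)).tangent (𝓡 n).tangent ∞ F₃ := by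
    apply ContMDiff.contMDiff_tangentMap (n := ∞) _ (m := ∞) (by simp)
    exact contMDiff_mul (𝓡 n) ∞
  let S := (S₃.comp S₂).comp S₁
  unfold SmoothVec
  convert! S with g
  · simp [F₁, F₂, F₃, fg, fv]
  · simp only [Function.comp_apply, tangentMap, F₃, F₂, F₁, fg, fv]
    rw [mfderiv_prod_eq_add_apply ((contMDiff_mul (𝓡 n) ∞).mdifferentiableAt (by simp))]
    have h : mfderiv (𝓡 n) (𝓡 n) (fun z : G => z * 1) g 0 = 0 := map_zero _
    exact ((congrArg (fun w : Mod n => w +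
      (show Mod n from mfderiv (𝓡 n) (𝓡 n) (fun z : G => g * z) 1 v)) h).trans
      (zero_add (M := Mod n) _)).symm

variable (n G) in
/-- The bracket of the Lie algebra as a bilinear map. -/
def lieBilin : GroupLieAlgebra (𝓡 n) G →ₗ[ℝ] GroupLieAlgebra (𝓡 n) G →ₗ[ℝ]
    GroupLieAlgebra (𝓡 n) G :=
  haveI := lieGroup_minSmoothness n G
  LinearMap.mk₂ ℝ (fun v w => ⁅v, w⁆) (fun _ _ _ => add_lie _ _ _) (fun _ _ _ => smul_lie _ _ _)
    (fun _ _ _ => lie_add _ _ _) (fun _ _ _ => lie_smul _ _ _)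

theorem lieBilin_skew (v w : GroupLieAlgebra (𝓡 n) G) :
    lieBilin n G v w = -lieBilin n G w v := by
  have := lieGroup_minSmoothness n G
  exact (lie_skew v w).symm

theorem lieBilin_jacobi (u v w : GroupLieAlgebra (𝓡 n) G) :
    lieBilin n G u (lieBilin n G v w)
      = lieBilin n G (lieBilin n G u v) w + lieBilin n G v (lieBilin n G u w) := by
  have := lieGroup_minSmoothness n G
  exact leibniz_lie u v w

theorem lieB_mulInvariant (v w : GroupLieAlgebra (𝓡 n) G) (x : G) :
    lieB (mulInvariantVectorField v) (mulInvariantVectorField w) x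
      = mulInvariantVectorField (lieBilin n G v w) x := by
  have := lieGroup_minSmoothness n G
  exact (congrFun (mulInvariantVector_mlieBracket v w) x).symm

theorem mdifferentiableAt_leftTrans (x : G) (v : GroupLieAlgebra (𝓡 n) G) :
    MDifferentiableAt (𝓡 n) (𝓡 n).tangent
      (fun y : G => (leftTrans y v : TangentBundle (𝓡 n) G)) x :=
  (smoothVec_mulInvariant v).contMDiffAt.mdifferentiableAt (by simp)

end LeftInvariant

/-! ### Smooth sections, fibre dimensions and values of invariant forms. -/

section DirDeriv

variable {n : ℕ} {M : Type*} [TopologicalSpace M] [ChartedSpace (Mod n) M]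

theorem dirDeriv_const (X : VField n M) (r : ℝ) (x : M) : dirDeriv X (fun _ => r) x = 0 := by
  unfold dirDeriv
  rw [mvfderiv_const]; rfl

end DirDeriv

section Smoothness

variable {n : ℕ} {M : Type*} [TopologicalSpace M] [ChartedSpace (Mod n) M]
  [IsManifold (𝓡 n) ∞ M]

theorem smoothCov_inner (c : Components n M) {X : VField n M} (hX : SmoothVec X) :
    SmoothCov (fun x => c.g.inner x (X x)) :=
  ContMDiff.clm_bundle_apply (F₁ := Mod n) (F₂ := Mod n →L[ℝ] ℝ)
    (E₁ := fun x : M => TangentSpace (𝓡 n) x)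
    (E₂ := fun x : M => TangentSpace (𝓡 n) x →L[ℝ] Bundle.Trivial M ℝ x) (b := fun y : M => y)
    c.g.contMDiff hX

theorem contMDiff_cov_apply {ξ : CovField n M} (hξ : SmoothCov ξ) {X : VField n M}
    (hX : SmoothVec X) : ContMDiff (𝓡 n) 𝓘(ℝ) ∞ (fun x => ξ x (X x)) := by
  have h := ContMDiff.clm_bundle_apply (F₁ := Mod n) (F₂ := ℝ)
    (E₁ := fun x : M => TangentSpace (𝓡 n) x) (E₂ := Bundle.Trivial M ℝ) (b := fun y : M => y)
    (ϕ := ξ) (v := X) hξ hX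
  intro x
  have h2 := h x
  simp only [Bundle.contMDiffAt_totalSpace] at h2
  exact h2.2

theorem contMDiff_inner (c : Components n M) {X Y : VField n M} (hX : SmoothVec X)
    (hY : SmoothVec Y) : ContMDiff (𝓡 n) 𝓘(ℝ) ∞ (fun x => c.g.inner x (X x) (Y x)) :=
  contMDiff_cov_apply (smoothCov_inner c hX) hY

theorem Sec.ext_val {u v : Sec n M} (h : ∀ x, u.val x = v.val x) : u = v := by
  obtain ⟨X, ξ, f, _, _, _⟩ := u
  obtain ⟨Y, η, g, _, _, _⟩ := v
  have h1 : X = Y := funext fun x => congrArg (fun p : Fib n x => p.1) (h x)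
  have h2 : ξ = η := funext fun x => congrArg (fun p : Fib n x => p.2.1) (h x)
  have h3 : f = g := funext fun x => congrArg (fun p : Fib n x => p.2.2) (h x)
  subst h1 h2 h3
  rfl

/-- The sum of two sections. -/
def Sec.add (u v : Sec n M) : Sec n M where
  vec := u.vec + v.vec
  cov := fun x => u.cov x + v.cov x
  fn := u.fn + v.fn
  smooth_vec := ContMDiff.add_section u.smooth_vec v.smooth_vec
  smooth_cov := ContMDiff.add_section u.smooth_cov v.smooth_cov
  smooth_fn := u.smooth_fn.add v.smooth_fn

/-- The product of a smooth function and a section. -/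
def Sec.smul (f : M → ℝ) (hf : ContMDiff (𝓡 n) 𝓘(ℝ) ∞ f) (u : Sec n M) : Sec n M where
  vec := f • u.vec
  cov := fun x => f x • u.cov x
  fn := f * u.fn
  smooth_vec := ContMDiff.smul_section hf u.smooth_vec
  smooth_cov := ContMDiff.smul_section hf u.smooth_cov
  smooth_fn := hf.mul u.smooth_fn

theorem Sec.val_add (u v : Sec n M) (x : M) : (u.add v).val x = u.val x + v.val x := rfl

theorem Sec.val_smul (f : M → ℝ) (hf : ContMDiff (𝓡 n) 𝓘(ℝ) ∞ f) (u : Sec n M) (x : M) :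
    (u.smul f hf).val x = f x • u.val x := rfl

theorem Sec.mdifferentiableAt_vec (u : Sec n M) (x : M) :
    MDifferentiableAt (𝓡 n) (𝓡 n).tangent (fun y => (u.vec y : TangentBundle (𝓡 n) M)) x :=
  u.smooth_vec.contMDiffAt.mdifferentiableAt (by simp)

end Smoothness

section Dimensions

variable {n : ℕ} {M : Type*} [TopologicalSpace M] [ChartedSpace (Mod n) M]

theorem finrank_tangentSpace (x : M) : Module.finrank ℝ (TangentSpace (𝓡 n) x) = n := by
  have : Module.finrank ℝ (Mod n) = n := by simp
  exact this

instance finiteDimensional_tangentSpace (x : M) : FiniteDimensional ℝ (TangentSpace (𝓡 n) x) :=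
  inferInstanceAs (FiniteDimensional ℝ (Mod n))

instance finiteDimensional_cotangentSpace (x : M) :
    FiniteDimensional ℝ (TangentSpace (𝓡 n) x →L[ℝ] ℝ) :=
  inferInstanceAs (FiniteDimensional ℝ (Mod n →L[ℝ] ℝ))

theorem finrank_cotangentSpace (x : M) :
    Module.finrank ℝ (TangentSpace (𝓡 n) x →L[ℝ] ℝ) = n := by
  have h : Module.finrank ℝ (Mod n →L[ℝ] ℝ) = n := by
    rw [← (LinearMap.toContinuousLinearMap (𝕜 := ℝ) (E := Mod n) (F' := ℝ)).finrank_eq]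
    simp
  exact h

theorem finrank_fib (x : M) : Module.finrank ℝ (Fib n x) = 2 * n + 1 := by
  rw [Module.finrank_prod, Module.finrank_prod, finrank_tangentSpace, finrank_cotangentSpace,
    Module.finrank_self]
  ring

end Dimensions

section InvariantForms

variable {n : ℕ} {G : Type*} [TopologicalSpace G] [ChartedSpace (Mod n) G] [Group G]

theorem LeftInvForm.apply₂ {F : FormField n G 2} (hF : LeftInvForm F) (x : G)
    (a b : GroupLieAlgebra (𝓡 n) G) : F x ![leftTrans x a, leftTrans x b] = F 1 ![a, b] := by
  rw [← hF x ![a, b]]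
  congr 1
  ext i; fin_cases i <;> rfl

theorem LeftInvForm.apply₃ {H : FormField n G 3} (hH : LeftInvForm H) (x : G)
    (a b c : GroupLieAlgebra (𝓡 n) G) :
    H x ![leftTrans x a, leftTrans x b, leftTrans x c] = H 1 ![a, b, c] := by
  rw [← hH x ![a, b, c]]
  congr 1
  ext i; fin_cases i <;> rfl

end InvariantForms

/-! ### The trivialization of `E` by invariant sections. -/

section InvariantSections

variable {n : ℕ} {G : Type*} [TopologicalSpace G] [ChartedSpace (Mod n) G] [Group G]
  [LieGroup (𝓡 n) ∞ G]

variable (n G) in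
/-- The model of the fibres of `E₊ ⊕ E₋`. -/
abbrev SplitFib : Type _ := GroupLieAlgebra (𝓡 n) G × GroupLieAlgebra (𝓡 n) G × ℝ

/-- The left-invariant section of `E` determined by a vector of the split fibre. -/
def Components.invSec (c : Components n G) (p : SplitFib n G) : Sec n G where
  vec x := leftTrans x (p.1 + p.2.1)
  cov x := c.g.inner x (leftTrans x (p.1 - p.2.1))
  fn _ := p.2.2
  smooth_vec := smoothVec_mulInvariant _
  smooth_cov := smoothCov_inner c (smoothVec_mulInvariant (p.1 - p.2.1))
  smooth_fn := contMDiff_const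

theorem dorfman_cov_apply (H : FormField n G 3) (F : FormField n G 2) (u v : Sec n G) (x : G)
    (z : GroupLieAlgebra (𝓡 n) G) :
    (dorfman H F u v x).2.1 (leftTrans x z)
      = dorfmanCovOp H F u v x (fun y => leftTrans y z) :=
  TensorialAt.mkHom_apply (I := 𝓡 n) (F := Mod n) (Φ := dorfmanCovOp H F u v x)
    (dorfmanCovOp_tensorial H F u v x) (σ := fun y => leftTrans y z)
    (mdifferentiableAt_leftTrans x z)

theorem Components.LeftInv.inner_leftTrans {c : Components n G} (hc : c.LeftInv) (x : G)
    (v w : GroupLieAlgebra (𝓡 n) G) :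
    c.g.inner x (leftTrans x v) (leftTrans x w) = c.g.inner 1 v w := hc.g x v w

/-- All products of invariant sections are constant, so every derivative in the Dorfman bracket
vanishes and only brackets of invariant fields and values of `H` and `F` remain. This reduces
integrability to the Lie algebra. -/
theorem Components.LeftInv.pairing_dorfman {c : Components n G} (hc : c.LeftInv)
    {H : FormField n G 3} {F : FormField n G 2} (hH : LeftInvForm H) (hF : LeftInvForm F)
    (p q r : SplitFib n G) (x : G) :
    pairing n x (dorfman H F (c.invSec p) (c.invSec q) x) ((c.invSec r).val x)
      = (c.atOne H F).bracketForm (lieBilin n G) p q r := by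
  have hb : ∀ v w : GroupLieAlgebra (𝓡 n) G,
      lieB (fun y => leftTrans y v) (fun y => leftTrans y w) x = leftTrans x (lieBilin n G v w) :=
    fun v w => lieB_mulInvariant v w x
  have h1 : (dorfman H F (c.invSec p) (c.invSec q) x).1
      = leftTrans x (lieBilin n G (p.1 + p.2.1) (q.1 + q.2.1)) := hb _ _
  have h2 : dorfmanCovOp H F (c.invSec p) (c.invSec q) x (fun y => leftTrans y (r.1 + r.2.1))
      = 0 - c.g.inner 1 (q.1 - q.2.1) (lieBilin n G (p.1 + p.2.1) (r.1 + r.2.1))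
        - (0 - 0 - c.g.inner 1 (p.1 - p.2.1) (lieBilin n G (q.1 + q.2.1) (r.1 + r.2.1))) + 0
        + H 1 ![q.1 + q.2.1, p.1 + p.2.1, r.1 + r.2.1]
        - 2 * (q.2.2 * F 1 ![p.1 + p.2.1, r.1 + r.2.1]
          - p.2.2 * F 1 ![q.1 + q.2.1, r.1 + r.2.1]) := by
    simp only [dorfmanCovOp, Components.invSec, dirDeriv_const, hF.apply₂, hH.apply₃, hb,
      hc.inner_leftTrans, mul_zero]
  have h3 : (dorfman H F (c.invSec p) (c.invSec q) x).2.2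
      = F 1 ![p.1 + p.2.1, q.1 + q.2.1] := by
    simp only [dorfman, Components.invSec, dirDeriv_const, hF.apply₂, sub_zero, zero_add]
  have h4 : pairing n x (dorfman H F (c.invSec p) (c.invSec q) x) ((c.invSec r).val x)
      = (1 / 2 : ℝ) * (c.g.inner x (leftTrans x (r.1 - r.2.1))
          (dorfman H F (c.invSec p) (c.invSec q) x).1
        + (dorfman H F (c.invSec p) (c.invSec q) x).2.1 (leftTrans x (r.1 + r.2.1)))
        + (dorfman H F (c.invSec p) (c.invSec q) x).2.2 * r.2.2 := rfl
  rw [h4, h1, dorfman_cov_apply, h2, h3, hc.inner_leftTrans]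
  have e : ∀ v w, (c.atOne H F).g v w = c.g.inner 1 v w := fun _ _ => rfl
  have e3 : ∀ a b d, H 1 ![a, b, d] = altLin₃ (c.atOne H F).H a b d := fun _ _ _ => rfl
  have e2 : ∀ a b, F 1 ![a, b] = altLin₂ (c.atOne H F).F a b := fun _ _ => rfl
  simp only [← e, e2, e3, AlgData.bracketForm]
  have symm : ∀ v w, (c.atOne H F).g v w = (c.atOne H F).g w v := fun v w => c.g.symm 1 v w
  rw [altLin₃_swap₁₂ _ (q.1 + q.2.1) (p.1 + p.2.1),
    altLin₂_swap _ (p.1 + p.2.1) (r.1 + r.2.1),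
    symm (p.1 - p.2.1), symm (q.1 - q.2.1), symm (r.1 - r.2.1),
    lieBilin_skew (r.1 + r.2.1) (p.1 + p.2.1), map_neg, LinearMap.neg_apply]
  ring

/-- The trivialization of `E` by left-invariant sections. -/
def Components.splitMap (c : Components n G) (x : G) : SplitFib n G →ₗ[ℝ] Fib n x where
  toFun p := (c.invSec p).val x
  map_add' p q := by
    simp only [Sec.val, Components.invSec, Prod.fst_add, Prod.snd_add, map_add, map_sub,
      Prod.mk_add_mk]
    congr 1
    · abel
    · congr 1; abel
  map_smul' r p := by
    simp [Sec.val, Components.invSec, smul_sub, smul_add]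

theorem Components.splitMap_apply (c : Components n G) (x : G) (p : SplitFib n G) :
    c.splitMap x p = (leftTrans x (p.1 + p.2.1), c.g.inner x (leftTrans x (p.1 - p.2.1)), p.2.2) :=
  rfl

theorem Components.LeftInv.pairing_splitMap {c : Components n G} (hc : c.LeftInv)
    (H : FormField n G 3) (F : FormField n G 2) (x : G) (p q : SplitFib n G) :
    pairing n x (c.splitMap x p) (c.splitMap x q) = splitPairing (c.atOne H F).g p q := by
  have e : ∀ v w, (c.atOne H F).g v w = c.g.inner 1 v w := fun _ _ => rfl
  have h : pairing n x (c.splitMap x p) (c.splitMap x q)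
      = (1 / 2 : ℝ) * (c.g.inner x (leftTrans x (q.1 - q.2.1)) (leftTrans x (p.1 + p.2.1))
        + c.g.inner x (leftTrans x (p.1 - p.2.1)) (leftTrans x (q.1 + q.2.1)))
        + p.2.2 * q.2.2 := rfl
  rw [h, hc.inner_leftTrans, hc.inner_leftTrans, splitPairing_apply, ← e, ← e]
  have symm : ∀ v w, (c.atOne H F).g v w = (c.atOne H F).g w v := fun v w => c.g.symm 1 v w
  simp only [map_add, map_sub, LinearMap.sub_apply]
  rw [symm q.1 p.1, symm q.1 p.2.1, symm q.2.1 p.1, symm q.2.1 p.2.1]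
  ring

theorem Components.atOne_symm (c : Components n G) (H : FormField n G 3) (F : FormField n G 2)
    (v w : GroupLieAlgebra (𝓡 n) G) : (c.atOne H F).g v w = (c.atOne H F).g w v :=
  c.g.symm 1 v w

theorem Components.atOne_pos (c : Components n G) (H : FormField n G 3) (F : FormField n G 2)
    (v : GroupLieAlgebra (𝓡 n) G) (hv : v ≠ 0) : 0 < (c.atOne H F).g v v :=
  c.g.pos 1 v hv

/-- The trivialization of `E` by left-invariant sections, as a linear equivalence. -/
def Components.LeftInv.splitEquiv {c : Components n G} (hc : c.LeftInv) (x : G) :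
    SplitFib n G ≃ₗ[ℝ] Fib n x :=
  LinearEquiv.ofInjectiveOfFinrankEq (c.splitMap x)
    (by
      rw [← LinearMap.ker_eq_bot, LinearMap.ker_eq_bot']
      intro p hp
      refine splitPairing_nondegenerate (c.atOne_pos 0 0) p fun q => ?_
      rw [← hc.pairing_splitMap 0 0 x, hp, map_zero, LinearMap.zero_apply])
    (by
      have h : Module.finrank ℝ (GroupLieAlgebra (𝓡 n) G) = n := finrank_tangentSpace 1
      rw [finrank_fib, Module.finrank_prod, Module.finrank_prod, h, Module.finrank_self]
      ring)

theorem Components.LeftInv.splitEquiv_apply {c : Components n G} (hc : c.LeftInv) (x : G)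
    (p : SplitFib n G) : hc.splitEquiv x p = c.splitMap x p := rfl

/-- Invariance and nondegeneracy of the pairing make the trivialization injective, hence bijective
by dimension; the vector part of its image is therefore everything. -/
theorem leftTrans_surjective {c : Components n G} (hc : c.LeftInv) (x : G) :
    Function.Surjective (leftTrans (n := n) x) := by
  intro v
  obtain ⟨p, hp⟩ := (hc.splitEquiv x).surjective (v, 0, 0)
  exact ⟨p.1 + p.2.1, congrArg Prod.fst hp⟩

end InvariantSections

/-! ### Recovering the tensors from an endomorphism of the split fibre. -/

section SplitAlgebra

variable {V : Type*} [AddCommGroup V] [Module ℝ V]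

/-- A skew-symmetric endomorphism of `E₊ ⊕ E₋` preserving the splitting is determined by its
components. -/
theorem AlgData.eq_endo (d : AlgData V)
    (A : V × V × ℝ →ₗ[ℝ] V × V × ℝ)
    (skew : ∀ u v, splitPairing d.g (A u) v = -splitPairing d.g u (A v))
    (comm : ∀ u, A (u.1, -u.2.1, u.2.2) = ((A u).1, -(A u).2.1, (A u).2.2))
    (hm : ∀ Y, (A (0, Y, 0)).1 + (A (0, Y, 0)).2.1 = d.Jm Y)
    (hp : ∀ X, (A (X, 0, 0)).1 + (A (X, 0, 0)).2.1 = d.Jp X)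
    (hX : (A (0, 0, 1)).1 + (A (0, 0, 1)).2.1 = d.Xp) : A = d.endo := by
  have half : ∀ Y : V, Y = -Y → Y = 0 := by
    intro Y h
    have : (2 : ℝ) • Y = 0 := by
      rw [two_smul]; nth_rewrite 1 [h]; exact neg_add_cancel _
    simpa using this
  have minus : ∀ Y, A (0, Y, 0) = (0, d.Jm Y, 0) := by
    intro Y
    -- `A` commutes with the involution that defines the splitting, so it preserves both summands.
    have h := comm (0, Y, 0)
    have e : ((0 : V), -Y, (0 : ℝ)) = -(0, Y, 0) := by simp
    simp only [e, map_neg] at h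
    have h1 := congrArg (fun u => u.1) h
    have h2 := congrArg (fun u => u.2.2) h
    simp only [Prod.fst_neg, Prod.snd_neg] at h1 h2
    have h3 := half _ h1.symm
    refine Prod.ext h3 (Prod.ext ?_ (by simp only; linarith))
    rw [← hm, h3, zero_add]
  have plus : ∀ X t, (A (X, 0, t)).2.1 = 0 := by
    intro X t
    have h := comm (X, 0, t)
    simp only [neg_zero] at h
    exact half _ (congrArg (fun u => u.2.1) h)
  have plus₁ : ∀ X t, (A (X, 0, t)).1 = d.Jp X + t • d.Xp := by
    intro X t
    have e : ((X, 0, t) : V × V × ℝ) = (X, 0, 0) + t • (0, 0, 1) := by simp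
    rw [e, map_add, map_smul, Prod.fst_add, Prod.smul_fst, ← hp, ← hX, plus, plus, add_zero,
      add_zero]
  have one₂ : (A (0, 0, 1)).2.2 = 0 := by
    -- Skewness with respect to the constant `1` determines the scalar part of `A` on `E₊` from `A 1
    -- = X₊`.
    have h := skew (0, 0, 1) (0, 0, 1)
    simp [splitPairing_apply] at h
    linarith
  have plus₂ : ∀ X t, (A (X, 0, t)).2.2 = -d.g X d.Xp := by
    intro X t
    have h := skew (X, 0, t) (0, 0, 1)
    simpa [splitPairing_apply, one₂, plus₁] using h
  refine LinearMap.ext fun u => ?_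
  obtain ⟨X, Y, t⟩ := u
  have e : ((X, Y, t) : V × V × ℝ) = (X, 0, t) + (0, Y, 0) := by simp
  have hA : A (X, Y, t) = A (X, 0, t) + (0, d.Jm Y, 0) := by rw [e, map_add, minus]
  rw [hA, AlgData.endo_apply]
  refine Prod.ext ?_ (Prod.ext ?_ ?_)
  · simp [plus₁]
  · simp [plus]
  · simp [plus₂]

/-- Since the endomorphism preserves the splitting, both components of `u₀` lie in its kernel, which
is a line. The `E₋` component is nonzero because `u₀` is negative, so the other one vanishes and the
kernel is spanned by `X₋` inside `E₋`. Then `A³ = -A` gives `A² = -1` on `E₊`, and the components of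
this identity are the properties of `J₊` and `X₊`. -/
theorem AlgData.isAlmostKahler_of_endo (d : AlgData V) (symm : ∀ v w, d.g v w = d.g w v)
    (pos : ∀ v, v ≠ 0 → 0 < d.g v v)
    (skew : ∀ u v, splitPairing d.g (d.endo u) v = -splitPairing d.g u (d.endo v))
    (cubic : ∀ u, d.endo (d.endo (d.endo u) + u) = 0)
    (ker : ∀ u v, d.endo u = 0 → d.endo v = 0 → u ≠ 0 → ∃ k : ℝ, v = k • u)
    (u₀ : V × V × ℝ) (h₀ : d.endo u₀ = 0) (norm : splitPairing d.g u₀ u₀ = -1)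
    (hXm : d.Xm = u₀.1 + u₀.2.1) : d.IsAlmostKahler := by
  obtain ⟨a, b, t⟩ := u₀
  have h1 : d.endo (a, 0, t) = 0 := by
    have h1 := congrArg (fun u => u.1) h₀
    have h2 := congrArg (fun u => u.2.2) h₀
    simp only [AlgData.endo_apply] at h1 h2 ⊢
    exact Prod.ext h1 (Prod.ext (by simp) h2)
  have h2 : d.endo (0, b, 0) = 0 := by
    have h1 := congrArg (fun u => u.2.1) h₀
    simp only [AlgData.endo_apply] at h1 ⊢
    exact Prod.ext (by simp) (Prod.ext h1 (by simp))
  have nonneg : ∀ v, 0 ≤ d.g v v := fun v => by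
    by_cases hv : v = 0
    · simp [hv]
    · exact (pos v hv).le
  rw [splitPairing_apply] at norm
  have hb : b ≠ 0 := by
    rintro rfl
    have := nonneg a
    simp at norm
    nlinarith [mul_self_nonneg t]
  have hb' : ((0, b, 0) : V × V × ℝ) ≠ 0 := by simpa using hb
  obtain ⟨k, hk⟩ := ker _ _ h2 h1 hb'
  obtain ⟨rfl, -, rfl⟩ : a = 0 ∧ 0 = k • b ∧ t = 0 := by simpa using hk
  have hm : d.Xm = b := by simpa using hXm
  subst hm
  have kerm : ∀ v, d.endo v = 0 → v.1 = 0 ∧ v.2.2 = 0 ∧ ∃ k : ℝ, v.2.1 = k • d.Xm := by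
    intro v hv
    obtain ⟨k, rfl⟩ := ker _ _ h2 hv hb'
    exact ⟨by simp, by simp, k, rfl⟩
  have Jm0 : d.Jm d.Xm = 0 := congrArg (fun u => u.2.1) h2
  have Jms : ∀ v w, d.g (d.Jm v) w = -d.g v (d.Jm w) := by
    intro v w
    have := skew (0, v, 0) (0, w, 0)
    simp [splitPairing_apply, AlgData.endo_apply] at this
    linarith
  have Jps : ∀ v w, d.g (d.Jp v) w = -d.g v (d.Jp w) := by
    intro v w
    have := skew (v, 0, 0) (w, 0, 0)
    simpa [splitPairing_apply, AlgData.endo_apply] using this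
  have sqp : ∀ X t, d.endo (d.endo (X, 0, t)) = -(X, 0, t) := by
    intro X t
    obtain ⟨k1, k2, k3⟩ := kerm _ (cubic (X, 0, t))
    rw [← add_eq_zero_iff_eq_neg]
    refine Prod.ext k1 (Prod.ext ?_ k2)
    simp [AlgData.endo_apply]
  -- On the constant `1`, the two components of `A² = -1` are `J₊ X₊ = 0` and `g(X₊, X₊) = 1`.
  have hone := sqp 0 1
  have Jp0 : d.Jp d.Xp = 0 := by
    have := congrArg (fun u => u.1) hone
    simpa [AlgData.endo_apply] using this
  have Xp1 : d.g d.Xp d.Xp = 1 := by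
    have := congrArg (fun u => u.2.2) hone
    simpa [AlgData.endo_apply] using this
  refine ⟨symm, pos, ⟨Jps, Jp0, fun v _ => ?_, fun v hv => ?_⟩,
    ⟨Jms, Jm0, fun v _ => ?_, fun v hv => ?_⟩, Xp1, ?_⟩
  · rw [Jps, Jp0, map_zero, neg_zero]
  · have := congrArg (fun u => u.1) (sqp v 0)
    simpa [AlgData.endo_apply, hv] using this
  · rw [Jms, Jm0, map_zero, neg_zero]
  -- On `E₋` the vector `J₋² v + v` is only known to be a multiple of `X₋`; its product with `X₋`
  -- vanishes for `v ⟂ X₋`, so it is zero.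
  · obtain ⟨-, -, k, hk⟩ := kerm _ (cubic (0, v, 0))
    simp only [AlgData.endo_apply, Prod.snd_add, Prod.fst_add] at hk
    have h3 := congrArg (fun v => d.g v d.Xm) hk
    simp [Jms (d.Jm v), Jm0, hv] at h3
    have hpos := (pos _ hb).ne'
    have hk0 : k = 0 := h3.resolve_right hpos
    rw [← add_eq_zero_iff_eq_neg, hk, hk0, zero_smul]
  · simp at norm
    exact norm

end SplitAlgebra

section Fibres

variable {n : ℕ} {M : Type*} [TopologicalSpace M] [ChartedSpace (Mod n) M]

theorem cx_mem_iEigen (A : EEndField n M) (x : M) (a b : Fib n x) :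
    cx a b ∈ iEigen A x ↔ A x a = -b ∧ A x b = a :=
  cplx_mem_eigenspace (A x) a b

theorem pairing_symm (x : M) (u v : Fib n x) : pairing n x u v = pairing n x v u := by
  simp only [pairing, LinearMap.mk₂_apply]
  ring

end Fibres

/-! ### From a generalized Kähler structure to data on the Lie algebra. -/

section Components

variable {n : ℕ} {G : Type*} [TopologicalSpace G] [ChartedSpace (Mod n) G] [Group G]
  [LieGroup (𝓡 n) ∞ G]

/-- The components with `J₋` replaced by `-J₋`. -/
def Components.conj (c : Components n G) : Components n G := { c with Jm := fun x => -c.Jm x }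

theorem Components.LeftInv.conj {c : Components n G} (hc : c.LeftInv) : c.conj.LeftInv where
  g := hc.g
  Jp := hc.Jp
  Jm x v := by
    have h := hc.Jm x v
    have e : mulInvariantVectorField (-(c.Jm 1 v) : GroupLieAlgebra (𝓡 n) G) x
        = -mulInvariantVectorField (c.Jm 1 v : GroupLieAlgebra (𝓡 n) G) x :=
      map_neg (leftTrans x) _
    calc -(c.Jm x (mulInvariantVectorField v x)) = _ := by rw [h]
      _ = _ := e.symm
  Xp := hc.Xp
  Xm := hc.Xm

theorem Components.LeftInv.leftTrans_injective {c : Components n G} (hc : c.LeftInv) (x : G) :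
    Function.Injective (leftTrans (n := n) x) := by
  rw [← LinearMap.ker_eq_bot, LinearMap.ker_eq_bot']
  intro v hv
  by_contra hne
  have h := c.g.pos 1 v hne
  rw [← hc.inner_leftTrans x, hv, map_zero] at h
  exact lt_irrefl _ h

/-- Integrability of the eigenbundle, evaluated on invariant sections. -/
theorem Components.LeftInv.isIntegrable_of_dorfman {c : Components n G} (hc : c.LeftInv)
    {H : FormField n G 3} {F : FormField n G 2} (hH : LeftInvForm H) (hF : LeftInvForm F)
    (hd : (c.atOne H F).IsAlmostKahler) (A : EEndField n G)
    (hA : ∀ x p, A x (c.splitMap x p) = c.splitMap x ((c.atOne H F).endo p))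
    (hI : DorfmanIntegrable H F (iEigen A)) : (c.atOne H F).IsIntegrable (lieBilin n G) := by
  intro p q r hp hq
  set e := (c.atOne H F).endo with he
  have mem : ∀ p : SplitFib n G, (c.atOne H F).g p.2.1 (c.atOne H F).Xm = 0 → ∀ x,
      cx ((c.invSec p).val x) ((c.invSec (-e p)).val x) ∈ iEigen A x := by
    intro p hp x
    rw [cx_mem_iEigen]
    have h1 : A x (c.splitMap x p) = -c.splitMap x (-e p) := by rw [hA, map_neg, neg_neg]
    have h2 : A x (c.splitMap x (-e p)) = c.splitMap x p := by
      rw [hA, map_neg, he, hd.endo_endo p hp, neg_neg]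
    exact ⟨h1, h2⟩
  -- The sections `p - i A p` and `q - i A q` lie in the eigenbundle when `p`, `q` are orthogonal to
  -- `ker A`. By skewness of `A`, the condition that `A` times the imaginary part of their bracket
  -- is its real part, paired with `r`, is the required identity.
  have h := hI _ _ _ _ (mem p hp) (mem q hq) 1
  rw [cx_mem_iEigen] at h
  obtain ⟨s, hs⟩ := (hc.splitEquiv 1).surjective
    (dorfman H F (c.invSec p) (c.invSec (-e q)) 1 + dorfman H F (c.invSec (-e p)) (c.invSec q) 1)
  rw [hc.splitEquiv_apply] at hs
  have key : pairing n 1 (c.splitMap 1 (e s)) (c.splitMap 1 r)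
      = -pairing n 1 (c.splitMap 1 s) (c.splitMap 1 (e r)) := by
    rw [hc.pairing_splitMap H F, hc.pairing_splitMap H F, he, hd.endo_skew]
  rw [← hA, hs, h.2] at key
  have dor : ∀ p q r, pairing n 1 (dorfman H F (c.invSec p) (c.invSec q) 1) (c.splitMap 1 r)
      = (c.atOne H F).bracketForm (lieBilin n G) p q r :=
    fun p q r => hc.pairing_dorfman hH hF p q r 1
  simp only [map_sub, map_add, LinearMap.sub_apply, LinearMap.add_apply, dor,
    AlgData.bracketForm_neg₁, AlgData.bracketForm_neg₂] at key
  linarith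

/-- The generalized metric in standard form is left-invariant. -/
theorem Components.IsOf.gend_splitMap {c : Components n G} (hc : c.LeftInv)
    {𝒢 : GenRiemannianMetric n G} {A : EEndField n G} (h : c.IsOf 𝒢 A) (x : G)
    (p : SplitFib n G) :
    𝒢.gend x (c.splitMap x p) = c.splitMap x (p.1, -p.2.1, p.2.2) := by
  have e1 : p = (p.1, 0, p.2.2) + (0, p.2.1, 0) := by simp
  have e2 : ((p.1, -p.2.1, p.2.2) : SplitFib n G) = (p.1, 0, p.2.2) + -(0, p.2.1, 0) := by simp
  have hm : 𝒢.gend x (c.splitMap x (0, p.2.1, 0)) = -c.splitMap x (0, p.2.1, 0) := by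
    apply 𝒢.gend_minus
    rw [h.minus_eq]
    exact ⟨leftTrans x p.2.1, by simp [c.splitMap_apply]⟩
  have hp : 𝒢.gend x (c.splitMap x (p.1, 0, p.2.2)) = c.splitMap x (p.1, 0, p.2.2) := by
    apply 𝒢.gend_plus
    intro w hw
    obtain ⟨X, rfl⟩ := (h.minus_eq x w).1 hw
    obtain ⟨Y, rfl⟩ := leftTrans_surjective hc x X
    have e : ((leftTrans x Y, -(c.g.inner x (leftTrans x Y)), 0) : Fib n x)
        = c.splitMap x (0, Y, 0) := by simp [c.splitMap_apply]
    rw [e, hc.pairing_splitMap 0 0]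
    simp [splitPairing_apply]
  rw [e2, map_add, map_neg, ← hm, ← hp]
  conv_lhs => rw [e1]
  rw [map_add, map_add]

/-- The endomorphism of `E` is determined by the components. -/
theorem Components.IsOf.splitMap_endo {c : Components n G} (hc : c.LeftInv)
    {H : FormField n G 3} {F : FormField n G 2} {𝒢 : GenRiemannianMetric n G}
    {A : EEndField n G} (h : c.IsOf 𝒢 A) (hK : IsBnKahler H F 𝒢 A) (x : G)
    (p : SplitFib n G) :
    A x (c.splitMap x p) = c.splitMap x ((c.atOne H F).endo p) := by
  obtain ⟨skew, -, -⟩ := skew_of_isotropic (pairing n x) (pairing_symm x) (A x) n (finrank_fib x)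
    (hK.complex.1.rank x) (hK.complex.1.isotropic x) (hK.complex.1.ker x)
  let Ψ := hc.splitEquiv x
  have hΨ : ∀ p, Ψ p = c.splitMap x p := fun _ => rfl
  let B : SplitFib n G →ₗ[ℝ] SplitFib n G := Ψ.symm.toLinearMap ∘ₗ A x ∘ₗ Ψ.toLinearMap
  have hB : ∀ p, c.splitMap x (B p) = A x (c.splitMap x p) := by
    intro p
    rw [← hΨ, ← hΨ]
    simp [B]
  suffices hBe : B = (c.atOne H F).endo by rw [← hBe, hB]
  have inj := hc.leftTrans_injective x
  apply AlgData.eq_endo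
  · intro u v
    rw [← hc.pairing_splitMap H F x, ← hc.pairing_splitMap H F x, hB, hB, skew]
  · intro u
    apply Ψ.injective
    rw [hΨ, hΨ, hB, ← h.gend_splitMap hc, ← h.gend_splitMap hc, hB]
    exact (LinearMap.congr_fun (hK.commute x) _).symm
  · intro Y
    apply inj
    calc leftTrans x ((B (0, Y, 0)).1 + (B (0, Y, 0)).2.1) = (c.splitMap x (B (0, Y, 0))).1 := rfl
      _ = (A x (leftTrans x Y, -(c.g.inner x (leftTrans x Y)), 0)).1 := by
        rw [hB]; simp [c.splitMap_apply]
      _ = c.Jm x (leftTrans x Y) := (h.Jm_eq x _).symm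
      _ = leftTrans x (c.Jm 1 Y) := hc.Jm x Y
  · intro X
    apply inj
    calc leftTrans x ((B (X, 0, 0)).1 + (B (X, 0, 0)).2.1) = (c.splitMap x (B (X, 0, 0))).1 := rfl
      _ = (A x (leftTrans x X, c.g.inner x (leftTrans x X), 0)).1 := by
        rw [hB]; simp [c.splitMap_apply]
      _ = c.Jp x (leftTrans x X) := (h.Jp_eq x _).symm
      _ = leftTrans x (c.Jp 1 X) := hc.Jp x X
  · apply inj
    calc leftTrans x ((B (0, 0, 1)).1 + (B (0, 0, 1)).2.1) = (c.splitMap x (B (0, 0, 1))).1 := rfl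
      _ = (A x (0, 0, 1)).1 := by
        rw [hB]; simp [c.splitMap_apply]
      _ = c.Xp x := (h.Xp_eq x).symm
      _ = leftTrans x (c.Xp 1) := hc.Xp x

theorem Components.IsOf.isAlmostKahler {c : Components n G} (hc : c.LeftInv)
    {H : FormField n G 3} {F : FormField n G 2} {𝒢 : GenRiemannianMetric n G}
    {A : EEndField n G} (h : c.IsOf 𝒢 A) (hK : IsBnKahler H F 𝒢 A) :
    (c.atOne H F).IsAlmostKahler := by
  obtain ⟨skew, cubic, ker⟩ := skew_of_isotropic (pairing n 1) (pairing_symm 1) (A 1) n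
    (finrank_fib 1) (hK.complex.1.rank 1) (hK.complex.1.isotropic 1) (hK.complex.1.ker 1)
  obtain ⟨u₀, ker₀, norm, hXm⟩ := h.Xm_eq
  have hA := h.splitMap_endo hc hK 1
  let Ψ := hc.splitEquiv 1
  have hΨ : ∀ p, Ψ p = c.splitMap 1 p := fun _ => rfl
  obtain ⟨p, hp⟩ := Ψ.surjective (u₀.val 1)
  refine (c.atOne H F).isAlmostKahler_of_endo (c.atOne_symm H F) (c.atOne_pos H F) ?_ ?_ ?_ p
    ?_ ?_ ?_
  · intro u v
    rw [← hc.pairing_splitMap H F 1, ← hc.pairing_splitMap H F 1, ← hA, ← hA, skew]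
  · intro u
    apply Ψ.injective
    rw [hΨ, ← hA, map_add, ← hA, ← hA, cubic, map_zero]
  · intro u v hu hv hne
    obtain ⟨k, hk⟩ := ker (Ψ u) (Ψ v) (by rw [hΨ, hA, hu, map_zero]) (by rw [hΨ, hA, hv, map_zero])
      (fun h => hne (by simpa using h))
    exact ⟨k, Ψ.injective (by rw [hk, map_smul])⟩
  · apply Ψ.injective
    rw [hΨ, ← hA, ← hΨ, hp, ker₀, map_zero]
  · rw [← hc.pairing_splitMap H F 1, ← hΨ, hp, norm]
  · apply hc.leftTrans_injective 1
    calc leftTrans 1 (c.Xm 1) = c.Xm 1 := (hc.Xm 1).symm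
      _ = (Ψ p).1 := by rw [hp]; exact hXm 1
      _ = _ := rfl

end Components

/-! ### Leibniz rules for the untwisted Dorfman bracket. -/

section Calculus

variable {n : ℕ} {M : Type*} [TopologicalSpace M] [ChartedSpace (Mod n) M]

theorem dirDeriv_add {f g : M → ℝ} {x : M} (X : VField n M)
    (hf : MDifferentiableAt (𝓡 n) 𝓘(ℝ) f x) (hg : MDifferentiableAt (𝓡 n) 𝓘(ℝ) g x) :
    dirDeriv X (fun y => f y + g y) x = dirDeriv X f x + dirDeriv X g x := by
  have h : mvfderiv (𝓡 n) (fun y => f y + g y) x = mvfderiv (𝓡 n) f x + mvfderiv (𝓡 n) g x :=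
    mvfderiv_add hf hg
  unfold dirDeriv
  rw [h]; rfl

theorem dirDeriv_mul {f g : M → ℝ} {x : M} (X : VField n M)
    (hf : MDifferentiableAt (𝓡 n) 𝓘(ℝ) f x) (hg : MDifferentiableAt (𝓡 n) 𝓘(ℝ) g x) :
    dirDeriv X (fun y => f y * g y) x = f x * dirDeriv X g x + g x * dirDeriv X f x := by
  have h : mvfderiv (𝓡 n) (fun y => f y * g y) x
      = f x • mvfderiv (𝓡 n) g x + g x • mvfderiv (𝓡 n) f x := mvfderiv_mul hf hg
  unfold dirDeriv
  rw [h]; rfl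

theorem dirDeriv_add_field (X Y : VField n M) (f : M → ℝ) (x : M) :
    dirDeriv (X + Y) f x = dirDeriv X f x + dirDeriv Y f x := map_add (mvfderiv (𝓡 n) f x) _ _

theorem dirDeriv_smul_field (h : M → ℝ) (X : VField n M) (f : M → ℝ) (x : M) :
    dirDeriv (h • X) f x = h x * dirDeriv X f x := map_smul (mvfderiv (𝓡 n) f x) _ _

end Calculus

section Leibniz

variable {n : ℕ} {G : Type*} [TopologicalSpace G] [ChartedSpace (Mod n) G] [Group G]
  [LieGroup (𝓡 n) ∞ G]

theorem Sec.mdifferentiableAt_cov (u : Sec n G) {Z : VField n G} {x : G}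
    (hZ : MDifferentiableAt (𝓡 n) (𝓡 n).tangent (fun y => (Z y : TangentBundle (𝓡 n) G)) x) :
    MDifferentiableAt (𝓡 n) 𝓘(ℝ) (fun y => u.cov y (Z y)) x :=
  mdiffAt_cov_apply u.smooth_cov hZ

theorem Sec.mdifferentiableAt_fn (u : Sec n G) (x : G) :
    MDifferentiableAt (𝓡 n) 𝓘(ℝ) u.fn x :=
  u.smooth_fn.contMDiffAt.mdifferentiableAt (by simp)

/-- Two elements of a fibre of `E` are equal if they agree on left-invariant vector fields. -/
theorem fib_ext {c : Components n G} (hc : c.LeftInv) {x : G} {u v : Fib n x} (h₁ : u.1 = v.1)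
    (h₂ : ∀ z : GroupLieAlgebra (𝓡 n) G, u.2.1 (leftTrans x z) = v.2.1 (leftTrans x z))
    (h₃ : u.2.2 = v.2.2) : u = v := by
  refine Prod.ext h₁ (Prod.ext ?_ h₃)
  ext w
  obtain ⟨z, rfl⟩ := leftTrans_surjective hc x w
  exact h₂ z

theorem dorfmanCovOp_zero (u v : Sec n G) (x : G) (Z : VField n G) :
    dorfmanCovOp 0 0 u v x Z = dirDeriv u.vec (fun y => v.cov y (Z y)) x - v.cov x (lieB u.vec Z x)
      - (dirDeriv v.vec (fun y => u.cov y (Z y)) x - dirDeriv Z (fun y => u.cov y (v.vec y)) x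
        - u.cov x (lieB v.vec Z x))
      + 2 * v.fn x * dirDeriv Z u.fn x := by
  simp [dorfmanCovOp]

theorem dorfman_fn_zero (u v : Sec n G) (x : G) :
    (dorfman 0 0 u v x).2.2 = dirDeriv u.vec v.fn x - dirDeriv v.vec u.fn x := by
  simp [dorfman]

theorem dorfman_add_left {c : Components n G} (hc : c.LeftInv) (u u' v : Sec n G) (x : G) :
    dorfman 0 0 (u.add u') v x = dorfman 0 0 u v x + dorfman 0 0 u' v x := by
  have hu := u.mdifferentiableAt_vec x
  have hu' := u'.mdifferentiableAt_vec x
  refine fib_ext hc ?_ (fun z => ?_) ?_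
  · exact VectorField.mlieBracket_add_left hu hu'
  · have hZ := mdifferentiableAt_leftTrans x z
    have hv := v.mdifferentiableAt_vec x
    rw [Prod.snd_add, Prod.fst_add, add_apply, dorfman_cov_apply,
      dorfman_cov_apply, dorfman_cov_apply, dorfmanCovOp_zero, dorfmanCovOp_zero,
      dorfmanCovOp_zero]
    have e1 := dirDeriv_add v.vec (u.mdifferentiableAt_cov hZ) (u'.mdifferentiableAt_cov hZ)
    have e2 := dirDeriv_add (fun y => leftTrans y z) (u.mdifferentiableAt_cov hv)
      (u'.mdifferentiableAt_cov hv)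
    have e3 := dirDeriv_add (fun y => leftTrans y z) (u.mdifferentiableAt_fn x)
      (u'.mdifferentiableAt_fn x)
    have e4 : lieB (u.vec + u'.vec) (fun y => leftTrans y z) x
        = lieB u.vec (fun y => leftTrans y z) x + lieB u'.vec (fun y => leftTrans y z) x :=
      VectorField.mlieBracket_add_left hu hu'
    have e5 : (u.add u').fn = fun y => u.fn y + u'.fn y := rfl
    rw [e5, e3]
    simp only [Sec.add, dirDeriv_add_field, add_apply, e1, e2, e4, map_add]
    ring
  · have e := dirDeriv_add v.vec (u.mdifferentiableAt_fn x) (u'.mdifferentiableAt_fn x)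
    have e5 : (u.add u').fn = fun y => u.fn y + u'.fn y := rfl
    rw [Prod.snd_add, Prod.snd_add, dorfman_fn_zero, dorfman_fn_zero, dorfman_fn_zero, e5, e]
    simp only [Sec.add, dirDeriv_add_field]
    ring

theorem dorfman_add_right {c : Components n G} (hc : c.LeftInv) (u v v' : Sec n G) (x : G) :
    dorfman 0 0 u (v.add v') x = dorfman 0 0 u v x + dorfman 0 0 u v' x := by
  have hv := v.mdifferentiableAt_vec x
  have hv' := v'.mdifferentiableAt_vec x
  refine fib_ext hc ?_ (fun z => ?_) ?_
  · exact VectorField.mlieBracket_add_right hv hv'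
  · have hZ := mdifferentiableAt_leftTrans x z
    rw [Prod.snd_add, Prod.fst_add, add_apply, dorfman_cov_apply,
      dorfman_cov_apply, dorfman_cov_apply, dorfmanCovOp_zero, dorfmanCovOp_zero,
      dorfmanCovOp_zero]
    have e1 := dirDeriv_add u.vec (v.mdifferentiableAt_cov hZ) (v'.mdifferentiableAt_cov hZ)
    have e2 := dirDeriv_add (fun y => leftTrans y z) (u.mdifferentiableAt_cov hv)
      (u.mdifferentiableAt_cov hv')
    have e4 : lieB (v.vec + v'.vec) (fun y => leftTrans y z) x
        = lieB v.vec (fun y => leftTrans y z) x + lieB v'.vec (fun y => leftTrans y z) x :=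
      VectorField.mlieBracket_add_left hv hv'
    have e5 : (v.add v').fn = fun y => v.fn y + v'.fn y := rfl
    rw [e5]
    simp only [Sec.add, dirDeriv_add_field, add_apply, Pi.add_apply, map_add,
      e1, e2, e4]
    ring
  · have e := dirDeriv_add u.vec (v.mdifferentiableAt_fn x) (v'.mdifferentiableAt_fn x)
    have e5 : (v.add v').fn = fun y => v.fn y + v'.fn y := rfl
    rw [Prod.snd_add, Prod.snd_add, dorfman_fn_zero, dorfman_fn_zero, dorfman_fn_zero, e5, e]
    simp only [Sec.add, dirDeriv_add_field]
    ring

theorem dorfman_smul_right {c : Components n G} (hc : c.LeftInv) (f : G → ℝ)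
    (hf : ContMDiff (𝓡 n) 𝓘(ℝ) ∞ f) (u v : Sec n G) (x : G) :
    dorfman 0 0 u (v.smul f hf) x = f x • dorfman 0 0 u v x + dirDeriv u.vec f x • v.val x := by
  have hv := v.mdifferentiableAt_vec x
  have hf' : MDifferentiableAt (𝓡 n) 𝓘(ℝ) f x := hf.contMDiffAt.mdifferentiableAt (by simp)
  refine fib_ext hc ?_ (fun z => ?_) ?_
  · exact (VectorField.mlieBracket_smul_right hf' hv).trans (add_comm _ _)
  · have hZ := mdifferentiableAt_leftTrans x z
    have e0 : (f x • dorfman 0 0 u v x + dirDeriv u.vec f x • v.val x).2.1 (leftTrans x z)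
        = f x * (dorfman 0 0 u v x).2.1 (leftTrans x z)
          + dirDeriv u.vec f x * v.cov x (leftTrans x z) := rfl
    rw [e0, dorfman_cov_apply, dorfman_cov_apply, dorfmanCovOp_zero, dorfmanCovOp_zero]
    have e1 := dirDeriv_mul u.vec hf' (v.mdifferentiableAt_cov hZ)
    have e2 := dirDeriv_mul (fun y => leftTrans y z) hf' (u.mdifferentiableAt_cov hv)
    have e4 : lieB (f • v.vec) (fun y => leftTrans y z) x
        = -(dirDeriv (fun y => leftTrans y z) f x) • v.vec x
          + f x • lieB v.vec (fun y => leftTrans y z) x :=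
      VectorField.mlieBracket_smul_left hf' hv
    simp only [Sec.smul, dirDeriv_smul_field, smul_apply, Pi.smul_apply',
      Pi.mul_apply, map_add, map_smul, smul_eq_mul, e1, e2, e4]
    ring
  · have e := dirDeriv_mul u.vec hf' (v.mdifferentiableAt_fn x)
    have e5 : (v.smul f hf).fn = fun y => f y * v.fn y := rfl
    have e0 : (f x • dorfman 0 0 u v x + dirDeriv u.vec f x • v.val x).2.2
        = f x * (dorfman 0 0 u v x).2.2 + dirDeriv u.vec f x * v.fn x := rfl
    rw [e0, dorfman_fn_zero, dorfman_fn_zero, e5, e]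
    simp only [Sec.smul, dirDeriv_smul_field]
    ring

/-- The term `2⟨u, v⟩ df` collects `i_Y (df ∧ ξ)`, the derivative of `λ` in `2μ dλ` and the missing
half of the symmetric pairing; it is the only obstruction to tensoriality on the eigenbundle. -/
theorem dorfman_smul_left {c : Components n G} (hc : c.LeftInv) (f : G → ℝ)
    (hf : ContMDiff (𝓡 n) 𝓘(ℝ) ∞ f) (u v : Sec n G) (x : G) :
    dorfman 0 0 (u.smul f hf) v x = f x • dorfman 0 0 u v x - dirDeriv v.vec f x • u.val x
      + (2 * pairing n x (u.val x) (v.val x)) • ((0, mvfderiv (𝓡 n) f x, 0) : Fib n x) := by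
  have hu := u.mdifferentiableAt_vec x
  have hv := v.mdifferentiableAt_vec x
  have hf' : MDifferentiableAt (𝓡 n) 𝓘(ℝ) f x := hf.contMDiffAt.mdifferentiableAt (by simp)
  refine fib_ext hc ?_ (fun z => ?_) ?_
  · have h : lieB (f • u.vec) v.vec x
        = -(dirDeriv v.vec f x) • u.vec x + f x • lieB u.vec v.vec x :=
      VectorField.mlieBracket_smul_left hf' hu
    have e0 : (f x • dorfman 0 0 u v x - dirDeriv v.vec f x • u.val x
      + (2 * pairing n x (u.val x) (v.val x)) • ((0, mvfderiv (𝓡 n) f x, 0) : Fib n x)).1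
      = f x • lieB u.vec v.vec x - dirDeriv v.vec f x • u.vec x
        + (2 * pairing n x (u.val x) (v.val x)) • (0 : TangentSpace (𝓡 n) x) := rfl
    rw [e0]
    refine h.trans ?_
    module
  · have hZ := mdifferentiableAt_leftTrans x z
    have e0 : (f x • dorfman 0 0 u v x - dirDeriv v.vec f x • u.val x
      + (2 * pairing n x (u.val x) (v.val x)) • ((0, mvfderiv (𝓡 n) f x, 0) : Fib n x)).2.1
        (leftTrans x z)
        = f x * (dorfman 0 0 u v x).2.1 (leftTrans x z)
          - dirDeriv v.vec f x * u.cov x (leftTrans x z)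
          + 2 * ((1 / 2 : ℝ) * (v.cov x (u.vec x) + u.cov x (v.vec x)) + u.fn x * v.fn x)
            * dirDeriv (fun y => leftTrans y z) f x := rfl
    rw [e0, dorfman_cov_apply, dorfman_cov_apply, dorfmanCovOp_zero, dorfmanCovOp_zero]
    have e1 := dirDeriv_mul v.vec hf' (u.mdifferentiableAt_cov hZ)
    have e2 := dirDeriv_mul (fun y => leftTrans y z) hf' (u.mdifferentiableAt_cov hv)
    have e3 := dirDeriv_mul (fun y => leftTrans y z) hf' (u.mdifferentiableAt_fn x)
    have e4 : lieB (f • u.vec) (fun y => leftTrans y z) x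
        = -(dirDeriv (fun y => leftTrans y z) f x) • u.vec x
          + f x • lieB u.vec (fun y => leftTrans y z) x :=
      VectorField.mlieBracket_smul_left hf' hu
    have e5 : (u.smul f hf).fn = fun y => f y * u.fn y := rfl
    rw [e5, e3]
    simp only [Sec.smul, dirDeriv_smul_field, smul_apply,
      map_add, map_smul, smul_eq_mul, e1, e2, e4]
    ring
  · have e := dirDeriv_mul v.vec hf' (u.mdifferentiableAt_fn x)
    have e5 : (u.smul f hf).fn = fun y => f y * u.fn y := rfl
    have e0 : (f x • dorfman 0 0 u v x - dirDeriv v.vec f x • u.val x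
      + (2 * pairing n x (u.val x) (v.val x)) • ((0, mvfderiv (𝓡 n) f x, 0) : Fib n x)).2.2
        = f x * (dorfman 0 0 u v x).2.2 - dirDeriv v.vec f x * u.fn x
          + 2 * pairing n x (u.val x) (v.val x) * 0 := rfl
    rw [e0, dorfman_fn_zero, dorfman_fn_zero, e5, e]
    simp only [Sec.smul, dirDeriv_smul_field]
    ring

end Leibniz

/-! ### Extension from invariant sections to all sections. -/

section Frames

variable {n : ℕ} {G : Type*} [TopologicalSpace G] [ChartedSpace (Mod n) G] [Group G]
  [LieGroup (𝓡 n) ∞ G]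

/-- By nondegeneracy every linear functional on the model is the pairing with a fixed vector, so the
coordinate is the pairing of `u` with an invariant section. -/
theorem Components.LeftInv.contMDiff_coord {c : Components n G} (hc : c.LeftInv)
    (ℓ : SplitFib n G →ₗ[ℝ] ℝ) (u : Sec n G) :
    ContMDiff (𝓡 n) 𝓘(ℝ) ∞ (fun x => ℓ ((hc.splitEquiv x).symm (u.val x))) := by
  have hinj : Function.Injective (splitPairing (c.atOne 0 0).g) := by
    rw [← LinearMap.ker_eq_bot, LinearMap.ker_eq_bot']
    intro p hp
    exact splitPairing_nondegenerate (c.atOne_pos 0 0) p (fun q => by rw [hp]; rfl)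
  obtain ⟨w, rfl⟩ := (LinearMap.injective_iff_surjective_of_finrank_eq_finrank
    (Subspace.dual_finrank_eq (K := ℝ) (V := SplitFib n G)).symm).1 hinj ℓ
  have e : (fun x => splitPairing (c.atOne 0 0).g w ((hc.splitEquiv x).symm (u.val x)))
      = fun x => (1 / 2 : ℝ) * (u.cov x (leftTrans x (w.1 + w.2.1))
        + c.g.inner x (leftTrans x (w.1 - w.2.1)) (u.vec x)) + w.2.2 * u.fn x := by
    funext x
    rw [← hc.pairing_splitMap 0 0 x, ← hc.splitEquiv_apply x ((hc.splitEquiv x).symm _),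
      LinearEquiv.apply_symm_apply]
    rfl
  rw [e]
  exact (contMDiff_const.mul ((contMDiff_cov_apply u.smooth_cov (smoothVec_mulInvariant _)).add
    (contMDiff_inner c (smoothVec_mulInvariant (w.1 - w.2.1)) u.smooth_vec))).add
    (contMDiff_const.mul u.smooth_fn)

/-- Combinations of invariant sections with smooth coefficients. -/
theorem Components.exists_sum_sec (c : Components n G) (e : SplitFib n G →ₗ[ℝ] SplitFib n G)
    (W : Submodule ℝ (SplitFib n G)) (Q : Sec n G → Sec n G → Prop)
    (inv : ∀ p ∈ W, Q (c.invSec (e p)) (c.invSec p))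
    (add : ∀ u u' v v', Q u u' → Q v v' → Q (u.add v) (u'.add v'))
    (smul : ∀ f hf u u', Q u u' → Q (u.smul f hf) (u'.smul f hf))
    {ι : Type*} (s : Finset ι) (f : ι → G → ℝ) (hf : ∀ i, ContMDiff (𝓡 n) 𝓘(ℝ) ∞ (f i))
    (b : ι → SplitFib n G) (hb : ∀ i, b i ∈ W) :
    ∃ u u' : Sec n G, Q u u' ∧ (∀ x, u.val x = c.splitMap x (e (∑ i ∈ s, f i x • b i))) ∧
      ∀ x, u'.val x = c.splitMap x (∑ i ∈ s, f i x • b i) := by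
  classical
  induction s using Finset.induction_on with
  | empty =>
    refine ⟨_, _, inv 0 W.zero_mem, fun x => ?_, fun x => ?_⟩
    · rw [Finset.sum_empty]; rfl
    · rw [Finset.sum_empty]; rfl
  | insert a s ha ih =>
    obtain ⟨u, u', hQ, hu, hu'⟩ := ih
    refine ⟨_, _, add _ _ _ _ (smul (f a) (hf a) _ _ (inv _ (hb a))) hQ, fun x => ?_, fun x => ?_⟩
    · rw [Sec.val_add, Sec.val_smul, hu, Finset.sum_insert ha, map_add, map_add, map_smul,
        map_smul]
      rfl
    · rw [Sec.val_add, Sec.val_smul, hu', Finset.sum_insert ha, map_add, map_smul]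
      rfl

theorem Components.LeftInv.smoothEnd {c : Components n G} (hc : c.LeftInv) (A : EEndField n G)
    (e : SplitFib n G →ₗ[ℝ] SplitFib n G)
    (hA : ∀ x p, A x (c.splitMap x p) = c.splitMap x (e p)) : SmoothEnd A := by
  intro u
  let b := Module.finBasis ℝ (SplitFib n G)
  obtain ⟨w, w', -, hw, -⟩ := c.exists_sum_sec e ⊤ (fun _ _ => True) (fun _ _ => trivial)
    (fun _ _ _ _ _ _ => trivial) (fun _ _ _ _ _ => trivial) Finset.univ
    (fun i x => b.coord i ((hc.splitEquiv x).symm (u.val x)))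
    (fun i => hc.contMDiff_coord (b.coord i) u) b (fun _ => trivial)
  refine ⟨w, fun x => ?_⟩
  have h : ∑ i, b.coord i ((hc.splitEquiv x).symm (u.val x)) • b i
      = (hc.splitEquiv x).symm (u.val x) := b.sum_repr _
  rw [hw, h, ← hA, ← hc.splitEquiv_apply, LinearEquiv.apply_symm_apply]

/-- A property of sections of the eigenbundle that holds for invariant sections and is stable
under sums and products with functions holds for all sections. -/
theorem Components.LeftInv.eigen_induction {c : Components n G} (hc : c.LeftInv)
    (A : EEndField n G) (e : SplitFib n G →ₗ[ℝ] SplitFib n G)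
    (hA : ∀ x p, A x (c.splitMap x p) = c.splitMap x (e p)) (Q : Sec n G → Sec n G → Prop)
    (inv : ∀ p ∈ sqNegOne e, Q (c.invSec (e p)) (c.invSec p))
    (add : ∀ u u' v v', Q u u' → Q v v' → Q (u.add v) (u'.add v'))
    (smul : ∀ f hf u u', Q u u' → Q (u.smul f hf) (u'.smul f hf))
    (u u' : Sec n G) (hu : ∀ x, cx (u.val x) (u'.val x) ∈ iEigen A x) : Q u u' := by
  let b := Module.finBasis ℝ (sqNegOne e)
  have hΨ : ∀ x, c.splitMap x ((hc.splitEquiv x).symm (u'.val x)) = u'.val x := fun x =>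
    (hc.splitEquiv x).apply_symm_apply _
  have mem : ∀ x, (hc.splitEquiv x).symm (u'.val x) ∈ sqNegOne e := by
    intro x
    rw [mem_sqNegOne]
    obtain ⟨h1, h2⟩ := (cx_mem_iEigen A x _ _).1 (hu x)
    apply (hc.splitEquiv x).injective
    rw [hc.splitEquiv_apply, ← hA, ← hA, hΨ, h2, h1, map_neg, LinearEquiv.apply_symm_apply]
  -- The coordinates are defined only on the subspace where the square is `-1`; they are extended to
  -- the whole model so that smoothness of coordinates applies. Real coefficients suffice because a
  -- section of the eigenbundle is determined by its imaginary part.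
  choose ℓ hℓ using fun i => LinearMap.exists_extend (b.coord i)
  obtain ⟨w, w', hQ, hw, hw'⟩ := c.exists_sum_sec e (sqNegOne e) Q inv add smul Finset.univ
    (fun i x => ℓ i ((hc.splitEquiv x).symm (u'.val x)))
    (fun i => hc.contMDiff_coord (ℓ i) u') (fun i => (b i : SplitFib n G)) (fun i => (b i).2)
  have hs : ∀ x, ∑ i, ℓ i ((hc.splitEquiv x).symm (u'.val x)) • (b i : SplitFib n G)
      = (hc.splitEquiv x).symm (u'.val x) := by
    intro x
    have h := congrArg Subtype.val (b.sum_repr ⟨_, mem x⟩)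
    rw [Submodule.coe_sum] at h
    refine Eq.trans (Finset.sum_congr rfl fun i _ => ?_) h
    have h' := LinearMap.congr_fun (hℓ i) ⟨_, mem x⟩
    simp only [LinearMap.comp_apply, Submodule.subtype_apply] at h'
    rw [h']
    rfl
  have e1 : w' = u' := Sec.ext_val fun x => by rw [hw', hs, hΨ]
  have e2 : w = u := Sec.ext_val fun x => by
    rw [hw, hs, ← hA, hΨ]
    exact ((cx_mem_iEigen A x _ _).1 (hu x)).2
  rwa [e1, e2] at hQ

theorem Components.LeftInv.endField_skew {c : Components n G} (hc : c.LeftInv)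
    {H : FormField n G 3} {F : FormField n G 2} (hd : (c.atOne H F).IsAlmostKahler)
    (A : EEndField n G) (hA : ∀ x p, A x (c.splitMap x p) = c.splitMap x ((c.atOne H F).endo p))
    (x : G) (u v : Fib n x) : pairing n x (A x u) v = -pairing n x u (A x v) := by
  obtain ⟨p, rfl⟩ := (hc.splitEquiv x).surjective u
  obtain ⟨q, rfl⟩ := (hc.splitEquiv x).surjective v
  rw [hc.splitEquiv_apply, hc.splitEquiv_apply, hA, hA, hc.pairing_splitMap H F,
    hc.pairing_splitMap H F, hd.endo_skew]

theorem AlgData.IsAlmostKahler.perp_of_mem_sqNegOne {V : Type*} [AddCommGroup V] [Module ℝ V]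
    {d : AlgData V} (hd : d.IsAlmostKahler) {p : V × V × ℝ} (hp : p ∈ sqNegOne d.endo) :
    d.g p.2.1 d.Xm = 0 := by
  rw [mem_sqNegOne] at hp
  have h := congrArg (fun u => d.g u.2.1 d.Xm) hp
  simp only [AlgData.endo_apply, hd.Jm.skew, hd.Jm.apply_X, map_zero, neg_zero, Prod.snd_neg,
    Prod.fst_neg, map_neg, LinearMap.neg_apply] at h
  linarith

/-- Membership of `a + i b` in the eigenbundle means `A b = a` and `A a = -b`. The first is the
algebraic condition at `(p, q)`; the second is the same condition at `(A p, q)`. -/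
theorem Components.LeftInv.dorfmanIntegrable_invSec {c : Components n G} (hc : c.LeftInv)
    (hd : (c.atOne 0 0).IsAlmostKahler) (A : EEndField n G)
    (hA : ∀ x p, A x (c.splitMap x p) = c.splitMap x ((c.atOne 0 0).endo p))
    (hI : (c.atOne 0 0).IsIntegrable (lieBilin n G)) (p q : SplitFib n G)
    (hp : p ∈ sqNegOne (c.atOne 0 0).endo) (hq : q ∈ sqNegOne (c.atOne 0 0).endo) (x : G) :
    cx (dorfman 0 0 (c.invSec ((c.atOne 0 0).endo p)) (c.invSec ((c.atOne 0 0).endo q)) x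
        - dorfman 0 0 (c.invSec p) (c.invSec q) x)
      (dorfman 0 0 (c.invSec ((c.atOne 0 0).endo p)) (c.invSec q) x
        + dorfman 0 0 (c.invSec p) (c.invSec ((c.atOne 0 0).endo q)) x) ∈ iEigen A x := by
  set e := (c.atOne 0 0).endo with he
  rw [cx_mem_iEigen]
  have hp' := map_mem_sqNegOne hp
  have hpp := mem_sqNegOne.1 hp
  have dor : ∀ p q r, pairing n x (dorfman 0 0 (c.invSec p) (c.invSec q) x) (c.splitMap x r)
      = (c.atOne 0 0).bracketForm (lieBilin n G) p q r :=
    fun p q r => hc.pairing_dorfman (fun _ _ => rfl) (fun _ _ => rfl) p q r x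
  have ext : ∀ u v : Fib n x,
      (∀ r, pairing n x u (c.splitMap x r) = pairing n x v (c.splitMap x r)) → u = v := by
    intro u v h
    obtain ⟨s, rfl⟩ := (hc.splitEquiv x).surjective u
    obtain ⟨t, rfl⟩ := (hc.splitEquiv x).surjective v
    rw [← sub_eq_zero, ← map_sub, map_eq_zero_iff _ (hc.splitEquiv x).injective]
    refine splitPairing_nondegenerate (c.atOne_pos 0 0) _ fun r => ?_
    rw [map_sub, LinearMap.sub_apply, ← hc.pairing_splitMap 0 0 x, ← hc.pairing_splitMap 0 0 x,
      sub_eq_zero]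
    exact h r
  constructor
  · apply ext
    intro r
    rw [hc.endField_skew hd A hA, hA]
    have h := hI (e p) q r (hd.perp_of_mem_sqNegOne hp') (hd.perp_of_mem_sqNegOne hq)
    simp only [← he, hpp, AlgData.bracketForm_neg₁] at h
    simp only [map_sub, map_add, map_neg, LinearMap.sub_apply, LinearMap.add_apply,
      LinearMap.neg_apply, dor]
    linarith
  · apply ext
    intro r
    rw [hc.endField_skew hd A hA, hA]
    have h := hI p q r (hd.perp_of_mem_sqNegOne hp) (hd.perp_of_mem_sqNegOne hq)
    simp only [← he] at h
    simp only [map_sub, map_add, LinearMap.sub_apply, LinearMap.add_apply, dor]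
    linarith

/-- Sections of the eigenbundle are combinations of invariant ones with smooth real coefficients.
Closure under the bracket is extended to arbitrary sections in the left argument with the right one
invariant, and then in the right argument. -/
theorem Components.LeftInv.dorfmanIntegrable {c : Components n G} (hc : c.LeftInv)
    (hd : (c.atOne 0 0).IsAlmostKahler) (A : EEndField n G)
    (hA : ∀ x p, A x (c.splitMap x p) = c.splitMap x ((c.atOne 0 0).endo p))
    (hI : (c.atOne 0 0).IsIntegrable (lieBilin n G)) : DorfmanIntegrable 0 0 (iEigen A) := by
  set e := (c.atOne 0 0).endo with he
  have skew := hc.endField_skew hd A hA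
  have isotropic : ∀ x (a b a' b' : Fib n x), cx a b ∈ iEigen A x → cx a' b' ∈ iEigen A x →
      pairing n x a a' = pairing n x b b' ∧ pairing n x a b' = -pairing n x b a' := by
    intro x a b a' b' h h'
    rw [cx_mem_iEigen] at h h'
    constructor
    · rw [← h.2, skew, h'.1, map_neg, neg_neg]
    · rw [← h.2, skew, h'.2]
  have memInv : ∀ p ∈ sqNegOne e, ∀ x,
      cx ((c.invSec (e p)).val x) ((c.invSec p).val x) ∈ iEigen A x := by
    intro p hp x
    rw [cx_mem_iEigen]
    have h1 : A x (c.splitMap x (e p)) = -c.splitMap x p := by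
      rw [hA, mem_sqNegOne.1 hp, map_neg]
    exact ⟨h1, hA x p⟩
  have memAdd : ∀ (u u' v v' : Sec n G), (∀ x, cx (u.val x) (u'.val x) ∈ iEigen A x) →
      (∀ x, cx (v.val x) (v'.val x) ∈ iEigen A x) →
      ∀ x, cx ((u.add v).val x) ((u'.add v').val x) ∈ iEigen A x := by
    intro u u' v v' h h' x
    have h := h x
    have h' := h' x
    rw [cx_mem_iEigen] at h h' ⊢
    rw [Sec.val_add, Sec.val_add, map_add, map_add, h.1, h'.1, h.2, h'.2, neg_add]
    exact ⟨rfl, rfl⟩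
  have memSmul : ∀ f hf (u u' : Sec n G), (∀ x, cx (u.val x) (u'.val x) ∈ iEigen A x) →
      ∀ x, cx ((u.smul f hf).val x) ((u'.smul f hf).val x) ∈ iEigen A x := by
    intro f hf u u' h x
    have h := h x
    rw [cx_mem_iEigen] at h ⊢
    rw [Sec.val_smul, Sec.val_smul, map_smul, map_smul, h.1, h.2, smul_neg]
    exact ⟨rfl, rfl⟩
  have left : ∀ q ∈ sqNegOne e, ∀ u u' : Sec n G, (∀ x, cx (u.val x) (u'.val x) ∈ iEigen A x) →
      ∀ x, cx (dorfman 0 0 u (c.invSec (e q)) x - dorfman 0 0 u' (c.invSec q) x)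
        (dorfman 0 0 u (c.invSec q) x + dorfman 0 0 u' (c.invSec (e q)) x) ∈ iEigen A x := by
    intro q hq u u' hu
    refine (hc.eigen_induction A e hA (fun u u' => (∀ x, cx (u.val x) (u'.val x) ∈ iEigen A x) ∧
      ∀ x, cx (dorfman 0 0 u (c.invSec (e q)) x - dorfman 0 0 u' (c.invSec q) x)
        (dorfman 0 0 u (c.invSec q) x + dorfman 0 0 u' (c.invSec (e q)) x) ∈ iEigen A x)
      (fun p hp => ⟨memInv p hp, hc.dorfmanIntegrable_invSec hd A hA hI p q hp hq⟩) ?_ ?_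
      u u' hu).2
    · rintro u u' v v' ⟨hu, hu2⟩ ⟨hv, hv2⟩
      refine ⟨memAdd _ _ _ _ hu hv, fun x => ?_⟩
      have h1 := hu2 x
      have h2 := hv2 x
      rw [cx_mem_iEigen] at h1 h2 ⊢
      simp only [dorfman_add_left hc]
      simp only [map_add, map_sub] at h1 h2 ⊢
      exact ⟨by linear_combination (norm := module) h1.1 + h2.1,
        by linear_combination (norm := module) h1.2 + h2.2⟩
    · rintro f hf u u' ⟨hu, hu2⟩
      refine ⟨memSmul _ _ _ _ hu, fun x => ?_⟩
      have h0 := hu x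
      have h1 := hu2 x
      -- These are the real and imaginary parts of the complex pairing; they cancel the `df` terms.
      obtain ⟨i1, i2⟩ := isotropic x _ _ _ _ h0 (memInv q hq x)
      rw [cx_mem_iEigen] at h0 h1 ⊢
      simp only [dorfman_smul_left hc, i1, i2]
      simp only [map_add, map_sub, map_smul, h0.1, h0.2] at h1 ⊢
      exact ⟨by linear_combination (norm := module) f x • h1.1,
        by linear_combination (norm := module) f x • h1.2⟩
  intro u u' v v' hu hv
  refine (hc.eigen_induction A e hA (fun v v' => (∀ x, cx (v.val x) (v'.val x) ∈ iEigen A x) ∧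
    ∀ x, cx (dorfman 0 0 u v x - dorfman 0 0 u' v' x)
      (dorfman 0 0 u v' x + dorfman 0 0 u' v x) ∈ iEigen A x)
    (fun q hq => ⟨memInv q hq, left q hq u u' hu⟩) ?_ ?_ v v' hv).2
  · rintro v v' w w' ⟨hv, hv2⟩ ⟨hw, hw2⟩
    refine ⟨memAdd _ _ _ _ hv hw, fun x => ?_⟩
    have h1 := hv2 x
    have h2 := hw2 x
    rw [cx_mem_iEigen] at h1 h2 ⊢
    simp only [dorfman_add_right hc]
    simp only [map_add, map_sub] at h1 h2 ⊢
    exact ⟨by linear_combination (norm := module) h1.1 + h2.1,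
      by linear_combination (norm := module) h1.2 + h2.2⟩
  · rintro f hf v v' ⟨hv, hv2⟩
    refine ⟨memSmul _ _ _ _ hv, fun x => ?_⟩
    have h0 := hv x
    have h1 := hv2 x
    rw [cx_mem_iEigen] at h0 h1 ⊢
    simp only [dorfman_smul_right hc]
    simp only [map_add, map_sub, map_smul, h0.1, h0.2] at h1 ⊢
    exact ⟨by linear_combination (norm := module) f x • h1.1,
      by linear_combination (norm := module) f x • h1.2⟩

end Frames

/-! ### Construction of the structure from the algebraic data. -/

section Construction

variable {n : ℕ} {G : Type*} [TopologicalSpace G] [ChartedSpace (Mod n) G] [Group G]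
  [LieGroup (𝓡 n) ∞ G]

/-- An invariant endomorphism of the model, transported to the fibres of `E`. -/
def Components.LeftInv.endField {c : Components n G} (hc : c.LeftInv)
    (e : SplitFib n G →ₗ[ℝ] SplitFib n G) : EEndField n G := fun x =>
  (hc.splitEquiv x).toLinearMap ∘ₗ e ∘ₗ (hc.splitEquiv x).symm.toLinearMap

theorem Components.LeftInv.endField_splitMap {c : Components n G} (hc : c.LeftInv)
    (e : SplitFib n G →ₗ[ℝ] SplitFib n G) (x : G) (p : SplitFib n G) :
    hc.endField e x (c.splitMap x p) = c.splitMap x (e p) := by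
  rw [← hc.splitEquiv_apply, ← hc.splitEquiv_apply]
  simp [endField]

theorem Components.LeftInv.isBnAlmostComplex {c : Components n G} (hc : c.LeftInv)
    {H : FormField n G 3} {F : FormField n G 2} (hd : (c.atOne H F).IsAlmostKahler)
    (A : EEndField n G)
    (hA : ∀ x p, A x (c.splitMap x p) = c.splitMap x ((c.atOne H F).endo p)) :
    IsBnAlmostComplex A := by
  have key := fun x => isotropic_of_skew (pairing n x) (fun u hu => by
      obtain ⟨p, rfl⟩ := (hc.splitEquiv x).surjective u
      rw [map_eq_zero_iff _ (hc.splitEquiv x).injective]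
      refine splitPairing_nondegenerate (c.atOne_pos H F) p fun q => ?_
      rw [← hc.pairing_splitMap H F x]
      exact hu _) (A x) n (finrank_fib x) (hc.endField_skew hd A hA x)
    (c.splitMap x (0, (c.atOne H F).Xm, 0))
    (by rw [hc.pairing_splitMap H F]; simp [splitPairing_apply, hd.Xm])
    (by
      rw [hA]
      have : (c.atOne H F).endo (0, (c.atOne H F).Xm, 0) = 0 := by
        simp [AlgData.endo_apply, hd.Jm.apply_X]
      rw [this, map_zero])
    (fun v hv => by
      obtain ⟨p, rfl⟩ := (hc.splitEquiv x).surjective v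
      rw [hc.splitEquiv_apply] at hv ⊢
      rw [hc.pairing_splitMap H F] at hv
      rw [hA, hA, hd.endo_endo p (by simpa [splitPairing_apply] using hv), map_neg])
  exact ⟨hc.smoothEnd A _ hA, fun x => (key x).1, fun x => (key x).2.1, fun x => (key x).2.2⟩

variable (n G) in
/-- The generalized metric on the model. -/
def splitGend : SplitFib n G →ₗ[ℝ] SplitFib n G where
  toFun p := (p.1, -p.2.1, p.2.2)
  map_add' p q := by simp [add_comm]
  map_smul' r p := by simp

/-- The generalized metric in standard form. -/
def Components.LeftInv.genMetric {c : Components n G} (hc : c.LeftInv) :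
    GenRiemannianMetric n G where
  minus x := LinearMap.range (c.splitMap x ∘ₗ LinearMap.inr ℝ (GroupLieAlgebra (𝓡 n) G) _ ∘ₗ
    LinearMap.inl ℝ (GroupLieAlgebra (𝓡 n) G) ℝ)
  gend := hc.endField (splitGend n G)
  finrank_minus x := by
    rw [LinearMap.finrank_range_of_inj]
    · exact finrank_tangentSpace (1 : G)
    · exact (hc.splitEquiv x).injective.comp (LinearMap.inr_injective.comp LinearMap.inl_injective)
  neg_def x := by
    rintro _ ⟨Y, rfl⟩ hne
    have hY : Y ≠ 0 := by rintro rfl; exact hne (map_zero _)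
    have e : (c.splitMap x ∘ₗ LinearMap.inr ℝ (GroupLieAlgebra (𝓡 n) G) _ ∘ₗ
      LinearMap.inl ℝ (GroupLieAlgebra (𝓡 n) G) ℝ) Y = c.splitMap x (0, Y, 0) := rfl
    rw [e, hc.pairing_splitMap 0 0]
    simpa [splitPairing_apply] using c.atOne_pos 0 0 Y hY
  gend_minus x := by
    rintro _ ⟨Y, rfl⟩
    have e : (c.splitMap x ∘ₗ LinearMap.inr ℝ (GroupLieAlgebra (𝓡 n) G) _ ∘ₗ
      LinearMap.inl ℝ (GroupLieAlgebra (𝓡 n) G) ℝ) Y = c.splitMap x (0, Y, 0) := rfl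
    rw [e, hc.endField_splitMap, ← map_neg]
    congr 1
    simp [splitGend]
  gend_plus x v hv := by
    obtain ⟨p, rfl⟩ := (hc.splitEquiv x).surjective v
    have h := hv _ ⟨p.2.1, rfl⟩
    have e : (c.splitMap x ∘ₗ LinearMap.inr ℝ (GroupLieAlgebra (𝓡 n) G) _ ∘ₗ
      LinearMap.inl ℝ (GroupLieAlgebra (𝓡 n) G) ℝ) p.2.1 = c.splitMap x (0, p.2.1, 0) := rfl
    rw [e, hc.splitEquiv_apply, hc.pairing_splitMap 0 0] at h
    have h0 : p.2.1 = 0 := by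
      by_contra hne
      have := c.atOne_pos 0 0 _ hne
      simp [splitPairing_apply] at h
      exact this.ne' h
    rw [hc.splitEquiv_apply, hc.endField_splitMap]
    congr 1
    refine Prod.ext rfl (Prod.ext ?_ rfl)
    simp [splitGend, h0]
  smooth_gend := hc.smoothEnd _ _ (hc.endField_splitMap _)

theorem Components.LeftInv.isOf {c : Components n G} (hc : c.LeftInv)
    (hd : (c.atOne 0 0).IsAlmostKahler) :
    c.IsOf hc.genMetric (hc.endField (c.atOne 0 0).endo) where
  minus_eq x v := by
    have e : ∀ Y, ((leftTrans x Y, -(c.g.inner x (leftTrans x Y)), 0) : Fib n x)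
        = c.splitMap x (0, Y, 0) := fun Y => by simp [c.splitMap_apply]
    constructor
    · rintro ⟨Y, rfl⟩
      exact ⟨leftTrans x Y, (e Y).symm⟩
    · rintro ⟨X, rfl⟩
      obtain ⟨Y, rfl⟩ := leftTrans_surjective hc x X
      exact ⟨Y, (e Y).symm⟩
  Jm_eq x X := by
    obtain ⟨Y, rfl⟩ := leftTrans_surjective hc x X
    have e : ((leftTrans x Y, -(c.g.inner x (leftTrans x Y)), 0) : Fib n x)
        = c.splitMap x (0, Y, 0) := by simp [c.splitMap_apply]
    rw [e, hc.endField_splitMap]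
    simp only [AlgData.endo_apply, c.splitMap_apply, map_zero, zero_smul, zero_add]
    exact hc.Jm x Y
  Jp_eq x X := by
    obtain ⟨Y, rfl⟩ := leftTrans_surjective hc x X
    have e : ((leftTrans x Y, c.g.inner x (leftTrans x Y), 0) : Fib n x)
        = c.splitMap x (Y, 0, 0) := by simp [c.splitMap_apply]
    rw [e, hc.endField_splitMap]
    simp only [AlgData.endo_apply, c.splitMap_apply, map_zero, zero_smul, add_zero]
    exact hc.Jp x Y
  Xp_eq x := by
    have e : ((0, 0, 1) : Fib n x) = c.splitMap x (0, 0, 1) := by simp [c.splitMap_apply]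
    rw [e, hc.endField_splitMap]
    simp only [AlgData.endo_apply, c.splitMap_apply, map_zero, one_smul, zero_add, add_zero]
    exact hc.Xp x
  Xm_eq := by
    refine ⟨c.invSec (0, (c.atOne 0 0).Xm, 0), fun x => ?_, fun x => ?_, fun x => ?_⟩
    · refine (hc.endField_splitMap _ x _).trans ?_
      have : (c.atOne 0 0).endo (0, (c.atOne 0 0).Xm, 0) = 0 := by
        simp [AlgData.endo_apply, hd.Jm.apply_X]
      rw [this, map_zero]
    · refine (hc.pairing_splitMap 0 0 x _ _).trans ?_
      simp [splitPairing_apply, hd.Xm]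
    · have h : (c.invSec (0, (c.atOne 0 0).Xm, 0)).vec x = leftTrans x (0 + c.Xm 1) := rfl
      rw [h, zero_add]
      exact hc.Xm x

/-- Composition with `𝒢^end` only reverses `J₋`, so the second structure is the first one for the
conjugate components. -/
theorem Components.LeftInv.isBnKahler {c : Components n G} (hc : c.LeftInv)
    (hd : (c.atOne 0 0).IsAlmostKahler) (hI : (c.atOne 0 0).IsIntegrable (lieBilin n G))
    (hI' : (c.atOne 0 0).conj.IsIntegrable (lieBilin n G)) :
    IsBnKahler 0 0 hc.genMetric (hc.endField (c.atOne 0 0).endo) := by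
  have hA := hc.endField_splitMap (c.atOne 0 0).endo
  have hgend : ∀ x p, hc.genMetric.gend x (c.splitMap x p) = c.splitMap x (splitGend n G p) :=
    hc.endField_splitMap (splitGend n G)
  have hA' : ∀ x p, (hc.genMetric.gend x ∘ₗ hc.endField (c.atOne 0 0).endo x) (c.conj.splitMap x p)
      = c.conj.splitMap x ((c.conj.atOne 0 0).endo p) := by
    intro x p
    have h1 : (hc.genMetric.gend x ∘ₗ hc.endField (c.atOne 0 0).endo x) (c.splitMap x p)
        = c.splitMap x (splitGend n G ((c.atOne 0 0).endo p)) := by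
      rw [LinearMap.comp_apply, hA, hgend]
    -- Conjugation leaves the metric unchanged, so both trivializations agree by definition.
    exact h1
  have hd' : (c.conj.atOne 0 0).IsAlmostKahler := hd.conj
  refine ⟨fun x => ?_, ⟨hc.isBnAlmostComplex hd _ hA, hc.dorfmanIntegrable hd _ hA hI⟩,
    ⟨hc.conj.isBnAlmostComplex hd' _ hA', hc.conj.dorfmanIntegrable hd' _ hA' hI'⟩⟩
  refine LinearMap.ext fun v => ?_
  obtain ⟨p, rfl⟩ := (hc.splitEquiv x).surjective v
  rw [hc.splitEquiv_apply, LinearMap.comp_apply, LinearMap.comp_apply, hA, hgend, hgend, hA]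
  congr 1
  simp [splitGend, AlgData.endo_apply]

theorem isTwist_zero : IsTwist (0 : FormField n G 3) (0 : FormField n G 2) where
  smooth_H _ _ := contMDiff_const
  smooth_F _ _ := contMDiff_const
  closed_F X Y Z _ _ _ x := by simp [dirDeriv_const]
  dH_eq X Y Z W _ _ _ _ x := by simp [dThree, wedgeSq, dirDeriv_const]

theorem LeftInvForm.eq_zero {c : Components n G} (hc : c.LeftInv) {k : ℕ} {θ : FormField n G k}
    (hθ : LeftInvForm θ) (h : θ 1 = 0) : θ = 0 := by
  funext x
  ext v
  choose w hw using fun i => leftTrans_surjective hc x (v i)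
  have hv : v = fun i => leftTrans x (w i) := funext fun i => (hw i).symm
  rw [hv]
  refine (hθ x w).trans ?_
  rw [h]; rfl

end Construction

/-! ### The two implications in dimension three. -/

section Classification

variable {G : Type*} [TopologicalSpace G] [ChartedSpace (Mod 3) G] [Group G]
  [LieGroup (𝓡 3) ∞ G]

theorem Components.IsOf.exists_isClassified {c : Components 3 G} (hc : c.LeftInv)
    {H : FormField 3 G 3} {F : FormField 3 G 2} (hH : LeftInvForm H) (hF : LeftInvForm F)
    {𝒢 : GenRiemannianMetric 3 G} {A : EEndField 3 G} (h : c.IsOf 𝒢 A)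
    (hK : IsBnKahler H F 𝒢 A) : ∃ r : ℝ, r ≠ 0 ∧ ((c.atOne H F).rescale r).IsClassified := by
  have hd := h.isAlmostKahler hc hK
  have hA := h.splitMap_endo hc hK
  have int := hc.isIntegrable_of_dorfman hH hF hd A hA hK.complex.2
  have hA' : ∀ x p, (𝒢.gend x ∘ₗ A x) (c.conj.splitMap x p)
      = c.conj.splitMap x ((c.conj.atOne H F).endo p) := by
    intro x p
    have e : (𝒢.gend x ∘ₗ A x) (c.splitMap x p) = c.splitMap x (((c.atOne H F).endo p).1,
        -((c.atOne H F).endo p).2.1, ((c.atOne H F).endo p).2.2) := by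
      rw [LinearMap.comp_apply, hA, h.gend_splitMap hc]
    -- The conjugate components have the same trivialization, and reversing the `E₋` part of the
    -- image is the endomorphism with `-J₋`.
    exact e
  have int' : (c.atOne H F).conj.IsIntegrable (lieBilin 3 G) :=
    hc.conj.isIntegrable_of_dorfman hH hF hd.conj _ hA' hK.complex₂.2
  obtain ⟨h₁, h₂⟩ := (c.atOne H F).connection_of_isIntegrable hd (lieBilin 3 G) lieBilin_skew
    int int'
  exact (c.atOne H F).exists_classified hd (finrank_tangentSpace 1) (lieBilin 3 G)
    (fun _ _ => rfl) lieBilin_skew lieBilin_jacobi h₁ h₂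

theorem AlgData.IsClassified.exists_isBnKahler {c : Components 3 G} (hc : c.LeftInv)
    {H : FormField 3 G 3} {F : FormField 3 G 2} (hH : LeftInvForm H) (hF : LeftInvForm F)
    {r : ℝ} (hr : r ≠ 0) (h : ((c.atOne H F).rescale r).IsClassified) :
    IsTwist H F ∧ ∃ (𝒢 : GenRiemannianMetric 3 G) (A : EEndField 3 G),
      IsBnKahler H F 𝒢 A ∧ c.IsOf 𝒢 A := by
  obtain ⟨hH₁, hF₁, hd, nf⟩ := AlgData.IsClassified.normal_form (c.atOne H F) hr h
    (c.atOne_symm H F) (c.atOne_pos H F) (finrank_tangentSpace 1) (lieBilin 3 G)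
    (fun _ _ => rfl) lieBilin_skew
  obtain rfl := hH.eq_zero hc hH₁
  obtain rfl := hF.eq_zero hc hF₁
  exact ⟨isTwist_zero, hc.genMetric, hc.endField (c.atOne 0 0).endo,
    hc.isBnKahler hd ((c.atOne 0 0).isIntegrable hd rfl rfl _ lieBilin_skew nf)
      ((c.atOne 0 0).conj.isIntegrable hd.conj rfl rfl _ lieBilin_skew nf), hc.isOf hd⟩

end Classification

end BnGeometry

end

theorem mainTheorem11 {G : Type*} [TopologicalSpace G]
    [ChartedSpace (EuclideanSpace ℝ (Fin 3)) G] [Group G] [LieGroup (𝓡 3) ∞ G]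
    (H : BnGeometry.FormField 3 G 3) (F : BnGeometry.FormField 3 G 2)
    (hH : BnGeometry.LeftInvForm H) (hF : BnGeometry.LeftInvForm F)
    (c : BnGeometry.Components 3 G) (hc : c.LeftInv) :
    (BnGeometry.IsTwist H F ∧
      ∃ (𝒢 : BnGeometry.GenRiemannianMetric 3 G) (A : BnGeometry.EEndField 3 G),
        BnGeometry.IsBnKahler H F 𝒢 A ∧ c.IsOf 𝒢 A) ↔
    ∃ r : ℝ, r ≠ 0 ∧ ((c.atOne H F).rescale r).IsClassified := by
  constructor
  · rintro ⟨-, 𝒢, A, hK, h⟩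
    exact h.exists_isClassified hc hH hF hK
  · rintro ⟨r, hr, h⟩
    exact h.exists_isBnKahler hc hH hF hr
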